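/- Let $d\ge 2$, let $\Omega\subset\mathbf R^d$ be a bounded domain with a Lipschitz boundary and a connected complement, and let $\sigma\in L^\infty(\Omega;\mathbf R)$ satisfy $\sigma\ge a$ a.e. in $\Omega$ for some constant $a>0$. Let $(f,g)=\int_{\partial\Omega} f\,\overline g\,\mathrm dS$ be the inner product of the complex space $L^2(\partial\Omega)$, and let $L^2_\diamond(\partial\Omega)=\{f\in L^2(\partial\Omega): (1,f)=0\}$. The Neumann-to-Dirichlet operator $\varLambda(\sigma)$ maps $f\in L^2_\diamond(\partial\Omega)$ to the mean-free trace $U=u|_{\partial\Omega}\in L^2_\diamond(\partial\Omega)$ of a solution $u\in H^1(\Omega)$ of $$\int_\Omega \sigma\,\nabla u\cdot\nabla\overline v\,\mathrm dx=\int_{\partial\Omega} f\,\overline v\,\mathrm dS\qquad\text{for all } v\in H^1(\Omega).$$ Then $\varLambda(\sigma)$ is a well-defined (for each $f$ there is exactly one such $U$) bounded linear operator on $L^2_\diamond(\partial\Omega)$. It is compact, self-adjoint and positive, i.e. $(\varLambda(\sigma)f,f)>0$ for $f\ne0$. It has an eigensystem $(\lambda_k,\phi_k)_{k\ge1}$: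 the $\phi_k$ form an orthonormal basis of $L^2_\diamond(\partial\Omega)$, $\varLambda(\sigma)\phi_k=\lambda_k\phi_k$, $\lambda_k\ge\lambda_{k+1}>0$ for all $k$, and $\lambda_k\to0$ as $k\to\infty$. Moreover, for every such eigensystem, the operator $$\log\varLambda(\sigma)\colon g\mapsto\sum_{k=1}^\infty\log(\lambda_k)\,(g,\phi_k)\,\phi_k$$ with the domain $$\mathcal D(\log\varLambda(\sigma))=\Big\{g\in L^2_\diamond(\partial\Omega):\ \sum_{k=1}^\infty\log^2(\lambda_k)\,|(g,\phi_k)|^2<\infty\Big\}$$ is densely defined, self-adjoint (it equals its Hilbert space adjoint, including the domains) and unbounded on $L^2_\diamond(\partial\Omega)$. -/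

import Mathlib

open MeasureTheory Filter Topology
open scoped ContDiff ENNReal ComplexConjugate

noncomputable section

namespace EIT

/-! ### Lipschitz domains, conductivities and function spaces -/

/-- `Ω` has a Lipschitz boundary: near every boundary point, in suitable orthogonal coordinates
`(y', y_d) ∈ ℝ^(d-1) × ℝ`, the set `Ω` is the strict epigraph `{γ(y') < y_d}` of a Lipschitz
function `γ` (so that `frontier Ω` is the graph of `γ` there). -/
def HasLipschitzBoundary {d : ℕ} (Ω : Set (EuclideanSpace ℝ (Fin d))) : Prop :=
  ∀ x₀ ∈ frontier Ω,
    ∃ (L : EuclideanSpace ℝ (Fin d) ≃ₗᵢ[ℝ] WithLp 2 (EuclideanSpace ℝ (Fin (d - 1)) × ℝ))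
      (γ : EuclideanSpace ℝ (Fin (d - 1)) → ℝ) (K : NNReal) (r : ℝ),
      LipschitzWith K γ ∧ 0 < r ∧
        ∀ x ∈ Metric.ball x₀ r, x ∈ Ω ↔ γ (L x).fst < (L x).snd

/-- A bounded domain (nonempty connected open set) with a Lipschitz boundary and a connected
complement. -/
structure IsAdmissibleDomain {d : ℕ} (Ω : Set (EuclideanSpace ℝ (Fin d))) : Prop where
  isOpen : IsOpen Ω
  isConnected : IsConnected Ω
  isBounded : Bornology.IsBounded Ω
  lipschitz : HasLipschitzBoundary Ω
  compl_connected : IsConnected Ωᶜ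

/-- `σ ∈ L^∞_+(Ω)`: real-valued, essentially bounded, and a.e. bounded from below by a positive
constant. -/
def IsConductivity {d : ℕ} (Ω : Set (EuclideanSpace ℝ (Fin d)))
    (σ : EuclideanSpace ℝ (Fin d) → ℝ) : Prop :=
  MemLp σ ∞ (volume.restrict Ω) ∧ ∃ a : ℝ, 0 < a ∧ ∀ᵐ x ∂(volume.restrict Ω), a ≤ σ x

/-- The surface measure of `∂Ω`. -/
def surface {d : ℕ} (Ω : Set (EuclideanSpace ℝ (Fin d))) :
    Measure (EuclideanSpace ℝ (Fin d)) :=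
  (Measure.euclideanHausdorffMeasure (d - 1)).restrict (frontier Ω)

/-- The complex space `L²(∂Ω)`. -/
abbrev BoundaryL2 {d : ℕ} (Ω : Set (EuclideanSpace ℝ (Fin d))) : Type :=
  Lp ℂ 2 (surface Ω)

/-- The mean-free subspace `L²_⋄(∂Ω)`, i.e. the orthogonal complement of the constant function
`1` in `L²(∂Ω)`. -/
abbrev meanFree {d : ℕ} (Ω : Set (EuclideanSpace ℝ (Fin d))) : Submodule ℂ (BoundaryL2 Ω) :=
  (Submodule.span ℂ {e : BoundaryL2 Ω | ⇑e =ᵐ[surface Ω] fun _ => (1 : ℂ)})ᗮ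

/-- The classical partial derivative `∂w/∂x_i`. -/
def partialDeriv {d : ℕ} (i : Fin d) (w : EuclideanSpace ℝ (Fin d) → ℂ)
    (x : EuclideanSpace ℝ (Fin d)) : ℂ :=
  fderiv ℝ w x (EuclideanSpace.single i (1 : ℝ))

/-- `u ∈ H¹(Ω)`, with weak gradient `∇u = G`. -/
structure MemH1 {d : ℕ} (Ω : Set (EuclideanSpace ℝ (Fin d)))
    (u : EuclideanSpace ℝ (Fin d) → ℂ) (G : Fin d → EuclideanSpace ℝ (Fin d) → ℂ) : Prop where
  memLp : MemLp u 2 (volume.restrict Ω)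
  memLp_grad : ∀ i, MemLp (G i) 2 (volume.restrict Ω)
  weak_grad : ∀ (i : Fin d) (ψ : EuclideanSpace ℝ (Fin d) → ℂ),
    ContDiff ℝ ∞ ψ → HasCompactSupport ψ → tsupport ψ ⊆ Ω →
      ∫ x in Ω, u x * partialDeriv i ψ x = - ∫ x in Ω, G i x * ψ x

/-- `g ∈ L²(∂Ω)` is the trace of `u ∈ H¹(Ω)` with weak gradient `G`. The trace operator is the
continuous extension of `w ↦ w|_∂Ω` from the functions that are smooth up to the boundary, so
`g` is the `L²(∂Ω)`-limit of `w n|_∂Ω` for smooth `w n` tending to `u` in `H¹(Ω)`. -/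
def HasTrace {d : ℕ} (Ω : Set (EuclideanSpace ℝ (Fin d)))
    (u : EuclideanSpace ℝ (Fin d) → ℂ) (G : Fin d → EuclideanSpace ℝ (Fin d) → ℂ)
    (g : BoundaryL2 Ω) : Prop :=
  ∃ w : ℕ → EuclideanSpace ℝ (Fin d) → ℂ, (∀ n, ContDiff ℝ ∞ (w n)) ∧
    Tendsto (fun n => eLpNorm (fun x => w n x - u x) 2 (volume.restrict Ω)) atTop (𝓝 0) ∧
    (∀ i, Tendsto (fun n => eLpNorm (fun x => partialDeriv i (w n) x - G i x) 2
      (volume.restrict Ω)) atTop (𝓝 0)) ∧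
    Tendsto (fun n => eLpNorm (fun x => w n x - g x) 2 (surface Ω)) atTop (𝓝 0)

/-! ### The Neumann-to-Dirichlet operator -/

/-- The variational form of the Neumann problem `∇·(σ∇u) = 0` in `Ω`, `σ ∂u/∂ν = f` on `∂Ω`:
`∫_Ω σ ∇u · ∇v̄ dx = ∫_∂Ω f v̄ dS` for all `v ∈ H¹(Ω)`. Here `H = ∇v` and `V = v|_∂Ω`. -/
def IsWeakSolution {d : ℕ} (Ω : Set (EuclideanSpace ℝ (Fin d)))
    (σ : EuclideanSpace ℝ (Fin d) → ℝ) (f : BoundaryL2 Ω)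
    (u : EuclideanSpace ℝ (Fin d) → ℂ) (G : Fin d → EuclideanSpace ℝ (Fin d) → ℂ) : Prop :=
  MemH1 Ω u G ∧
    ∀ (v : EuclideanSpace ℝ (Fin d) → ℂ) (H : Fin d → EuclideanSpace ℝ (Fin d) → ℂ)
      (V : BoundaryL2 Ω), MemH1 Ω v H → HasTrace Ω v H V →
        ∫ x in Ω, (σ x : ℂ) * ∑ i, G i x * conj (H i x) = ∫ x, f x * conj (V x) ∂(surface Ω)

/-- `U` is a mean-free boundary potential `u|_∂Ω` of a solution `u` of the Neumann problem with
conductivity `σ` and mean-free boundary current density `f`. -/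
def IsBoundaryPotential {d : ℕ} (Ω : Set (EuclideanSpace ℝ (Fin d)))
    (σ : EuclideanSpace ℝ (Fin d) → ℝ) (f U : meanFree Ω) : Prop :=
  ∃ (u : EuclideanSpace ℝ (Fin d) → ℂ) (G : Fin d → EuclideanSpace ℝ (Fin d) → ℂ),
    IsWeakSolution Ω σ (f : BoundaryL2 Ω) u G ∧ HasTrace Ω u G (U : BoundaryL2 Ω)

open scoped Classical in
/-- The Neumann-to-Dirichlet operator `Λ(σ) : f ↦ U` on `L²_⋄(∂Ω)`: the bounded operator whose
graph is `IsBoundaryPotential Ω σ` (and `0` if there is no such operator). -/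
def neumannToDirichlet {d : ℕ} (Ω : Set (EuclideanSpace ℝ (Fin d)))
    (σ : EuclideanSpace ℝ (Fin d) → ℝ) : meanFree Ω →L[ℂ] meanFree Ω :=
  if h : ∃ T : meanFree Ω →L[ℂ] meanFree Ω, ∀ f U, IsBoundaryPotential Ω σ f U ↔ U = T f
  then h.choose else 0

/-! ### The spectral logarithm -/

section Spectral

variable {H : Type*} [NormedAddCommGroup H] [InnerProductSpace ℂ H]

/-- `(lam k, φ k)` is an eigensystem of `T`: the `φ k` form an orthonormal basis of `H` and the
`lam k` are the corresponding eigenvalues, positive, non-increasing and tending to zero. -/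
structure IsEigensystem (T : H →L[ℂ] H) (φ : HilbertBasis ℕ ℂ H) (lam : ℕ → ℝ) : Prop where
  pos : ∀ k, 0 < lam k
  antitone : Antitone lam
  tendsto_zero : Tendsto lam atTop (𝓝 0)
  apply_eq : ∀ k, T (φ k) = (lam k : ℂ) • φ k

/-- The domain `{g : ∑ log²(lam k) |(g, φ k)|² < ∞}` of the logarithm. -/
def logDomain (φ : HilbertBasis ℕ ℂ H) (lam : ℕ → ℝ) : Submodule ℂ H where
  carrier := {g | Summable fun k => Real.log (lam k) ^ 2 * ‖inner ℂ (φ k) g‖ ^ 2}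
  zero_mem' := by simp
  add_mem' := by
    intro f g hf hg
    refine Summable.of_nonneg_of_le (fun k => by positivity) (fun k => ?_)
      ((hf.add hg).mul_left 2)
    have h1 : ‖inner ℂ (φ k) (f + g)‖ ^ 2
        ≤ 2 * (‖inner ℂ (φ k) f‖ ^ 2 + ‖inner ℂ (φ k) g‖ ^ 2) := by
      rw [inner_add_right]
      have := norm_add_le (inner ℂ (φ k) f) (inner ℂ (φ k) g)
      nlinarith [norm_nonneg (inner ℂ (φ k) f + inner ℂ (φ k) g),
        sq_nonneg (‖inner ℂ (φ k) f‖ - ‖inner ℂ (φ k) g‖)]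
    have h2 := mul_le_mul_of_nonneg_left h1 (sq_nonneg (Real.log (lam k)))
    linarith
  smul_mem' := by
    intro c g hg
    refine (hg.mul_left (‖c‖ ^ 2)).congr (fun k => ?_)
    rw [inner_smul_right, norm_mul]
    ring

theorem summable_log (φ : HilbertBasis ℕ ℂ H) (lam : ℕ → ℝ) (g : logDomain φ lam) :
    Summable fun k => ((Real.log (lam k) : ℂ) * inner ℂ (φ k) (g : H)) • φ k := by
  have hmem : Memℓp (fun k => (Real.log (lam k) : ℂ) * inner ℂ (φ k) (g : H)) 2 := by
    rw [memℓp_gen_iff (by norm_num)]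
    refine g.2.congr (fun k => ?_)
    norm_num [mul_pow]
  exact (φ.hasSum_repr_symm ⟨_, hmem⟩).summable

/-- The (unbounded) operator `g ↦ ∑ log(lam k) (g, φ k) φ k` with domain `logDomain φ lam`. Here
`(g, φ k)`, which is linear in `g`, is written as `inner ℂ (φ k) g`. -/
def spectralLog (φ : HilbertBasis ℕ ℂ H) (lam : ℕ → ℝ) : H →ₗ.[ℂ] H where
  domain := logDomain φ lam
  toFun :=
    { toFun := fun g => ∑' k, ((Real.log (lam k) : ℂ) * inner ℂ (φ k) (g : H)) • φ k
      map_add' := by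
        intro f g
        rw [← (summable_log φ lam f).tsum_add (summable_log φ lam g)]
        refine tsum_congr (fun k => ?_)
        rw [Submodule.coe_add, inner_add_right, mul_add, add_smul]
      map_smul' := by
        intro c g
        rw [RingHom.id_apply, ← (summable_log φ lam g).tsum_const_smul c]
        refine tsum_congr (fun k => ?_)
        rw [Submodule.coe_smul, inner_smul_right, smul_smul]
        congr 1
        ring }

end Spectral

end EIT

end

/-! The Neumann problem is solved as a coercive variational problem in a Hilbert space of triples
(u, ∇u, u|_∂Ω). `traceSpace` is the closure of the smooth triples in L²(Ω) × L²(Ω)^d × L²(∂Ω). Its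
elements correspond exactly to the Sobolev functions with a trace (`HasTrace.triple_mem`,
`hasTrace_of_mem`, `memH1_of_mem`), and `freeSpace` keeps those with mean-free trace. Estimates
therefore need proof only for smooth functions and pass to the closure.

Two estimates carry the analysis. `IsAdmissibleDomain.rellichEstimate` bounds the L² norm by a small
multiple of the Dirichlet integral plus finitely many integrals: small cubes and Poincaré's
inequality give it on compact subsets, and near the boundary a small shift along the vertical
direction of a Lipschitz chart moves everything into such a subset.
`IsAdmissibleDomain.trace_estimate` bounds the trace by integrating along the vertical direction
over a thin strip. Together they make u ↦ u ∈ L²(Ω) and u ↦ u|_∂Ω compact on `traceSpace`.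
Compactness, and the connectedness of Ω, then yield the Poincaré inequality
`IsAdmissibleDomain.poincare` on `freeSpace`, which is coercivity of ∫ σ ∇u · ∇v̄.

If A is the operator of this form on `freeSpace` and B the trace map into L²_⋄(∂Ω), then Λ(σ) = B
A⁻¹ B† (`exists_solutionOperator`). It is compact because B is, symmetric because A is, and positive
because B† is injective, smooth functions being dense in L²(∂Ω)
(`IsAdmissibleDomain.eq_zero_of_inner_trL`). Testing only with mean-free traces loses nothing, since
f is orthogonal to the constants (`isBoundaryPotential_iff`).

L²_⋄(∂Ω) is infinite-dimensional (`IsAdmissibleDomain.meanFree_infinite`), so peeling off top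
eigenvectors one by one gives an infinite eigensystem with λ_k → 0 (`exists_isEigensystem`). The
logarithm is a real diagonal operator on its maximal domain, hence self-adjoint, and it is unbounded
because log λ_k → -∞. -/

noncomputable section

namespace EIT

/-! ### Spectral theorem for compact positive operators. -/

section SpectralTheory

variable {H : Type*} [NormedAddCommGroup H] [InnerProductSpace ℂ H]

/-- A compact positive definite operator has, on each nonzero closed invariant subspace, an
eigenvector whose eigenvalue dominates the operator there. -/
theorem exists_top_eigenvector [CompleteSpace H] {T : H →L[ℂ] H} (hc : IsCompactOperator T)
    (hs : T.IsSymmetric) (hpos : ∀ f : H, f ≠ 0 → 0 < (inner ℂ f (T f)).re)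
    {K : Submodule ℂ H} (hK : IsClosed (K : Set H)) (hinv : ∀ x ∈ K, T x ∈ K) (hne : K ≠ ⊥) :
    ∃ v ∈ K, ∃ l : ℝ, ‖v‖ = 1 ∧ 0 < l ∧ T v = (l : ℂ) • v ∧ ∀ x ∈ K, ‖T x‖ ≤ l * ‖x‖ := by
  have : CompleteSpace K := hK.completeSpace_coe
  have : Nontrivial K := Submodule.nontrivial_iff_ne_bot.2 hne
  let S : K →L[ℂ] K := T.restrict hinv
  have hSc : IsCompactOperator S := hc.restrict' hinv
  have hSs : S.IsSymmetric := hs.restrict_invariant hinv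
  have hSapp : ∀ x : K, ((S x : K) : H) = T x := fun x => rfl
  -- Some spectral value has modulus equal to the spectral radius, which is `‖S‖` by
  -- self-adjointness. It is nonzero, so compactness makes it an eigenvalue; symmetry and positivity
  -- then make it equal to `‖S‖`, which is the domination claimed.
  obtain ⟨μ, hμ, hμn⟩ := spectrum.exists_nnnorm_eq_spectralRadius S
  rw [S.spectralRadius_eq_nnnorm hSs.isSelfAdjoint] at hμn
  have hμn' : ‖μ‖ = ‖S‖ := by
    have : ‖μ‖₊ = ‖S‖₊ := by exact_mod_cast hμn
    exact congrArg NNReal.toReal this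
  have hS0 : S ≠ 0 := by
    intro h0
    obtain ⟨x, hx⟩ := exists_ne (0 : K)
    have h1 := hpos (x : H) (by simpa using hx)
    rw [← hSapp, h0] at h1
    simp at h1
  have hμ0 : μ ≠ 0 := by
    intro h
    rw [h, norm_zero] at hμn'
    exact hS0 ((ContinuousLinearMap.opNorm_zero_iff S).1 hμn'.symm)
  have hev := (hSc.hasEigenvalue_iff_mem_spectrum hμ0).2 hμ
  obtain ⟨v, hv⟩ := hev.exists_hasEigenvector
  have hvS : S v = μ • v := hv.apply_eq_smul
  have hv0 : (v : H) ≠ 0 := by simpa using hv.2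
  have hvT : T (v : H) = μ • (v : H) := by rw [← hSapp, hvS]; rfl
  have hreal : conj μ = μ := hSs.conj_eigenvalue_eq_self hev
  obtain ⟨l, rfl⟩ := Complex.conj_eq_iff_real.1 hreal
  have hlpos : 0 < l := by
    have h1 := hpos _ hv0
    rw [hvT, inner_smul_right, inner_self_eq_norm_sq_to_K, Complex.re_ofReal_mul] at h1
    have h2 : (((‖(v : H)‖ : ℂ)) ^ 2).re = ‖(v : H)‖ ^ 2 := by
      rw [← Complex.ofReal_pow, Complex.ofReal_re]
    have h3 : 0 < ‖(v : H)‖ ^ 2 := by positivity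
    erw [h2] at h1
    exact (mul_pos_iff_of_pos_right h3).1 h1
  have hl : l = ‖S‖ := by
    rw [← hμn', Complex.norm_real, Real.norm_of_nonneg hlpos.le]
  refine ⟨((‖(v : H)‖ : ℂ)⁻¹) • (v : H), K.smul_mem _ v.2, l, ?_, hlpos, ?_, ?_⟩
  · rw [norm_smul, norm_inv, Complex.norm_real, norm_norm,
      inv_mul_cancel₀ (norm_ne_zero_iff.2 hv0)]
  · rw [map_smul, hvT, smul_comm]
  · intro x hx
    rw [hl]
    exact S.le_opNorm ⟨x, hx⟩

/-- Spectral theorem for compact positive definite operators, with the eigenvalues in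
decreasing order. -/
theorem exists_isEigensystem [CompleteSpace H] (hinf : ¬ FiniteDimensional ℂ H)
    {T : H →L[ℂ] H} (hc : IsCompactOperator T)
    (hs : T.IsSymmetric) (hpos : ∀ f : H, f ≠ 0 → 0 < (inner ℂ f (T f)).re) :
    ∃ (φ : HilbertBasis ℕ ℂ H) (lam : ℕ → ℝ), IsEigensystem T φ lam := by
  -- The state of the recursion is the span of the eigenvectors found so far. Invariance of `F`
  -- passes to `Fᗮ` by symmetry, and finite dimension keeps `Fᗮ` nonzero.
  let St := {F : Submodule ℂ H // FiniteDimensional ℂ F ∧ ∀ x ∈ F, T x ∈ F}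
  have hstep : ∀ F : St, ∃ v ∈ (F.1)ᗮ, ∃ l : ℝ, ‖v‖ = 1 ∧ 0 < l ∧ T v = (l : ℂ) • v ∧
      ∀ x ∈ (F.1)ᗮ, ‖T x‖ ≤ l * ‖x‖ := by
    intro F
    have := F.2.1
    refine exists_top_eigenvector hc hs hpos (F.1.isClosed_orthogonal) ?_ ?_
    · intro x hx
      rw [Submodule.mem_orthogonal] at hx ⊢
      intro u hu
      have h1 : inner ℂ (T u) x = inner ℂ u (T x) := hs u x
      rw [← h1]
      exact hx _ (F.2.2 u hu)
    · intro hbot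
      rw [Submodule.orthogonal_eq_bot_iff] at hbot
      apply hinf
      have h2 := F.2.1
      rw [hbot] at h2
      exact Module.Finite.equiv (Submodule.topEquiv (R := ℂ) (M := H))
  choose v hvF l hv1 hl0 hTv hle using hstep
  have hfin : ∀ F : St, FiniteDimensional ℂ (F.1 ⊔ Submodule.span ℂ {v F} : Submodule ℂ H) := by
    intro F
    have := F.2.1
    infer_instance
  have hnext : ∀ F : St, ∀ x ∈ F.1 ⊔ Submodule.span ℂ {v F},
      T x ∈ F.1 ⊔ Submodule.span ℂ {v F} := by
    intro F x hx
    obtain ⟨y, hy, z, hz, rfl⟩ := Submodule.mem_sup.1 hx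
    obtain ⟨c, rfl⟩ := Submodule.mem_span_singleton.1 hz
    rw [map_add, map_smul, hTv]
    refine Submodule.add_mem_sup (F.2.2 y hy) ?_
    exact Submodule.smul_mem _ _ (Submodule.smul_mem _ _ (Submodule.mem_span_singleton_self _))
  let next : St → St := fun F => ⟨F.1 ⊔ Submodule.span ℂ {v F}, hfin F, hnext F⟩
  let F0 : St := ⟨⊥, inferInstance, by simp⟩
  let F : ℕ → St := fun n => next^[n] F0
  have hFs : ∀ n, (F (n + 1)).1 = (F n).1 ⊔ Submodule.span ℂ {v (F n)} := by
    intro n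
    simp only [F, Function.iterate_succ_apply', next]
  have hFmono : Monotone fun n => (F n).1 := monotone_nat_of_le_succ fun n => by
    rw [hFs]; exact le_sup_left
  have hmem : ∀ n, v (F n) ∈ (F (n + 1)).1 := fun n => by
    rw [hFs]
    exact Submodule.mem_sup_right (Submodule.mem_span_singleton_self _)
  have hlt : ∀ m n, m < n → inner ℂ (v (F m)) (v (F n)) = 0 := fun m n hmn =>
    (Submodule.mem_orthogonal _ _).1 (hvF (F n)) _ (hFmono (Nat.succ_le_of_lt hmn) (hmem m))
  have hon : Orthonormal ℂ fun n => v (F n) := by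
    refine ⟨fun n => hv1 _, fun m n hmn => ?_⟩
    rcases lt_or_gt_of_ne hmn with h | h
    · exact hlt m n h
    · exact inner_eq_zero_symm.1 (hlt n m h)
  have hnormT : ∀ n, ‖T (v (F n))‖ = l (F n) := fun n => by
    rw [hTv, norm_smul, hv1, Complex.norm_real, Real.norm_of_nonneg (hl0 _).le, mul_one]
  -- A later eigenvector lies in every earlier complement, where the earlier eigenvalue bounds `T`.
  have hanti : Antitone fun n => l (F n) := by
    intro m n hmn
    have h1 := hle (F m) (v (F n)) (Submodule.orthogonal_le (hFmono hmn) (hvF _))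
    rwa [hnormT, hv1, mul_one] at h1
  have hlim : Tendsto (fun n => l (F n)) atTop (𝓝 0) := by
    obtain ⟨C, hC, hsub⟩ := hc.image_closedBall_subset_compact (f := (T : H →ₗ[ℂ] H)) 1
    obtain ⟨a, -, ψ, hψ, hlima⟩ := hC.tendsto_subseq (x := fun n => T (v (F n)))
      (fun n => hsub ⟨_, by simp [hv1], rfl⟩)
    -- An orthonormal sequence tends weakly to zero by Bessel's inequality, so the strong limit `a`
    -- of `T (v (F (ψ n)))` must vanish. Its norms are the eigenvalues, and monotonicity extends the
    -- limit to the whole sequence.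
    have ha : inner ℂ a a = (0 : ℂ) := by
      have h1 : Tendsto (fun n => inner ℂ a (T (v (F (ψ n))))) atTop (𝓝 (inner ℂ a a)) :=
        (tendsto_const_nhds (x := a)).inner hlima
      have h2 : Tendsto (fun n => ‖inner ℂ (v (F n)) a‖ ^ 2) atTop (𝓝 0) :=
        (hon.inner_products_summable a).tendsto_atTop_zero
      have h3 : Tendsto (fun n => ‖inner ℂ (v (F n)) a‖) atTop (𝓝 0) := by
        have := h2.sqrt
        simpa using this
      have h4 : Tendsto (fun n => l (F 0) * ‖inner ℂ (v (F (ψ n))) a‖) atTop (𝓝 0) := by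
        simpa using (h3.comp hψ.tendsto_atTop).const_mul (l (F 0))
      refine tendsto_nhds_unique h1 (squeeze_zero_norm (fun n => ?_) h4)
      rw [hTv, inner_smul_right, norm_mul, Complex.norm_real, Real.norm_of_nonneg (hl0 _).le,
        norm_inner_symm]
      exact mul_le_mul_of_nonneg_right (hanti (Nat.zero_le _)) (norm_nonneg _)
    rw [inner_self_eq_zero] at ha
    have h5 : Tendsto (fun n => l (F (ψ n))) atTop (𝓝 0) := by
      have := hlima.norm
      rw [ha, norm_zero] at this
      exact this.congr fun n => hnormT _
    exact (tendsto_iff_tendsto_subseq_of_antitone hanti hψ.tendsto_atTop).2 h5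
  have hcomplete : (Submodule.span ℂ (Set.range fun n => v (F n)))ᗮ = ⊥ := by
    rw [Submodule.eq_bot_iff]
    intro x hx
    have hxv : ∀ n, inner ℂ (v (F n)) x = 0 := fun n =>
      (Submodule.mem_orthogonal _ _).1 hx _ (Submodule.subset_span ⟨n, rfl⟩)
    have hxF : ∀ n, x ∈ ((F n).1)ᗮ := by
      intro n
      induction n with
      | zero => simp [F, F0]
      | succ n ih =>
        rw [hFs, ← Submodule.inf_orthogonal]
        refine ⟨ih, ?_⟩
        rw [SetLike.mem_coe, Submodule.mem_orthogonal_singleton_iff_inner_right]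
        exact hxv n
    -- A vector orthogonal to all eigenvectors lies in every complement, so every `l (F n)` bounds
    -- `T` on it; then `T x = 0`, against positivity.
    have h1 : ‖T x‖ ≤ 0 := by
      have h2 : Tendsto (fun n => l (F n) * ‖x‖) atTop (𝓝 0) := by
        simpa using hlim.mul_const ‖x‖
      exact ge_of_tendsto' h2 fun n => hle (F n) x (hxF n)
    by_contra hx0
    have h3 := hpos x hx0
    rw [norm_le_zero_iff.1 h1] at h3
    simp at h3
  refine ⟨HilbertBasis.mkOfOrthogonalEqBot hon hcomplete, fun n => l (F n),
    fun n => hl0 _, hanti, hlim, fun n => ?_⟩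
  rw [HilbertBasis.coe_mkOfOrthogonalEqBot]
  exact hTv _

/-! ### The logarithm as a diagonal operator. -/

theorem inner_spectralLog (φ : HilbertBasis ℕ ℂ H) (lam : ℕ → ℝ)
    (g : (spectralLog φ lam).domain) (k : ℕ) :
    inner ℂ (φ k) (spectralLog φ lam g) = (Real.log (lam k) : ℂ) * inner ℂ (φ k) (g : H) := by
  have h := (summable_log φ lam g).hasSum.mapL (innerSL ℂ (φ k))
  refine (h.unique ?_)
  have hz : ∀ j, j ≠ k → innerSL ℂ (φ k)
      (((Real.log (lam j) : ℂ) * inner ℂ (φ j) (g : H)) • φ j) = 0 := by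
    intro j hj
    rw [innerSL_apply_apply, inner_smul_right, φ.orthonormal.2 hj.symm, mul_zero]
  have h2 := hasSum_single k hz
  rwa [innerSL_apply_apply, inner_smul_right, inner_self_eq_norm_sq_to_K, φ.orthonormal.1 k,
    RCLike.ofReal_one, one_pow, mul_one] at h2

theorem basis_mem_logDomain (φ : HilbertBasis ℕ ℂ H) (lam : ℕ → ℝ) (k : ℕ) :
    φ k ∈ logDomain φ lam := by
  refine summable_of_ne_finset_zero (s := {k}) fun j hj => ?_
  rw [Finset.mem_singleton] at hj
  rw [φ.orthonormal.2 hj, norm_zero]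
  ring

theorem spectralLog_basis (φ : HilbertBasis ℕ ℂ H) (lam : ℕ → ℝ) (k : ℕ) :
    spectralLog φ lam ⟨φ k, basis_mem_logDomain φ lam k⟩ = (Real.log (lam k) : ℂ) • φ k := by
  have h := hasSum_single (f := fun j => ((Real.log (lam j) : ℂ) * inner ℂ (φ j) (φ k)) • φ j) k
    (fun j hj => by rw [φ.orthonormal.2 hj, mul_zero, zero_smul])
  rw [inner_self_eq_norm_sq_to_K, φ.orthonormal.1 k,
    RCLike.ofReal_one, one_pow, mul_one] at h
  exact h.tsum_eq

theorem dense_spectralLog_domain (φ : HilbertBasis ℕ ℂ H) (lam : ℕ → ℝ) :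
    Dense ((spectralLog φ lam).domain : Set H) := by
  have h : Submodule.span ℂ (Set.range φ) ≤ (spectralLog φ lam).domain :=
    Submodule.span_le.2 (by rintro _ ⟨k, rfl⟩; exact basis_mem_logDomain φ lam k)
  exact (Submodule.dense_iff_topologicalClosure_eq_top.2 φ.dense_span).mono h

/-- Real diagonal entries give symmetry. For the domains, pairing the adjoint at `y` with the basis
vectors shows that its coefficients are log λ_k times those of `y`. They are square summable by
Bessel, which is exactly membership of `y` in the domain. -/
theorem isSelfAdjoint_spectralLog [CompleteSpace H] (φ : HilbertBasis ℕ ℂ H) (lam : ℕ → ℝ) :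
    IsSelfAdjoint (spectralLog φ lam) := by
  have hd := dense_spectralLog_domain φ lam
  have hformal : (spectralLog φ lam).IsFormalAdjoint (spectralLog φ lam) := by
    intro x y
    rw [← φ.tsum_inner_mul_inner, ← φ.tsum_inner_mul_inner]
    refine tsum_congr fun k => ?_
    rw [inner_spectralLog, ← inner_conj_symm (spectralLog φ lam x), inner_spectralLog, map_mul,
      inner_conj_symm, Complex.conj_ofReal]
    ring
  rw [LinearPMap.isSelfAdjoint_def]
  symm
  refine LinearPMap.eq_of_le_of_domain_eq (hformal.le_adjoint hd) (le_antisymm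
    (hformal.le_adjoint hd).1 fun y hy => ?_)
  have hadj := LinearPMap.adjoint_isFormalAdjoint hd ⟨y, hy⟩
  have hw : ∀ k, inner ℂ (φ k) ((spectralLog φ lam).adjoint ⟨y, hy⟩)
      = (Real.log (lam k) : ℂ) * inner ℂ (φ k) y := by
    intro k
    have h1 := hadj ⟨φ k, basis_mem_logDomain φ lam k⟩
    rw [spectralLog_basis, inner_smul_right] at h1
    rw [← inner_conj_symm, h1, map_mul, Complex.conj_ofReal, inner_conj_symm]
  refine (φ.orthonormal.inner_products_summable ((spectralLog φ lam).adjoint ⟨y, hy⟩)).congr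
    fun k => ?_
  rw [hw, norm_mul, mul_pow, Complex.norm_real, Real.norm_eq_abs, sq_abs]

/-- A bound would hold on the unit vectors `φ k`, hence for all |log λ_k|, although λ_k → 0. -/
theorem spectralLog_unbounded {T : H →L[ℂ] H} {φ : HilbertBasis ℕ ℂ H} {lam : ℕ → ℝ}
    (h : IsEigensystem T φ lam) :
    ¬ ∃ C : ℝ, ∀ g : (spectralLog φ lam).domain, ‖spectralLog φ lam g‖ ≤ C * ‖g‖ := by
  rintro ⟨C, hC⟩
  have h1 : ∀ k, |Real.log (lam k)| ≤ C := by
    intro k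
    have h2 := hC ⟨φ k, basis_mem_logDomain φ lam k⟩
    rw [spectralLog_basis, norm_smul, Submodule.coe_norm, φ.orthonormal.1 k, Complex.norm_real,
      Real.norm_eq_abs, mul_one, mul_one] at h2
    exact h2
  have h3 : Tendsto (fun k => Real.log (lam k)) atTop atBot :=
    Real.tendsto_log_nhdsGT_zero.comp
      (tendsto_nhdsWithin_iff.2 ⟨h.tendsto_zero, Eventually.of_forall h.pos⟩)
  obtain ⟨k, hk⟩ := (h3.eventually (eventually_lt_atBot (-C))).exists
  have := (abs_le.1 (h1 k)).1
  linarith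

end SpectralTheory

/-! ### Translation and Poincaré estimates -/

/-- Cauchy–Schwarz against the constant 1. -/
theorem sq_lintegral_le {α : Type*} [MeasurableSpace α] (μ : Measure α) {f : α → ℝ≥0∞}
    (hf : AEMeasurable f μ) :
    (∫⁻ x, f x ∂μ) ^ 2 ≤ μ Set.univ * ∫⁻ x, f x ^ 2 ∂μ := by
  have h := ENNReal.lintegral_mul_le_Lp_mul_Lq μ Real.HolderConjugate.two_two hf
    (aemeasurable_const (b := (1 : ℝ≥0∞)))
  simp only [Pi.mul_apply, mul_one, ENNReal.one_rpow, lintegral_const, one_mul] at h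
  have h2 := pow_le_pow_left₀ zero_le h 2
  rw [mul_pow, ← ENNReal.rpow_mul_natCast, ← ENNReal.rpow_mul_natCast] at h2
  norm_num at h2
  rwa [mul_comm] at h2

theorem enorm_add_sq_le (a b : ℂ) : ‖a + b‖ₑ ^ 2 ≤ 2 * ‖a‖ₑ ^ 2 + 2 * ‖b‖ₑ ^ 2 := by
  have h : ‖a + b‖ ^ 2 ≤ 2 * ‖a‖ ^ 2 + 2 * ‖b‖ ^ 2 := by
    nlinarith [norm_add_le a b, norm_nonneg (a + b), sq_nonneg (‖a‖ - ‖b‖)]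
  have h2 := ENNReal.ofReal_le_ofReal h
  rw [ENNReal.ofReal_add (by positivity) (by positivity), ENNReal.ofReal_mul (by norm_num),
    ENNReal.ofReal_mul (by norm_num), ENNReal.ofReal_pow (norm_nonneg _),
    ENNReal.ofReal_pow (norm_nonneg _), ENNReal.ofReal_pow (norm_nonneg _), ofReal_norm,
    ofReal_norm, ofReal_norm, ENNReal.ofReal_ofNat] at h2
  exact h2

theorem lintegral_translate_le {E : Type*} [NormedAddCommGroup E] [MeasurableSpace E]
    [BorelSpace E] (μ : Measure E) [μ.IsAddRightInvariant] {A U : Set E} (hA : MeasurableSet A) (hU : MeasurableSet U) (v : E)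
    (h : ∀ x ∈ A, x + v ∈ U) (f : E → ℝ≥0∞) :
    ∫⁻ x in A, f (x + v) ∂μ ≤ ∫⁻ x in U, f x ∂μ := by
  rw [← lintegral_indicator hA, ← lintegral_indicator hU,
    ← lintegral_add_right_eq_self (U.indicator f) v]
  refine lintegral_mono fun x => ?_
  by_cases hx : x ∈ A
  · rw [Set.indicator_of_mem hx, Set.indicator_of_mem (h x hx)]
  · rw [Set.indicator_of_notMem hx]
    exact zero_le

section Normed

variable {E : Type*} [NormedAddCommGroup E] [NormedSpace ℝ E]

theorem continuous_enorm_fderiv_sq {w : E → ℂ} (hw : ContDiff ℝ ∞ w) :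
    Continuous fun x => ‖fderiv ℝ w x‖ₑ ^ 2 :=
  (ENNReal.continuous_pow 2).comp (hw.continuous_fderiv (by simp)).enorm

/-- The fundamental theorem of calculus along the segment, followed by Cauchy–Schwarz in the
parameter. Working with extended norms avoids integrability conditions in the estimates built on it.
-/
theorem enorm_sub_sq_le_lintegral {w : E → ℂ} (hw : ContDiff ℝ ∞ w) (x v : E) {s : ℝ}
    (hs : 0 ≤ s) :
    ‖w (x + s • v) - w x‖ₑ ^ 2 ≤
      ENNReal.ofReal s * ‖v‖ₑ ^ 2 * ∫⁻ ρ in Set.Ioc 0 s, ‖fderiv ℝ w (x + ρ • v)‖ₑ ^ 2 := by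
  have hcf := hw.continuous_fderiv (by simp)
  have hline : ∀ ρ : ℝ, HasDerivAt (fun ρ : ℝ => x + ρ • v) v ρ := fun ρ => by
    simpa using ((hasDerivAt_id ρ).smul_const v).const_add x
  have hderiv : ∀ ρ : ℝ, HasDerivAt (fun ρ : ℝ => w (x + ρ • v))
      (fderiv ℝ w (x + ρ • v) v) ρ := fun ρ =>
    ((hw.differentiable (by simp)) _).hasFDerivAt.comp_hasDerivAt ρ (hline ρ)
  have hcont : Continuous fun ρ : ℝ => fderiv ℝ w (x + ρ • v) := hcf.comp (by fun_prop)
  have hftc := intervalIntegral.integral_eq_sub_of_hasDerivAt (a := 0) (b := s)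
    (fun ρ _ => hderiv ρ) ((hcont.clm_apply continuous_const).intervalIntegrable _ _)
  rw [zero_smul, add_zero, intervalIntegral.integral_of_le hs] at hftc
  rw [← hftc]
  have h1 : ‖∫ ρ in Set.Ioc 0 s, fderiv ℝ w (x + ρ • v) v‖ₑ ≤
      ∫⁻ ρ in Set.Ioc 0 s, ‖fderiv ℝ w (x + ρ • v)‖ₑ * ‖v‖ₑ :=
    (enorm_integral_le_lintegral_enorm _).trans
      (lintegral_mono fun ρ => ContinuousLinearMap.le_opENorm _ _)
  have hm : Measurable fun ρ : ℝ => ‖fderiv ℝ w (x + ρ • v)‖ₑ := hcont.enorm.measurable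
  rw [lintegral_mul_const _ hm] at h1
  refine (pow_le_pow_left₀ zero_le h1 2).trans ?_
  rw [mul_pow]
  have h2 := sq_lintegral_le (volume.restrict (Set.Ioc 0 s)) hm.aemeasurable
  rw [Measure.restrict_apply_univ, Real.volume_Ioc, sub_zero] at h2
  calc _ ≤ _ := mul_le_mul_left h2 _
    _ = _ := by ring

variable [MeasurableSpace E] [BorelSpace E] [FiniteDimensional ℝ E] (μ : Measure E)
  [μ.IsAddHaarMeasure]

/-- The `L²` modulus of continuity of a smooth function is controlled by its gradient. -/
theorem lintegral_translate_sub_le {A U : Set E} (hA : MeasurableSet A) (hU : MeasurableSet U)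
    (v : E) (h : ∀ x ∈ A, ∀ ρ ∈ Set.Icc (0 : ℝ) 1, x + ρ • v ∈ U) {w : E → ℂ}
    (hw : ContDiff ℝ ∞ w) :
    ∫⁻ x in A, ‖w (x + v) - w x‖ₑ ^ 2 ∂μ ≤ ‖v‖ₑ ^ 2 * ∫⁻ x in U, ‖fderiv ℝ w x‖ₑ ^ 2 ∂μ := by
  have hc := continuous_enorm_fderiv_sq hw
  calc ∫⁻ x in A, ‖w (x + v) - w x‖ₑ ^ 2 ∂μ
      ≤ ∫⁻ x in A, ‖v‖ₑ ^ 2 * (∫⁻ ρ in Set.Ioc (0 : ℝ) 1, ‖fderiv ℝ w (x + ρ • v)‖ₑ ^ 2) ∂μ :=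
        lintegral_mono fun x => by
          have := enorm_sub_sq_le_lintegral hw x v zero_le_one
          rwa [one_smul, ENNReal.ofReal_one, one_mul] at this
    _ = ‖v‖ₑ ^ 2 * ∫⁻ x in A, (∫⁻ ρ in Set.Ioc (0 : ℝ) 1, ‖fderiv ℝ w (x + ρ • v)‖ₑ ^ 2) ∂μ := by
        rw [lintegral_const_mul']
        simp
    _ = ‖v‖ₑ ^ 2 * ∫⁻ ρ in Set.Ioc (0 : ℝ) 1, ∫⁻ x in A, ‖fderiv ℝ w (x + ρ • v)‖ₑ ^ 2 ∂μ := by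
        rw [lintegral_lintegral_swap]
        have : Continuous (Function.uncurry fun (x : E) (ρ : ℝ) =>
            ‖fderiv ℝ w (x + ρ • v)‖ₑ ^ 2) :=
          hc.comp (f := fun p : E × ℝ => p.1 + p.2 • v) (by fun_prop)
        exact this.measurable.aemeasurable
    _ ≤ ‖v‖ₑ ^ 2 * ∫⁻ ρ in Set.Ioc (0 : ℝ) 1, ∫⁻ x in U, ‖fderiv ℝ w x‖ₑ ^ 2 ∂μ := by
        gcongr ‖v‖ₑ ^ 2 * ?_
        refine setLIntegral_mono measurable_const fun ρ hρ => ?_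
        exact lintegral_translate_le μ hA hU (ρ • v)
          (fun x hx => h x hx ρ (Set.Ioc_subset_Icc_self hρ)) fun x => ‖fderiv ℝ w x‖ₑ ^ 2
    _ = _ := by simp

/-- Substituting y = x + v and exchanging the integrals leaves, for each v, a translation estimate.
Convexity keeps the segments inside `Q`, and only v of norm at most δ contribute. -/
theorem lintegral_lintegral_sub_le {Q : Set E} (hQ : MeasurableSet Q) (hconv : Convex ℝ Q) {δ : ℝ}
    (hδ : ∀ x ∈ Q, ∀ y ∈ Q, ‖y - x‖ ≤ δ) {w : E → ℂ} (hw : ContDiff ℝ ∞ w) :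
    ∫⁻ x in Q, ∫⁻ y in Q, ‖w y - w x‖ₑ ^ 2 ∂μ ∂μ ≤
      ENNReal.ofReal δ ^ 2 * μ (Metric.closedBall 0 δ) * ∫⁻ x in Q, ‖fderiv ℝ w x‖ₑ ^ 2 ∂μ := by
  have hwm : Measurable w := hw.continuous.measurable
  set D := ∫⁻ x in Q, ‖fderiv ℝ w x‖ₑ ^ 2 ∂μ with hD
  -- The indicators turn the integral over a v-dependent set into one over the whole product, where
  -- Tonelli applies.
  let f : E → E → ℝ≥0∞ := fun x v => Q.indicator 1 x * Q.indicator 1 (x + v) *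
    ‖w (x + v) - w x‖ₑ ^ 2
  have h1Q : Measurable (Q.indicator (1 : E → ℝ≥0∞)) := measurable_one.indicator hQ
  have hf : Measurable (Function.uncurry f) := by
    refine ((h1Q.comp measurable_fst).mul (h1Q.comp (measurable_fst.add measurable_snd))).mul ?_
    exact (((hwm.comp (measurable_fst.add measurable_snd)).sub
      (hwm.comp measurable_fst)).enorm).pow_const 2
  have hstep : ∀ x, Q.indicator 1 x * ∫⁻ y in Q, ‖w y - w x‖ₑ ^ 2 ∂μ = ∫⁻ v, f x v ∂μ := by
    intro x
    rw [← lintegral_indicator hQ, ← lintegral_add_left_eq_self _ x, ← lintegral_const_mul']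
    · refine lintegral_congr fun v => ?_
      simp only [f, mul_assoc]
      by_cases hv : x + v ∈ Q <;> simp [hv]
    · by_cases hx : x ∈ Q <;> simp [hx]
  calc ∫⁻ x in Q, ∫⁻ y in Q, ‖w y - w x‖ₑ ^ 2 ∂μ ∂μ
      = ∫⁻ x, ∫⁻ v, f x v ∂μ ∂μ := by
        rw [← lintegral_indicator hQ]
        refine lintegral_congr fun x => ?_
        rw [← hstep]
        by_cases hx : x ∈ Q <;> simp [hx]
    _ = ∫⁻ v, ∫⁻ x, f x v ∂μ ∂μ := lintegral_lintegral_swap hf.aemeasurable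
    _ ≤ ∫⁻ v, (Metric.closedBall (0 : E) δ).indicator
          (fun _ => ENNReal.ofReal δ ^ 2 * D) v ∂μ := by
        refine lintegral_mono fun v => ?_
        by_cases hv : v ∈ Metric.closedBall (0 : E) δ
        · rw [Set.indicator_of_mem hv]
          have hA : MeasurableSet (Q ∩ (fun x => x + v) ⁻¹' Q) :=
            hQ.inter (measurable_add_const v hQ)
          have h1 := lintegral_translate_sub_le μ hA hQ v (fun x hx ρ hρ => by
            have := hconv hx.1 hx.2 (sub_nonneg.2 hρ.2) hρ.1 (by ring)
            convert this using 1
            module) hw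
          have hvδ : ‖v‖ₑ ≤ ENNReal.ofReal δ := by
            rw [← ofReal_norm]
            exact ENNReal.ofReal_le_ofReal (by simpa using hv)
          refine le_trans ?_ (h1.trans (mul_le_mul_left (pow_le_pow_left₀ zero_le hvδ 2) _))
          rw [← lintegral_indicator hA]
          refine lintegral_mono fun x => ?_
          simp only [f]
          by_cases hx : x ∈ Q <;> by_cases hxv : x + v ∈ Q <;> simp [hx, hxv]
        · rw [Set.indicator_of_notMem hv]
          refine le_of_eq ?_
          refine (lintegral_congr fun x => ?_).trans lintegral_zero
          simp only [f]
          by_cases hx : x ∈ Q <;> by_cases hxv : x + v ∈ Q <;> simp [hx, hxv]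
          exact (hv (by simpa using hδ x hx _ hxv)).elim
    _ = _ := by
        rw [lintegral_indicator Metric.isClosed_closedBall.measurableSet, lintegral_const,
          Measure.restrict_apply_univ]
        ring

/-- Poincaré's inequality on convex sets. -/
theorem lintegral_sub_average_le {Q : Set E} (hQ : MeasurableSet Q) (hconv : Convex ℝ Q) {δ : ℝ}
    (hδ : ∀ x ∈ Q, ∀ y ∈ Q, ‖y - x‖ ≤ δ) (h0 : μ Q ≠ 0) (h1 : μ Q ≠ ⊤) {w : E → ℂ}
    (hw : ContDiff ℝ ∞ w) (hwi : IntegrableOn w Q μ) :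
    ∫⁻ x in Q, ‖w x - ⨍ y in Q, w y ∂μ‖ₑ ^ 2 ∂μ ≤
      (μ Q)⁻¹ * (ENNReal.ofReal δ ^ 2 * μ (Metric.closedBall 0 δ)) *
        ∫⁻ x in Q, ‖fderiv ℝ w x‖ₑ ^ 2 ∂μ := by
  have hpt : ∀ x, ‖w x - ⨍ y in Q, w y ∂μ‖ₑ ^ 2 ≤ (μ Q)⁻¹ * ∫⁻ y in Q, ‖w y - w x‖ₑ ^ 2 ∂μ := by
    intro x
    have hint : IntegrableOn (fun y => w y - w x) Q μ := hwi.sub (integrableOn_const h1)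
    -- The deviation from the mean is itself a mean of differences, so Cauchy–Schwarz reduces the
    -- inequality to the double integral of `lintegral_lintegral_sub_le`.
    have heq : w x - ⨍ y in Q, w y ∂μ = - ⨍ y in Q, (w y - w x) ∂μ := by
      have hr : μ.real Q ≠ 0 := (measureReal_ne_zero_iff h1).2 h0
      rw [setAverage_eq, setAverage_eq, integral_sub hwi (integrableOn_const h1),
        setIntegral_const, smul_sub, inv_smul_smul₀ hr, neg_sub]
    have h2 : ‖⨍ y in Q, (w y - w x) ∂μ‖ₑ ≤ (μ Q)⁻¹ * ∫⁻ y in Q, ‖w y - w x‖ₑ ∂μ := by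
      rw [setAverage_eq, enorm_smul]
      have : ‖(μ.real Q)⁻¹‖ₑ = (μ Q)⁻¹ := by
        have hr : 0 < μ.real Q := (measureReal_nonneg).lt_of_ne'
          ((measureReal_ne_zero_iff h1).2 h0)
        rw [Real.enorm_eq_ofReal (by positivity), ENNReal.ofReal_inv_of_pos hr, measureReal_def,
          ENNReal.ofReal_toReal h1]
      rw [this]
      gcongr
      exact enorm_integral_le_lintegral_enorm _
    have h3 := sq_lintegral_le (μ.restrict Q) (f := fun y => ‖w y - w x‖ₑ)
      (hw.continuous.sub continuous_const).enorm.measurable.aemeasurable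
    rw [Measure.restrict_apply_univ] at h3
    rw [heq, enorm_neg]
    calc _ ≤ ((μ Q)⁻¹ * ∫⁻ y in Q, ‖w y - w x‖ₑ ∂μ) ^ 2 := pow_le_pow_left₀ zero_le h2 2
      _ = (μ Q)⁻¹ ^ 2 * (∫⁻ y in Q, ‖w y - w x‖ₑ ∂μ) ^ 2 := mul_pow _ _ _
      _ ≤ (μ Q)⁻¹ ^ 2 * (μ Q * ∫⁻ y in Q, ‖w y - w x‖ₑ ^ 2 ∂μ) := by gcongr
      _ = (μ Q)⁻¹ * (((μ Q)⁻¹ * μ Q) * ∫⁻ y in Q, ‖w y - w x‖ₑ ^ 2 ∂μ) := by ring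
      _ = _ := by rw [ENNReal.inv_mul_cancel h0 h1, one_mul]
  refine (lintegral_mono hpt).trans ?_
  rw [lintegral_const_mul' _ _ (ENNReal.inv_ne_top.2 h0), mul_assoc]
  gcongr
  exact lintegral_lintegral_sub_le μ hQ hconv hδ hw

end Normed

/-! ### Rellich estimates in the interior -/

/-- Up to finitely many averages and a small multiple of the Dirichlet integral, the `L²(S)` norm
of smooth functions vanishes. -/
def RellichEstimate {d : ℕ} (Ω S : Set (EuclideanSpace ℝ (Fin d))) : Prop :=
  ∀ ε : ℝ≥0∞, ε ≠ 0 → ∃ (ι : Type) (_ : Fintype ι) (Q : ι → Set (EuclideanSpace ℝ (Fin d)))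
    (C : ℝ≥0∞), C ≠ ⊤ ∧ (∀ i, MeasurableSet (Q i) ∧ Q i ⊆ Ω) ∧
      ∀ w : EuclideanSpace ℝ (Fin d) → ℂ, ContDiff ℝ ∞ w →
        ∫⁻ x in S, ‖w x‖ₑ ^ 2 ≤
          ε * (∫⁻ x in Ω, ‖fderiv ℝ w x‖ₑ ^ 2) + C * ∑ i, ‖∫ x in Q i, w x‖ₑ ^ 2

/-- The half-open cube of side `h` with index `k` in the cubical grid. -/
def gridCell {d : ℕ} (h : ℝ) (k : Fin d → ℤ) : Set (EuclideanSpace ℝ (Fin d)) :=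
  {x | ∀ i, x i ∈ Set.Ico (h * k i) (h * k i + h)}

section Grid

variable {d : ℕ} {h : ℝ}

theorem gridCell_eq_preimage (k : Fin d → ℤ) :
    gridCell h k = (WithLp.ofLp : EuclideanSpace ℝ (Fin d) → Fin d → ℝ) ⁻¹'
      (Set.univ.pi fun i => Set.Ico (h * k i) (h * k i + h)) := by
  ext x
  simp [gridCell]

theorem measurableSet_gridCell (k : Fin d → ℤ) : MeasurableSet (gridCell h k) := by
  rw [gridCell_eq_preimage]
  exact (MeasurableSet.univ_pi fun i => measurableSet_Ico).preimage
    (PiLp.volume_preserving_ofLp (Fin d)).measurable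

theorem volume_gridCell (k : Fin d → ℤ) : volume (gridCell h k) = ENNReal.ofReal h ^ d := by
  rw [gridCell_eq_preimage, (PiLp.volume_preserving_ofLp (Fin d)).measure_preimage
    (MeasurableSet.univ_pi fun i => measurableSet_Ico).nullMeasurableSet, volume_pi_pi]
  simp

theorem convex_gridCell (k : Fin d → ℤ) : Convex ℝ (gridCell h k) := by
  intro x hx y hy a b ha hb hab i
  have := (convex_Ico (𝕜 := ℝ) (h * k i) (h * k i + h)) (hx i) (hy i) ha hb hab
  simpa using this

theorem norm_sub_le_of_mem_gridCell (hh : 0 < h) (k : Fin d → ℤ)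
    {x y : EuclideanSpace ℝ (Fin d)} (hx : x ∈ gridCell h k) (hy : y ∈ gridCell h k) :
    ‖y - x‖ ≤ h * √d := by
  rw [EuclideanSpace.norm_eq]
  have h1 : ∑ i, ‖(y - x) i‖ ^ 2 ≤ h ^ 2 * d := by
    calc ∑ i, ‖(y - x) i‖ ^ 2 ≤ ∑ _i : Fin d, h ^ 2 := by
          refine Finset.sum_le_sum fun i _ => ?_
          have h1 := hx i
          have h2 := hy i
          rw [Set.mem_Ico] at h1 h2
          rw [PiLp.sub_apply, Real.norm_eq_abs, sq_abs]
          refine sq_le_sq' ?_ ?_ <;> linarith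
      _ = h ^ 2 * d := by simp [mul_comm]
  calc √(∑ i, ‖(y - x) i‖ ^ 2) ≤ √(h ^ 2 * d) := Real.sqrt_le_sqrt h1
    _ = h * √d := by rw [Real.sqrt_mul (sq_nonneg h), Real.sqrt_sq hh.le]

theorem mem_gridCell_floor (hh : 0 < h) (x : EuclideanSpace ℝ (Fin d)) :
    x ∈ gridCell h fun i => ⌊x i / h⌋ := by
  intro i
  have h1 := Int.floor_le (x i / h)
  have h2 := Int.lt_floor_add_one (x i / h)
  rw [le_div_iff₀ hh] at h1
  rw [div_lt_iff₀ hh] at h2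
  constructor <;> nlinarith

theorem eq_floor_of_mem_gridCell (hh : 0 < h) {k : Fin d → ℤ} {x : EuclideanSpace ℝ (Fin d)}
    (hx : x ∈ gridCell h k) : k = fun i => ⌊x i / h⌋ := by
  funext i
  symm
  have h1 := hx i
  rw [Set.mem_Ico] at h1
  rw [Int.floor_eq_iff, le_div_iff₀ hh, div_lt_iff₀ hh]
  constructor <;> nlinarith

theorem finite_image_floor (hh : 0 < h) {K : Set (EuclideanSpace ℝ (Fin d))}
    (hK : Bornology.IsBounded K) :
    ((fun (x : EuclideanSpace ℝ (Fin d)) i => ⌊x i / h⌋) '' K).Finite := by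
  obtain ⟨R, hR⟩ := hK.exists_norm_le
  refine (Set.Finite.pi' fun _ : Fin d => Set.finite_Icc ⌊-R / h⌋ ⌊R / h⌋).subset ?_
  rintro _ ⟨x, hx, rfl⟩ i
  have h1 : |x i| ≤ R := (PiLp.norm_apply_le x i).trans (hR x hx)
  rw [abs_le] at h1
  exact ⟨Int.floor_le_floor (div_le_div_of_nonneg_right h1.1 hh.le),
    Int.floor_le_floor (div_le_div_of_nonneg_right h1.2 hh.le)⟩

/-- The Poincaré constant of a cube of side `h` is `O(h)`. -/
theorem lintegral_gridCell_sub_average_le (hh : 0 < h) (k : Fin d → ℤ)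
    {w : EuclideanSpace ℝ (Fin d) → ℂ} (hw : ContDiff ℝ ∞ w) (hwi : IntegrableOn w (gridCell h k)) :
    ∫⁻ x in gridCell h k, ‖w x - ⨍ y in gridCell h k, w y‖ₑ ^ 2 ≤
      ENNReal.ofReal h ^ 2 * (ENNReal.ofReal √d ^ 2 *
        volume (Metric.closedBall (0 : EuclideanSpace ℝ (Fin d)) √d)) *
        ∫⁻ x in gridCell h k, ‖fderiv ℝ w x‖ₑ ^ 2 := by
  have h0 : ENNReal.ofReal h ≠ 0 := by simpa using hh
  have hv0 : volume (gridCell h k) ≠ 0 := by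
    rw [volume_gridCell]
    exact pow_ne_zero _ h0
  have hv1 : volume (gridCell h k) ≠ ⊤ := by
    rw [volume_gridCell]
    exact ENNReal.pow_ne_top ENNReal.ofReal_ne_top
  have hp := lintegral_sub_average_le volume (measurableSet_gridCell k) (convex_gridCell k)
    (fun x hx y hy => norm_sub_le_of_mem_gridCell hh k hx hy) hv0 hv1 hw hwi
  refine hp.trans (le_of_eq ?_)
  congr 1
  have hball : volume (Metric.closedBall (0 : EuclideanSpace ℝ (Fin d)) (h * √d)) =
      ENNReal.ofReal h ^ d * volume (Metric.closedBall (0 : EuclideanSpace ℝ (Fin d)) √d) := by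
    have := Measure.addHaar_closedBall_mul volume (0 : EuclideanSpace ℝ (Fin d)) hh.le
      (Real.sqrt_nonneg d)
    rw [this, finrank_euclideanSpace_fin, ENNReal.ofReal_pow hh.le]
  rw [hball, volume_gridCell, ENNReal.ofReal_mul hh.le]
  have hc : (ENNReal.ofReal h ^ d)⁻¹ * ENNReal.ofReal h ^ d = 1 :=
    ENNReal.inv_mul_cancel (pow_ne_zero _ h0) (ENNReal.pow_ne_top ENNReal.ofReal_ne_top)
  calc _ = ((ENNReal.ofReal h ^ d)⁻¹ * ENNReal.ofReal h ^ d) * (ENNReal.ofReal h ^ 2 *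
        (ENNReal.ofReal √d ^ 2 * volume (Metric.closedBall (0 : EuclideanSpace ℝ (Fin d)) √d))) := by
        ring
    _ = _ := by rw [hc, one_mul]

end Grid

section Rellich

variable {d : ℕ} {Ω S S' : Set (EuclideanSpace ℝ (Fin d))}

theorem enorm_setAverage_sq (w : EuclideanSpace ℝ (Fin d) → ℂ) (Q : Set (EuclideanSpace ℝ (Fin d))) :
    ‖⨍ y in Q, w y‖ₑ ^ 2 = ‖(volume.real Q)⁻¹‖ₑ ^ 2 * ‖∫ y in Q, w y‖ₑ ^ 2 := by
  rw [setAverage_eq, enorm_smul, mul_pow]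

/-- Finitely many grid cubes of small side h cover `K` inside `Ω`. On each, Poincaré's inequality
costs O(h²) times the Dirichlet integral, and what remains is the average over the cube. -/
theorem rellichEstimate_of_isCompact (hΩ : IsOpen Ω) {K : Set (EuclideanSpace ℝ (Fin d))}
    (hK : IsCompact K) (hKΩ : K ⊆ Ω) : RellichEstimate Ω K := by
  intro ε hε
  obtain ⟨η, hη, hηΩ⟩ := hK.exists_cthickening_subset_open hΩ hKΩ
  set c := ENNReal.ofReal √d ^ 2 * volume (Metric.closedBall (0 : EuclideanSpace ℝ (Fin d)) √d)
    with hc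
  have hctop : c ≠ ⊤ := ENNReal.mul_ne_top (ENNReal.pow_ne_top ENNReal.ofReal_ne_top)
    (measure_closedBall_lt_top.ne)
  -- The bound on the diameter h√d keeps each cube that meets `K` inside `Ω`; the last bound absorbs
  -- twice the Poincaré constant into ε.
  have hsmall : ∃ h : ℝ, 0 < h ∧ h * √d ≤ η ∧ 2 * (ENNReal.ofReal h ^ 2 * c) ≤ ε := by
    have t1 : Tendsto (fun h : ℝ => h * √d) (𝓝[>] 0) (𝓝 0) := by
      have : Tendsto (fun h : ℝ => h * √d) (𝓝 0) (𝓝 (0 * √d)) := (tendsto_id).mul_const _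
      rw [zero_mul] at this
      exact this.mono_left nhdsWithin_le_nhds
    have t2 : Tendsto (fun h : ℝ => 2 * (ENNReal.ofReal h ^ 2 * c)) (𝓝[>] 0) (𝓝 0) := by
      have h1 : Tendsto (fun h : ℝ => ENNReal.ofReal h ^ 2) (𝓝 0) (𝓝 (ENNReal.ofReal 0 ^ 2)) :=
        ((ENNReal.continuous_pow 2).comp ENNReal.continuous_ofReal).tendsto 0
      have h2 := ENNReal.Tendsto.const_mul (a := 2)
        (ENNReal.Tendsto.mul_const (b := c) h1 (Or.inr hctop)) (Or.inr (by simp))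
      simp only [ENNReal.ofReal_zero, ne_eq, OfNat.ofNat_ne_zero, not_false_eq_true, zero_pow,
        zero_mul, mul_zero] at h2
      exact h2.mono_left nhdsWithin_le_nhds
    obtain ⟨h, h1, h2, h3⟩ := ((eventually_mem_nhdsWithin (a := (0 : ℝ)) (s := Set.Ioi 0)).and
      ((t1.eventually (eventually_le_nhds hη)).and
        (t2.eventually (eventually_le_nhds (pos_iff_ne_zero.2 hε))))).exists
    exact ⟨h, h1, h2, h3⟩
  obtain ⟨h, hh, hhη, hhε⟩ := hsmall
  let I : Finset (Fin d → ℤ) := (finite_image_floor hh hK.isBounded).toFinset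
  have hI : ∀ k ∈ I, gridCell h k ⊆ Ω := by
    intro k hk x hx
    obtain ⟨y, hy, rfl⟩ := (Set.Finite.mem_toFinset _).1 hk
    refine hηΩ (Metric.mem_cthickening_of_dist_le x y η K hy ?_)
    rw [dist_eq_norm]
    exact (norm_sub_le_of_mem_gridCell hh _ (mem_gridCell_floor hh y) hx).trans hhη
  have hcover : K ⊆ ⋃ k ∈ I, gridCell h k := fun x hx => Set.mem_biUnion
    ((Set.Finite.mem_toFinset _).2 ⟨x, hx, rfl⟩) (mem_gridCell_floor hh x)
  have hdisj : (I : Set (Fin d → ℤ)).PairwiseDisjoint (gridCell h) := by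
    intro k _ l _ hkl
    refine Set.disjoint_left.2 fun x hx hx' => hkl ?_
    rw [eq_floor_of_mem_gridCell hh hx, eq_floor_of_mem_gridCell hh hx']
  have hV : ∀ k : Fin d → ℤ, volume (gridCell h k) ≠ ⊤ := fun k => by
    rw [volume_gridCell]
    exact ENNReal.pow_ne_top ENNReal.ofReal_ne_top
  refine ⟨I, inferInstance, fun k => gridCell h k.1,
    ∑ k ∈ I, 2 * volume (gridCell h k) * ‖(volume.real (gridCell h k))⁻¹‖ₑ ^ 2, ?_,
    fun k => ⟨measurableSet_gridCell _, hI k.1 k.2⟩, fun w hw => ?_⟩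
  · refine ENNReal.sum_ne_top.2 fun k _ => ENNReal.mul_ne_top (ENNReal.mul_ne_top (by simp) (hV k))
      (ENNReal.pow_ne_top (by simp))
  have hwi : ∀ k : Fin d → ℤ, IntegrableOn w (gridCell h k) := by
    intro k
    have hb : Bornology.IsBounded (gridCell (d := d) h k) :=
      Metric.isBounded_iff.2 ⟨h * √d, fun x hx y hy => by
        rw [dist_eq_norm]; exact norm_sub_le_of_mem_gridCell hh k hy hx⟩
    exact (hw.continuous.continuousOn.integrableOn_compact hb.isCompact_closure).mono_set
      subset_closure
  have hcell : ∀ k ∈ I, ∫⁻ x in gridCell h k, ‖w x‖ₑ ^ 2 ≤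
      ε * (∫⁻ x in gridCell h k, ‖fderiv ℝ w x‖ₑ ^ 2) + 2 * volume (gridCell h k) *
        ‖(volume.real (gridCell h k))⁻¹‖ₑ ^ 2 * ‖∫ x in gridCell h k, w x‖ₑ ^ 2 := by
    intro k hk
    set m := ⨍ y in gridCell h k, w y with hm
    calc ∫⁻ x in gridCell h k, ‖w x‖ₑ ^ 2
        ≤ ∫⁻ x in gridCell h k, (2 * ‖w x - m‖ₑ ^ 2 + 2 * ‖m‖ₑ ^ 2) := by
          refine lintegral_mono fun x => ?_
          simpa using enorm_add_sq_le (w x - m) m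
      _ = 2 * (∫⁻ x in gridCell h k, ‖w x - m‖ₑ ^ 2) + 2 * ‖m‖ₑ ^ 2 * volume (gridCell h k) := by
          rw [lintegral_add_right _ measurable_const, lintegral_const_mul' _ _ (by simp),
            lintegral_const, Measure.restrict_apply_univ]
      _ ≤ 2 * (ENNReal.ofReal h ^ 2 * c * ∫⁻ x in gridCell h k, ‖fderiv ℝ w x‖ₑ ^ 2) +
            2 * ‖m‖ₑ ^ 2 * volume (gridCell h k) := by
          gcongr
          exact lintegral_gridCell_sub_average_le hh k hw (hwi k)
      _ ≤ ε * (∫⁻ x in gridCell h k, ‖fderiv ℝ w x‖ₑ ^ 2) +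
            2 * ‖m‖ₑ ^ 2 * volume (gridCell h k) := by
          rw [← mul_assoc]
          gcongr
      _ = _ := by
          rw [hm, enorm_setAverage_sq]
          ring
  calc ∫⁻ x in K, ‖w x‖ₑ ^ 2 ≤ ∫⁻ x in ⋃ k ∈ I, gridCell h k, ‖w x‖ₑ ^ 2 :=
        lintegral_mono_set hcover
    _ = ∑ k ∈ I, ∫⁻ x in gridCell h k, ‖w x‖ₑ ^ 2 :=
        lintegral_biUnion_finset hdisj (fun k _ => measurableSet_gridCell k) _
    _ ≤ ∑ k ∈ I, (ε * (∫⁻ x in gridCell h k, ‖fderiv ℝ w x‖ₑ ^ 2) + 2 * volume (gridCell h k) *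
        ‖(volume.real (gridCell h k))⁻¹‖ₑ ^ 2 * ‖∫ x in gridCell h k, w x‖ₑ ^ 2) :=
        Finset.sum_le_sum hcell
    _ = ε * (∫⁻ x in ⋃ k ∈ I, gridCell h k, ‖fderiv ℝ w x‖ₑ ^ 2) + ∑ k ∈ I,
        2 * volume (gridCell h k) * ‖(volume.real (gridCell h k))⁻¹‖ₑ ^ 2 *
          ‖∫ x in gridCell h k, w x‖ₑ ^ 2 := by
        rw [Finset.sum_add_distrib, ← Finset.mul_sum,
          lintegral_biUnion_finset hdisj (fun k _ => measurableSet_gridCell k)]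
    _ ≤ _ := by
        gcongr
        · exact Set.iUnion₂_subset hI
        · let g : (Fin d → ℤ) → ℝ≥0∞ := fun k => ‖∫ x in gridCell h k, w x‖ₑ ^ 2
          have hg : ∑ i : I, ‖∫ x in gridCell h i.1, w x‖ₑ ^ 2 = ∑ k ∈ I, g k :=
            Finset.sum_coe_sort I g
          rw [Finset.sum_mul, hg]
          refine Finset.sum_le_sum fun k hk => mul_le_mul_right ?_ _
          exact Finset.single_le_sum (f := g) (fun _ _ => zero_le) hk

theorem RellichEstimate.mono (h : RellichEstimate Ω S') (hS : S ⊆ S') : RellichEstimate Ω S := by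
  intro ε hε
  obtain ⟨ι, hι, Q, C, hC, hQ, hw⟩ := h ε hε
  exact ⟨ι, hι, Q, C, hC, hQ, fun w hww => (lintegral_mono_set hS).trans (hw w hww)⟩

theorem rellichEstimate_empty : RellichEstimate Ω ∅ := fun _ _ =>
  ⟨Empty, inferInstance, fun _ => ∅, 0, by simp, fun i => i.elim, fun w _ => by simp⟩

/-- Each piece receives half of ε. With the monotone and empty cases this lets the estimate be
checked locally on a compact set. -/
theorem RellichEstimate.union (h : RellichEstimate Ω S) (h' : RellichEstimate Ω S') :
    RellichEstimate Ω (S ∪ S') := by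
  intro ε hε
  have hε2 : ε / 2 ≠ 0 := by simp [hε]
  obtain ⟨ι, hι, Q, C, hC, hQ, hw⟩ := h (ε / 2) hε2
  obtain ⟨ι', hι', Q', C', hC', hQ', hw'⟩ := h' (ε / 2) hε2
  refine ⟨ι ⊕ ι', inferInstance, Sum.elim Q Q', C + C', by simp [hC, hC'], ?_, fun w hww => ?_⟩
  · rintro (i | i)
    · exact hQ i
    · exact hQ' i
  · set D := ∫⁻ x in Ω, ‖fderiv ℝ w x‖ₑ ^ 2
    calc ∫⁻ x in S ∪ S', ‖w x‖ₑ ^ 2 ≤ (∫⁻ x in S, ‖w x‖ₑ ^ 2) + ∫⁻ x in S', ‖w x‖ₑ ^ 2 :=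
          lintegral_union_le _ _ _
      _ ≤ (ε / 2 * D + C * ∑ i, ‖∫ x in Q i, w x‖ₑ ^ 2) +
          (ε / 2 * D + C' * ∑ i, ‖∫ x in Q' i, w x‖ₑ ^ 2) := add_le_add (hw w hww) (hw' w hww)
      _ = (ε / 2 + ε / 2) * D + (C * (∑ i, ‖∫ x in Q i, w x‖ₑ ^ 2) +
          C' * ∑ i, ‖∫ x in Q' i, w x‖ₑ ^ 2) := by ring
      _ ≤ ε * D + (C + C') * ((∑ i, ‖∫ x in Q i, w x‖ₑ ^ 2) + ∑ i, ‖∫ x in Q' i, w x‖ₑ ^ 2) := by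
          rw [ENNReal.add_halves, add_mul]
          gcongr
          · exact le_self_add
          · exact le_add_self
      _ = _ := by simp

/-- If `S` can be pushed into compact subsets of `Ω` by arbitrarily small translations inside `Ω`,
then the Rellich estimate holds on `S`. -/
theorem rellichEstimate_of_translate (hΩ : IsOpen Ω) (hS : MeasurableSet S)
    (hSb : Bornology.IsBounded S) (e : EuclideanSpace ℝ (Fin d)) {ρ : ℝ} (hρ : 0 < ρ)
    (hSe : ∀ x ∈ closure S, ∀ s ∈ Set.Ioo 0 ρ, x + s • e ∈ Ω) (hSΩ : S ⊆ Ω) :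
    RellichEstimate Ω S := by
  intro ε hε
  have hε2 : ε / 2 ≠ 0 := by simp [hε]
  have hsmall : ∃ t ∈ Set.Ioo 0 ρ, 2 * ‖t • e‖ₑ ^ 2 ≤ ε / 2 := by
    have h1 : Continuous fun t : ℝ => ‖t • e‖ₑ ^ 2 :=
      (ENNReal.continuous_pow 2).comp (by fun_prop)
    have h2 := ENNReal.Tendsto.const_mul (a := 2) (h1.tendsto 0) (Or.inr (by simp))
    simp only [zero_smul, enorm_zero, ne_eq, OfNat.ofNat_ne_zero, not_false_eq_true, zero_pow,
        mul_zero] at h2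
    obtain ⟨t, h3, h4⟩ := ((Filter.eventually_of_mem (Ioo_mem_nhdsGT hρ) fun _ h => h).and
      ((h2.mono_left nhdsWithin_le_nhds).eventually
        (eventually_le_nhds (pos_iff_ne_zero.2 hε2)))).exists
    exact ⟨t, h3, h4⟩
  obtain ⟨t, ht, hte⟩ := hsmall
  have hKc : IsCompact ((fun x => x + t • e) '' closure S) :=
    hSb.isCompact_closure.image (by fun_prop)
  have hKΩ : (fun x => x + t • e) '' closure S ⊆ Ω := by
    rintro _ ⟨x, hx, rfl⟩
    exact hSe x hx t ht
  -- Splitting w(x) into its translate and the difference doubles both squares, so ε/4 on the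
  -- compact set contributes ε/2, and the translation contributes the other ε/2.
  have hε4 : ε / 4 ≠ 0 := by simp [hε]
  obtain ⟨ι, hι, Q, C, hC, hQ, hw⟩ := rellichEstimate_of_isCompact hΩ hKc hKΩ (ε / 4) hε4
  refine ⟨ι, hι, Q, 2 * C, ENNReal.mul_ne_top (by simp) hC, hQ, fun w hww => ?_⟩
  set D := ∫⁻ x in Ω, ‖fderiv ℝ w x‖ₑ ^ 2
  have h1 := lintegral_translate_sub_le volume hS hΩ.measurableSet (t • e) (fun x hx r hr => by
    rcases hr.1.eq_or_lt with rfl | h0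
    · simpa using hSΩ hx
    · rw [smul_smul]
      exact hSe x (subset_closure hx) _ ⟨mul_pos h0 ht.1,
        (mul_le_of_le_one_left ht.1.le hr.2).trans_lt ht.2⟩) hww
  have h2 := lintegral_translate_le volume hS hKc.measurableSet (t • e)
    (fun x hx => ⟨x, subset_closure hx, rfl⟩) fun x => ‖w x‖ₑ ^ 2
  have hcont : Continuous fun x => ‖w (x + t • e)‖ₑ ^ 2 :=
    (ENNReal.continuous_pow 2).comp (hww.continuous.comp (by fun_prop)).enorm
  calc ∫⁻ x in S, ‖w x‖ₑ ^ 2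
      ≤ ∫⁻ x in S, (2 * ‖w (x + t • e)‖ₑ ^ 2 + 2 * ‖w (x + t • e) - w x‖ₑ ^ 2) := by
        refine lintegral_mono fun x => ?_
        have := enorm_add_sq_le (w (x + t • e)) (-(w (x + t • e) - w x))
        rw [enorm_neg] at this
        simpa using this
    _ = 2 * (∫⁻ x in S, ‖w (x + t • e)‖ₑ ^ 2) + 2 * ∫⁻ x in S, ‖w (x + t • e) - w x‖ₑ ^ 2 := by
        rw [lintegral_add_left (hcont.measurable.const_mul 2), lintegral_const_mul' _ _ (by simp),
          lintegral_const_mul' _ _ (by simp)]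
    _ ≤ 2 * (ε / 4 * D + C * ∑ i, ‖∫ x in Q i, w x‖ₑ ^ 2) + 2 * (‖t • e‖ₑ ^ 2 * D) := by
        gcongr
        exact h2.trans (hw w hww)
    _ = (2 * (ε / 4) + 2 * ‖t • e‖ₑ ^ 2) * D + 2 * C * ∑ i, ‖∫ x in Q i, w x‖ₑ ^ 2 := by ring
    _ ≤ _ := by
        gcongr
        have h4 : 2 * (ε / 4) = ε / 2 := by
          rw [show (4 : ℝ≥0∞) = 2 * 2 by norm_num, div_eq_mul_inv, ENNReal.mul_inv (by simp) (by simp),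
            div_eq_mul_inv]
          calc 2 * (ε * (2⁻¹ * 2⁻¹)) = (2 * 2⁻¹) * (ε * 2⁻¹) := by ring
            _ = _ := by rw [ENNReal.mul_inv_cancel (by simp) (by simp), one_mul]
        calc 2 * (ε / 4) + 2 * ‖t • e‖ₑ ^ 2 ≤ ε / 2 + ε / 2 := by rw [h4]; gcongr
          _ = ε := ENNReal.add_halves ε

end Rellich

/-! ### Boundary charts -/

section Chart

variable {d : ℕ}

theorem norm_toLp_prod_le {U V : Type*} [NormedAddCommGroup U] [NormedAddCommGroup V]
    (a : U) (b : V) : ‖WithLp.toLp 2 (a, b)‖ ≤ ‖a‖ + ‖b‖ := by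
  rw [WithLp.prod_norm_eq_of_L2]
  refine Real.sqrt_le_iff.2 ⟨by positivity, ?_⟩
  change ‖a‖ ^ 2 + ‖b‖ ^ 2 ≤ _
  nlinarith [norm_nonneg a, norm_nonneg b]

/-- The point of height `s` above the graph of `γ` over `y`. -/
def graphPoint (L : EuclideanSpace ℝ (Fin d) ≃ₗᵢ[ℝ] WithLp 2 (EuclideanSpace ℝ (Fin (d - 1)) × ℝ))
    (γ : EuclideanSpace ℝ (Fin (d - 1)) → ℝ) (y : EuclideanSpace ℝ (Fin (d - 1))) (s : ℝ) :
    EuclideanSpace ℝ (Fin d) :=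
  L.symm (WithLp.toLp 2 (y, γ y + s))

/-- The vertical direction of the coordinates `L`. -/
def verticalDir
    (L : EuclideanSpace ℝ (Fin d) ≃ₗᵢ[ℝ] WithLp 2 (EuclideanSpace ℝ (Fin (d - 1)) × ℝ)) :
    EuclideanSpace ℝ (Fin d) :=
  L.symm (WithLp.toLp 2 (0, 1))

/-- A Lipschitz graph chart of `Ω` around the boundary point `x₀`. -/
structure IsChart (Ω : Set (EuclideanSpace ℝ (Fin d))) (x₀ : EuclideanSpace ℝ (Fin d))
    (L : EuclideanSpace ℝ (Fin d) ≃ₗᵢ[ℝ] WithLp 2 (EuclideanSpace ℝ (Fin (d - 1)) × ℝ))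
    (γ : EuclideanSpace ℝ (Fin (d - 1)) → ℝ) (K : NNReal) (ρ : ℝ) : Prop where
  pos : 0 < ρ
  lipschitz : LipschitzWith K γ
  above_mem : ∀ y ∈ Metric.ball (L x₀).fst ρ, ∀ s ∈ Set.Ioo 0 ρ, graphPoint L γ y s ∈ Ω
  graph_mem : ∀ y ∈ Metric.ball (L x₀).fst ρ, graphPoint L γ y 0 ∈ frontier Ω
  eq_graph : ∀ x ∈ frontier Ω ∩ Metric.ball x₀ ρ, x = graphPoint L γ (L x).fst 0
  shift_mem : ∀ x ∈ closure (Ω ∩ Metric.ball x₀ ρ), ∀ s ∈ Set.Ioo 0 ρ, x + s • verticalDir L ∈ Ω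
  center : x₀ = graphPoint L γ (L x₀).fst 0

variable {Ω : Set (EuclideanSpace ℝ (Fin d))} {x₀ : EuclideanSpace ℝ (Fin d)}
    {L : EuclideanSpace ℝ (Fin d) ≃ₗᵢ[ℝ] WithLp 2 (EuclideanSpace ℝ (Fin (d - 1)) × ℝ)}
    {γ : EuclideanSpace ℝ (Fin (d - 1)) → ℝ} {K : NNReal} {ρ : ℝ}

theorem graphPoint_add (y : EuclideanSpace ℝ (Fin (d - 1))) (s t : ℝ) :
    graphPoint L γ y s + t • verticalDir L = graphPoint L γ y (s + t) := by
  rw [graphPoint, verticalDir, graphPoint, ← map_smul, ← map_add]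
  congr 1
  rw [← WithLp.toLp_smul, ← WithLp.toLp_add]
  simp [add_assoc]

theorem norm_verticalDir : ‖verticalDir L‖ = 1 := by
  rw [verticalDir, LinearIsometryEquiv.norm_map, WithLp.prod_norm_eq_of_L2]
  simp

theorem continuous_graphPoint (hγ : LipschitzWith K γ) :
    Continuous fun p : EuclideanSpace ℝ (Fin (d - 1)) × ℝ => graphPoint L γ p.1 p.2 := by
  refine L.symm.continuous.comp ((WithLp.prod_continuous_toLp 2 _ _).comp ?_)
  exact continuous_fst.prodMk ((hγ.continuous.comp continuous_fst).add continuous_snd)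

theorem norm_fst_sub_le (x y : WithLp 2 (EuclideanSpace ℝ (Fin (d - 1)) × ℝ)) :
    ‖x.fst - y.fst‖ ≤ ‖x - y‖ := by
  have := WithLp.prod_norm_sq_eq_of_L2 (x - y)
  rw [WithLp.sub_fst] at this
  exact abs_le_of_sq_le_sq' (by nlinarith [sq_nonneg ‖(x - y).snd‖]) (norm_nonneg _) |>.2

theorem dist_graphPoint_le (hγ : LipschitzWith K γ) (y z : EuclideanSpace ℝ (Fin (d - 1))) (s t : ℝ) :
    dist (graphPoint L γ y s) (graphPoint L γ z t) ≤ (1 + K) * dist y z + |s - t| := by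
  rw [graphPoint, graphPoint, L.symm.dist_map, dist_eq_norm, ← WithLp.toLp_sub, Prod.mk_sub_mk]
  refine (norm_toLp_prod_le _ _).trans ?_
  have h1 := hγ.dist_le_mul y z
  rw [Real.dist_eq] at h1
  rw [dist_eq_norm] at h1 ⊢
  have h2 : ‖γ y + s - (γ z + t)‖ ≤ |γ y - γ z| + |s - t| := by
    rw [Real.norm_eq_abs, show γ y + s - (γ z + t) = (γ y - γ z) + (s - t) by ring]
    exact abs_add_le _ _
  linarith

/-- Passing to the closure turns the strict epigraph into the weak one, so boundary points lie on
the graph and every closure point enters `Ω` when shifted upwards. The radius only has to be shrunk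
so that all points in question stay in the original ball. -/
theorem exists_isChart (hΩ : IsOpen Ω) (hL : HasLipschitzBoundary Ω) (hx₀ : x₀ ∈ frontier Ω) :
    ∃ (L : EuclideanSpace ℝ (Fin d) ≃ₗᵢ[ℝ] WithLp 2 (EuclideanSpace ℝ (Fin (d - 1)) × ℝ))
      (γ : EuclideanSpace ℝ (Fin (d - 1)) → ℝ) (K : NNReal) (ρ : ℝ), IsChart Ω x₀ L γ K ρ := by
  obtain ⟨L, γ, K, r, hγ, hr, hmem⟩ := hL x₀ hx₀
  have hK : (0 : ℝ) ≤ K := K.2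
  -- A graph point over the ρ-ball at height below ρ is within (K + 2)ρ of `x₀`, and a shifted point
  -- is within 2ρ; both are below (K + 3)ρ = r.
  set ρ : ℝ := r / (K + 3) with hρ
  have hρ0 : 0 < ρ := by positivity
  have hrρ : r = (K + 3) * ρ := by rw [hρ]; field_simp
  have hfle : ∀ x ∈ closure Ω ∩ Metric.ball x₀ r, γ (L x).fst ≤ (L x).snd := by
    intro x hx
    have hcl : IsClosed {x : EuclideanSpace ℝ (Fin d) | γ (L x).fst ≤ (L x).snd} := by
      refine isClosed_le (hγ.continuous.comp ?_) ?_
      · exact (WithLp.prod_continuous_ofLp 2 _ _).fst.comp L.continuous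
      · exact (WithLp.prod_continuous_ofLp 2 _ _).snd.comp L.continuous
    have hx' : x ∈ closure (Metric.ball x₀ r ∩ Ω) :=
      Metric.isOpen_ball.inter_closure ⟨hx.2, hx.1⟩
    exact closure_minimal (fun z hz => ((hmem z hz.1).1 hz.2).le) hcl hx'
  have hfr : ∀ x ∈ frontier Ω ∩ Metric.ball x₀ r, x = graphPoint L γ (L x).fst 0 := by
    intro x hx
    have h1 := hfle x ⟨hx.1.1, hx.2⟩
    have h2 : ¬ γ (L x).fst < (L x).snd := fun h => by
      have h3 := (hmem x hx.2).2 h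
      rw [hΩ.frontier_eq] at hx
      exact hx.1.2 h3
    have h3 : γ (L x).fst = (L x).snd := le_antisymm h1 (not_lt.1 h2)
    rw [graphPoint, add_zero, h3]
    exact (L.symm_apply_apply x).symm
  have hcenter := hfr x₀ ⟨hx₀, Metric.mem_ball_self hr⟩
  have hball : ∀ y ∈ Metric.ball (L x₀).fst ρ, ∀ s, 0 ≤ s → s < ρ →
      graphPoint L γ y s ∈ Metric.ball x₀ r := by
    intro y hy s hs hsρ
    rw [Metric.mem_ball] at hy ⊢
    rw [hcenter]
    refine (dist_graphPoint_le hγ y _ s 0).trans_lt ?_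
    rw [sub_zero, abs_of_nonneg hs, hrρ]
    have : (1 + (K : ℝ)) * dist y (L x₀).fst ≤ (1 + K) * ρ := by gcongr
    nlinarith
  have habove : ∀ y ∈ Metric.ball (L x₀).fst ρ, ∀ s ∈ Set.Ioo 0 ρ, graphPoint L γ y s ∈ Ω := by
    intro y hy s hs
    rw [hmem _ (hball y hy s hs.1.le hs.2), graphPoint, L.apply_symm_apply]
    simpa using hs.1
  refine ⟨L, γ, K, ρ, hρ0, hγ, habove, ?_, ?_, ?_, hcenter⟩
  · intro y hy
    rw [hΩ.frontier_eq]
    constructor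
    · have hc : Continuous fun s : ℝ => graphPoint L γ y s :=
        (continuous_graphPoint (L := L) hγ).comp (continuous_const.prodMk continuous_id)
      refine mem_closure_of_tendsto ((hc.tendsto 0).mono_left (nhdsWithin_le_nhds (s := Set.Ioi 0)))
        (Filter.eventually_of_mem (Ioo_mem_nhdsGT hρ0) fun s hs => habove y hy s hs)
    · intro h
      rw [hmem _ (hball y hy 0 le_rfl hρ0), graphPoint, L.apply_symm_apply] at h
      simp at h
  · intro x hx
    refine hfr x ⟨hx.1, Metric.ball_subset_ball ?_ hx.2⟩
    rw [hrρ]; nlinarith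
  · intro x hx s hs
    have hxc : x ∈ Metric.closedBall x₀ ρ :=
      Metric.closure_ball_subset_closedBall (closure_mono Set.inter_subset_right hx)
    rw [Metric.mem_closedBall] at hxc
    have h1 : dist (x + s • verticalDir L) x₀ ≤ s + ρ := by
      refine (dist_triangle _ x _).trans (add_le_add ?_ hxc)
      rw [dist_eq_norm, add_sub_cancel_left, norm_smul, norm_verticalDir, mul_one,
        Real.norm_of_nonneg hs.1.le]
    have h2 := hfle x ⟨closure_mono Set.inter_subset_left hx, by
      rw [Metric.mem_ball, hrρ]; nlinarith⟩
    rw [hmem _ (by rw [Metric.mem_ball, hrρ]; nlinarith [hs.2]), map_add, map_smul, verticalDir,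
      L.apply_symm_apply]
    simpa using h2.trans_lt (lt_add_of_pos_right _ hs.1)

/-! ### The surface measure in a chart -/

/-- Flattening the graph is a shear followed by an isometry, so no Jacobian appears even though γ is
only Lipschitz. -/
theorem measurePreserving_graphPoint (hγ : LipschitzWith K γ) :
    MeasurePreserving (fun p : EuclideanSpace ℝ (Fin (d - 1)) × ℝ => graphPoint L γ p.1 p.2)
      volume volume := by
  have h1 : MeasurePreserving
      (fun p : EuclideanSpace ℝ (Fin (d - 1)) × ℝ => (p.1, γ p.1 + p.2)) volume volume := by
    refine MeasurePreserving.skew_product (g := fun y s => γ y + s) (MeasurePreserving.id _)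
      ?_ (ae_of_all _ fun y => ?_)
    · exact ((hγ.continuous.comp continuous_fst).add continuous_snd).measurable
    · exact (measurePreserving_add_left volume (γ y)).map_eq
  exact (L.symm.measurePreserving.comp (WithLp.volume_preserving_toLp _ _)).comp h1

theorem IsChart.lintegral_strip_le (h : IsChart Ω x₀ L γ K ρ) (hΩ : IsOpen Ω) {t : ℝ} (ht : t ≤ ρ)
    {f : EuclideanSpace ℝ (Fin d) → ℝ≥0∞} (hf : Measurable f) :
    ∫⁻ y in Metric.ball (L x₀).fst ρ, (∫⁻ s in Set.Ioo 0 t, f (graphPoint L γ y s)) ≤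
      ∫⁻ x in Ω, f x := by
  have hmp := measurePreserving_graphPoint (L := L) h.lipschitz
  have hm : Measurable fun p : EuclideanSpace ℝ (Fin (d - 1)) × ℝ => f (graphPoint L γ p.1 p.2) :=
    hf.comp hmp.measurable
  rw [← lintegral_prod (μ := volume.restrict (Metric.ball (L x₀).fst ρ))
      (ν := volume.restrict (Set.Ioo 0 t))
      (fun p : EuclideanSpace ℝ (Fin (d - 1)) × ℝ => f (graphPoint L γ p.1 p.2)) hm.aemeasurable,
    Measure.prod_restrict, ← hmp.setLIntegral_comp_preimage hΩ.measurableSet hf]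
  refine lintegral_mono_set fun p hp => ?_
  exact h.above_mem _ hp.1 _ ⟨hp.2.1, hp.2.2.trans_le ht⟩

theorem IsChart.fst_mem_ball {x : EuclideanSpace ℝ (Fin d)} (hx : x ∈ Metric.ball x₀ ρ) :
    (L x).fst ∈ Metric.ball (L x₀).fst ρ := by
  rw [Metric.mem_ball, dist_eq_norm] at hx ⊢
  refine (norm_fst_sub_le _ _).trans_lt ?_
  rwa [← map_sub, L.norm_map]

/-- The graph parametrization is (1 + K)-Lipschitz, so it enlarges (d-1)-dimensional Hausdorff
measure by at most (1 + K)^(d-1). An upper bound on the density suffices here, so the area formula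
is not needed. -/
theorem IsChart.surface_restrict_le (h : IsChart Ω x₀ L γ K ρ) :
    (surface Ω).restrict (Metric.ball x₀ ρ) ≤ ((1 + K : NNReal) : ℝ≥0∞) ^ (d - 1) •
      (volume.restrict (Metric.ball (L x₀).fst ρ)).map fun y => graphPoint L γ y 0 := by
  have hlip : LipschitzWith (1 + K) fun y => graphPoint L γ y 0 :=
    LipschitzWith.of_dist_le_mul fun y z => by
      simpa using dist_graphPoint_le (L := L) h.lipschitz y z 0 0
  have hm : Measurable fun y => graphPoint L γ y 0 := hlip.continuous.measurable
  refine Measure.le_iff.2 fun S hS => ?_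
  rw [Measure.restrict_apply hS, surface, Measure.restrict_apply (hS.inter measurableSet_ball),
    Measure.smul_apply, Measure.map_apply hm hS, Measure.restrict_apply (hm hS)]
  have hsub : S ∩ Metric.ball x₀ ρ ∩ frontier Ω ⊆ (fun y => graphPoint L γ y 0) ''
      ((fun y => graphPoint L γ y 0) ⁻¹' S ∩ Metric.ball (L x₀).fst ρ) := by
    rintro x ⟨⟨hxS, hxb⟩, hxf⟩
    have hx := h.eq_graph x ⟨hxf, hxb⟩
    exact ⟨(L x).fst, ⟨by rw [Set.mem_preimage, ← hx]; exact hxS, IsChart.fst_mem_ball hxb⟩, hx.symm⟩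
  refine (measure_mono hsub).trans ?_
  have h1 := hlip.hausdorffMeasure_image_le (d := ((d - 1 : ℕ) : ℝ)) (by positivity)
    ((fun y => graphPoint L γ y 0) ⁻¹' S ∩ Metric.ball (L x₀).fst ρ)
  rw [ENNReal.rpow_natCast] at h1
  rw [← EuclideanSpace.euclideanHausdorffMeasure_eq_volume,
    Measure.euclideanHausdorffMeasure_def, Measure.euclideanHausdorffMeasure_def,
    Measure.smul_apply, Measure.smul_apply, smul_eq_mul, ENNReal.smul_def, ENNReal.smul_def,
    smul_eq_mul, smul_eq_mul]
  calc _ ≤ _ := mul_le_mul_right h1 _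
    _ = _ := by ring

/-- A function on the boundary is integrated in a chart with a bounded density. -/
theorem IsChart.lintegral_surface_le (h : IsChart Ω x₀ L γ K ρ)
    {f : EuclideanSpace ℝ (Fin d) → ℝ≥0∞} (hf : Measurable f) :
    ∫⁻ x in Metric.ball x₀ ρ, f x ∂(surface Ω) ≤ ((1 + K : NNReal) : ℝ≥0∞) ^ (d - 1) *
      ∫⁻ y in Metric.ball (L x₀).fst ρ, f (graphPoint L γ y 0) := by
  have hm : Measurable fun y => graphPoint L γ y 0 :=
    ((continuous_graphPoint (L := L) h.lipschitz).comp
      (continuous_id.prodMk continuous_const)).measurable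
  refine (lintegral_mono' h.surface_restrict_le le_rfl).trans ?_
  rw [lintegral_smul_measure, lintegral_map hf hm, smul_eq_mul]

/-- The trace inequality in a chart. -/
theorem IsChart.lintegral_trace_le (h : IsChart Ω x₀ L γ K ρ) (hΩ : IsOpen Ω) {t : ℝ} (ht0 : 0 < t)
    (ht : t ≤ ρ) {w : EuclideanSpace ℝ (Fin d) → ℂ} (hw : ContDiff ℝ ∞ w) :
    ∫⁻ x in Metric.ball x₀ ρ, ‖w x‖ₑ ^ 2 ∂(surface Ω) ≤ ((1 + K : NNReal) : ℝ≥0∞) ^ (d - 1) *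
      (2 * (ENNReal.ofReal t)⁻¹ * (∫⁻ x in Ω, ‖w x‖ₑ ^ 2) +
        2 * ENNReal.ofReal t * ∫⁻ x in Ω, ‖fderiv ℝ w x‖ₑ ^ 2) := by
  have hwm : Measurable fun x => ‖w x‖ₑ ^ 2 :=
    ((ENNReal.continuous_pow 2).comp hw.continuous.enorm).measurable
  have hdm : Measurable fun x => ‖fderiv ℝ w x‖ₑ ^ 2 := (continuous_enorm_fderiv_sq hw).measurable
  have hgp := (measurePreserving_graphPoint (L := L) h.lipschitz).measurable
  refine (h.lintegral_surface_le hwm).trans (mul_le_mul_right ?_ _)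
  have hT0 : ENNReal.ofReal t ≠ 0 := by simpa using ht0
  have hT1 : ENNReal.ofReal t ≠ ⊤ := ENNReal.ofReal_ne_top
  set T := ENNReal.ofReal t with hT
  have hvert : ‖verticalDir L‖ₑ = 1 := by rw [← ofReal_norm, norm_verticalDir, ENNReal.ofReal_one]
  have hpt : ∀ y, ‖w (graphPoint L γ y 0)‖ₑ ^ 2 ≤
      2 * T⁻¹ * (∫⁻ s in Set.Ioo 0 t, ‖w (graphPoint L γ y s)‖ₑ ^ 2) +
        2 * T * ∫⁻ s in Set.Ioo 0 t, ‖fderiv ℝ w (graphPoint L γ y s)‖ₑ ^ 2 := by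
    intro y
    set D := ∫⁻ s in Set.Ioo 0 t, ‖fderiv ℝ w (graphPoint L γ y s)‖ₑ ^ 2 with hD
    -- The boundary value is compared with the value at each height s along the vertical segment.
    -- Averaging over s in (0, t) then produces the factor 1/t on the function and t on the
    -- gradient.
    have h1 : ∀ s ∈ Set.Ioo 0 t, ‖w (graphPoint L γ y 0)‖ₑ ^ 2 ≤
        2 * ‖w (graphPoint L γ y s)‖ₑ ^ 2 + 2 * (T * D) := by
      intro s hs
      have h2 := enorm_sub_sq_le_lintegral hw (graphPoint L γ y 0) (verticalDir L) hs.1.le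
      simp only [graphPoint_add, zero_add, hvert, one_pow, mul_one] at h2
      have h3 := enorm_add_sq_le (w (graphPoint L γ y s))
        (-(w (graphPoint L γ y s) - w (graphPoint L γ y 0)))
      rw [enorm_neg, neg_sub, add_sub_cancel] at h3
      refine h3.trans ?_
      gcongr
      refine h2.trans ?_
      gcongr
      · exact ENNReal.ofReal_le_ofReal hs.2.le
      · rw [hD]
        exact lintegral_mono_set fun r hr => ⟨hr.1, hr.2.trans_lt hs.2⟩
    have h2 : T * ‖w (graphPoint L γ y 0)‖ₑ ^ 2 ≤
        2 * (∫⁻ s in Set.Ioo 0 t, ‖w (graphPoint L γ y s)‖ₑ ^ 2) + T * (2 * (T * D)) := by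
      have h3 := setLIntegral_mono' (μ := volume) measurableSet_Ioo h1
      rw [lintegral_const, Measure.restrict_apply_univ, Real.volume_Ioo, sub_zero,
        lintegral_add_right _ measurable_const, lintegral_const_mul' _ _ (by simp),
        lintegral_const, Measure.restrict_apply_univ, Real.volume_Ioo, sub_zero] at h3
      rw [mul_comm T, mul_comm T]
      exact h3
    calc ‖w (graphPoint L γ y 0)‖ₑ ^ 2 = T⁻¹ * (T * ‖w (graphPoint L γ y 0)‖ₑ ^ 2) := by
          rw [← mul_assoc, ENNReal.inv_mul_cancel hT0 hT1, one_mul]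
      _ ≤ T⁻¹ * (2 * (∫⁻ s in Set.Ioo 0 t, ‖w (graphPoint L γ y s)‖ₑ ^ 2) + T * (2 * (T * D))) :=
          mul_le_mul_right h2 _
      _ = 2 * T⁻¹ * (∫⁻ s in Set.Ioo 0 t, ‖w (graphPoint L γ y s)‖ₑ ^ 2) +
            (T⁻¹ * T) * (2 * T * D) := by ring
      _ = _ := by rw [ENNReal.inv_mul_cancel hT0 hT1, one_mul]
  have hmeas : Measurable fun y => ∫⁻ s in Set.Ioo 0 t, ‖w (graphPoint L γ y s)‖ₑ ^ 2 :=
    Measurable.lintegral_prod_right' (f := fun p : EuclideanSpace ℝ (Fin (d - 1)) × ℝ =>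
      ‖w (graphPoint L γ p.1 p.2)‖ₑ ^ 2) (hwm.comp hgp)
  refine (lintegral_mono hpt).trans ?_
  rw [lintegral_add_left (hmeas.const_mul _), lintegral_const_mul' _ _
    (ENNReal.mul_ne_top (by simp) (ENNReal.inv_ne_top.2 hT0)),
    lintegral_const_mul' _ _ (ENNReal.mul_ne_top (by simp) hT1)]
  gcongr
  · exact h.lintegral_strip_le hΩ ht hwm
  · exact h.lintegral_strip_le hΩ ht hdm

theorem IsChart.surface_ball_lt_top (h : IsChart Ω x₀ L γ K ρ) :
    surface Ω (Metric.ball x₀ ρ) < ⊤ := by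
  have h1 := h.lintegral_surface_le (f := fun _ => 1) measurable_const
  simp only [lintegral_const, Measure.restrict_apply_univ, one_mul] at h1
  exact h1.trans_lt (ENNReal.mul_lt_top (ENNReal.pow_lt_top ENNReal.coe_lt_top)
    measure_ball_lt_top)

/-- The horizontal projection is 1-Lipschitz and maps the boundary piece onto a set containing a
ball of ℝ^(d-1), so the piece has at least the measure of that ball. -/
theorem IsChart.surface_ball_pos (h : IsChart Ω x₀ L γ K ρ) {r : ℝ} (hr : 0 < r) :
    0 < surface Ω (Metric.ball x₀ r) := by
  obtain ⟨δ, hδ, hδρ, hδr⟩ : ∃ δ : ℝ, 0 < δ ∧ δ ≤ ρ ∧ (1 + K) * δ < r := by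
    refine ⟨min ρ (r / (2 * (1 + K))), lt_min h.pos (by positivity), min_le_left _ _, ?_⟩
    calc (1 + (K : ℝ)) * min ρ (r / (2 * (1 + K))) ≤ (1 + K) * (r / (2 * (1 + K))) := by
          gcongr; exact min_le_right _ _
      _ = r / 2 := by field_simp
      _ < r := half_lt_self hr
  have hsub : Metric.ball (L x₀).fst δ ⊆ (fun x => (L x).fst) '' (Metric.ball x₀ r ∩ frontier Ω) := by
    intro y hy
    refine ⟨graphPoint L γ y 0, ⟨?_, h.graph_mem y (Metric.ball_subset_ball hδρ hy)⟩, ?_⟩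
    · rw [Metric.mem_ball] at hy ⊢
      rw [h.center]
      refine (dist_graphPoint_le h.lipschitz y _ 0 0).trans_lt ?_
      simp only [sub_self, abs_zero, add_zero]
      refine lt_of_le_of_lt ?_ hδr
      gcongr
    · simp only [graphPoint, L.apply_symm_apply]
      rfl
  have hlip : LipschitzWith 1 fun x : EuclideanSpace ℝ (Fin d) => (L x).fst :=
    LipschitzWith.of_dist_le_mul fun x y => by
      rw [NNReal.coe_one, one_mul, dist_eq_norm, dist_eq_norm, ← L.norm_map (x - y), map_sub]
      exact norm_fst_sub_le _ _
  have h1 := hlip.hausdorffMeasure_image_le (d := ((d - 1 : ℕ) : ℝ)) (by positivity)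
    (Metric.ball x₀ r ∩ frontier Ω)
  rw [ENNReal.coe_one, ENNReal.one_rpow, one_mul] at h1
  have h2 : volume (Metric.ball (L x₀).fst δ) ≤ surface Ω (Metric.ball x₀ r) := by
    rw [← EuclideanSpace.euclideanHausdorffMeasure_eq_volume, surface,
      Measure.restrict_apply measurableSet_ball,
      Measure.euclideanHausdorffMeasure_def, Measure.euclideanHausdorffMeasure_def,
      Measure.smul_apply, Measure.smul_apply, ENNReal.smul_def, ENNReal.smul_def]
    exact mul_le_mul_right ((measure_mono hsub).trans h1) _
  exact (Metric.measure_ball_pos volume _ hδ).trans_le h2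

end Chart

/-! ### Global estimates on admissible domains -/

theorem eLpNorm_two_sq {α F : Type*} [MeasurableSpace α] [NormedAddCommGroup F] (f : α → F)
    (μ : Measure α) : eLpNorm f 2 μ ^ 2 = ∫⁻ x, ‖f x‖ₑ ^ 2 ∂μ := by
  have h := eLpNorm_nnreal_pow_eq_lintegral (f := f) (μ := μ) (p := 2) (by simp)
  simpa using h

theorem tendsto_sq_zero_iff {ι : Type*} {l : Filter ι} {a : ι → ℝ≥0∞} :
    Tendsto (fun i => a i ^ 2) l (𝓝 0) ↔ Tendsto a l (𝓝 0) := by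
  constructor
  · intro h
    have h2 := ((ENNReal.continuous_rpow_const (y := (1 / 2 : ℝ))).tendsto 0).comp h
    rw [ENNReal.zero_rpow_of_pos (by norm_num)] at h2
    refine h2.congr fun i => ?_
    rw [Function.comp_apply, ← ENNReal.rpow_natCast, ← ENNReal.rpow_mul]
    norm_num
  · intro h
    have := ((ENNReal.continuous_pow 2).tendsto 0).comp h
    rwa [zero_pow two_ne_zero] at this

section Domain

variable {d : ℕ} {Ω : Set (EuclideanSpace ℝ (Fin d))}

theorem IsAdmissibleDomain.exists_isChart (hΩ : IsAdmissibleDomain Ω)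
    {x₀ : EuclideanSpace ℝ (Fin d)} (hx₀ : x₀ ∈ frontier Ω) :
    ∃ (L : EuclideanSpace ℝ (Fin d) ≃ₗᵢ[ℝ] WithLp 2 (EuclideanSpace ℝ (Fin (d - 1)) × ℝ))
      (γ : EuclideanSpace ℝ (Fin (d - 1)) → ℝ) (K : NNReal) (ρ : ℝ), IsChart Ω x₀ L γ K ρ :=
  EIT.exists_isChart hΩ.isOpen hΩ.lipschitz hx₀

theorem IsAdmissibleDomain.isCompact_frontier (hΩ : IsAdmissibleDomain Ω) :
    IsCompact (frontier Ω) :=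
  hΩ.isBounded.isCompact_closure.of_isClosed_subset isClosed_frontier frontier_subset_closure

theorem IsAdmissibleDomain.volume_lt_top (hΩ : IsAdmissibleDomain Ω) : volume Ω < ⊤ :=
  hΩ.isBounded.measure_lt_top

theorem surface_restrict_frontier : (surface Ω).restrict (frontier Ω) = surface Ω := by
  rw [surface, Measure.restrict_restrict isClosed_frontier.measurableSet, Set.inter_self]

theorem IsAdmissibleDomain.isFiniteMeasure_surface (hΩ : IsAdmissibleDomain Ω) :
    IsFiniteMeasure (surface Ω) := by
  refine ⟨?_⟩
  rw [← surface_restrict_frontier, Measure.restrict_apply_univ]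
  refine hΩ.isCompact_frontier.measure_lt_top_of_nhdsWithin fun x hx => ?_
  obtain ⟨L, γ, K, ρ, h⟩ := hΩ.exists_isChart hx
  exact ⟨Metric.ball x ρ, mem_nhdsWithin_of_mem_nhds (Metric.ball_mem_nhds x h.pos),
    h.surface_ball_lt_top⟩

theorem IsAdmissibleDomain.surface_ball_pos (hΩ : IsAdmissibleDomain Ω)
    {x : EuclideanSpace ℝ (Fin d)} (hx : x ∈ frontier Ω) {r : ℝ} (hr : 0 < r) :
    0 < surface Ω (Metric.ball x r) := by
  obtain ⟨L, γ, K, ρ, h⟩ := hΩ.exists_isChart hx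
  exact h.surface_ball_pos hr

theorem IsAdmissibleDomain.frontier_nonempty (hd : 2 ≤ d) (hΩ : IsAdmissibleDomain Ω) :
    (frontier Ω).Nonempty := by
  refine nonempty_frontier_iff.2 ⟨hΩ.isConnected.nonempty, fun h => ?_⟩
  have : Nonempty (Fin d) := ⟨⟨0, by omega⟩⟩
  have hb := hΩ.isBounded
  rw [h] at hb
  exact NormedSpace.unbounded_univ ℝ (EuclideanSpace ℝ (Fin d)) hb

/-- A chart embeds a ball of ℝ^(d-1) into the boundary, and `2 ≤ d` makes that ball infinite. -/
theorem IsAdmissibleDomain.frontier_infinite (hd : 2 ≤ d) (hΩ : IsAdmissibleDomain Ω) :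
    (frontier Ω).Infinite := by
  obtain ⟨x₀, hx₀⟩ := hΩ.frontier_nonempty hd
  obtain ⟨L, γ, K, ρ, h⟩ := hΩ.exists_isChart hx₀
  have : Nonempty (Fin (d - 1)) := ⟨⟨0, by omega⟩⟩
  have hinj : Function.Injective fun y => graphPoint L γ y 0 := by
    intro y z hyz
    have h1 := WithLp.toLp_injective 2 (L.symm.injective hyz)
    exact (Prod.mk.inj h1).1
  have := Module.punctured_nhds_neBot ℝ (EuclideanSpace ℝ (Fin (d - 1))) (L x₀).fst
  have hinf : (Metric.ball (L x₀).fst ρ).Infinite :=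
    infinite_of_mem_nhds (L x₀).fst (Metric.ball_mem_nhds _ h.pos)
  refine (hinf.image hinj.injOn).mono ?_
  rintro _ ⟨y, hy, rfl⟩
  exact h.graph_mem y hy

/-- Compactness of the closure reduces the claim to a neighbourhood of each point: a closed ball at
interior points, the upward shift of a chart at boundary points. -/
theorem IsAdmissibleDomain.rellichEstimate (hΩ : IsAdmissibleDomain Ω) : RellichEstimate Ω Ω := by
  have h : RellichEstimate Ω (Ω ∩ closure Ω) := by
    refine hΩ.isBounded.isCompact_closure.induction_on (p := fun S => RellichEstimate Ω (Ω ∩ S))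
      ?_ ?_ ?_ ?_
    · rw [Set.inter_empty]
      exact rellichEstimate_empty
    · exact fun S T hST h => h.mono (Set.inter_subset_inter_right _ hST)
    · intro S T hS hT
      rw [Set.inter_union_distrib_left]
      exact hS.union hT
    · intro x hx
      by_cases hxΩ : x ∈ Ω
      · obtain ⟨r, hr, hrΩ⟩ := Metric.nhds_basis_closedBall.mem_iff.1 (hΩ.isOpen.mem_nhds hxΩ)
        exact ⟨_, mem_nhdsWithin_of_mem_nhds (Metric.closedBall_mem_nhds x hr),
          (rellichEstimate_of_isCompact hΩ.isOpen (isCompact_closedBall x r) hrΩ).mono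
            Set.inter_subset_right⟩
      · have hxf : x ∈ frontier Ω := by
          rw [hΩ.isOpen.frontier_eq]
          exact ⟨hx, hxΩ⟩
        obtain ⟨L, γ, K, ρ, h⟩ := hΩ.exists_isChart hxf
        exact ⟨_, mem_nhdsWithin_of_mem_nhds (Metric.ball_mem_nhds x h.pos),
          rellichEstimate_of_translate hΩ.isOpen (hΩ.isOpen.measurableSet.inter measurableSet_ball)
            (hΩ.isBounded.subset Set.inter_subset_left) (verticalDir L) h.pos h.shift_mem
            Set.inter_subset_left⟩
  exact h.mono fun x hx => ⟨hx, subset_closure hx⟩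

/-- The trace of a smooth function is controlled by its `L²` norm and a small multiple of its
Dirichlet integral. -/
theorem IsAdmissibleDomain.trace_estimate (hΩ : IsAdmissibleDomain Ω) (ε : ℝ≥0∞) (hε : ε ≠ 0) :
    ∃ C : ℝ≥0∞, C ≠ ⊤ ∧ ∀ w : EuclideanSpace ℝ (Fin d) → ℂ, ContDiff ℝ ∞ w →
      ∫⁻ x, ‖w x‖ₑ ^ 2 ∂(surface Ω) ≤
        ε * (∫⁻ x in Ω, ‖fderiv ℝ w x‖ₑ ^ 2) + C * ∫⁻ x in Ω, ‖w x‖ₑ ^ 2 := by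
  rw [← surface_restrict_frontier]
  -- The inductive predicate has to hold for all ε at once, since the union step halves it.
  revert ε
  refine hΩ.isCompact_frontier.induction_on (p := fun S => ∀ ε : ℝ≥0∞, ε ≠ 0 → ∃ C : ℝ≥0∞, C ≠ ⊤ ∧
    ∀ w : EuclideanSpace ℝ (Fin d) → ℂ, ContDiff ℝ ∞ w → ∫⁻ x in S, ‖w x‖ₑ ^ 2 ∂(surface Ω) ≤
      ε * (∫⁻ x in Ω, ‖fderiv ℝ w x‖ₑ ^ 2) + C * ∫⁻ x in Ω, ‖w x‖ₑ ^ 2) ?_ ?_ ?_ ?_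
  · exact fun ε _ => ⟨0, by simp, fun w _ => by simp⟩
  · intro S T hST h ε hε
    obtain ⟨C, hC, hw⟩ := h ε hε
    exact ⟨C, hC, fun w hww => (lintegral_mono_set hST).trans (hw w hww)⟩
  · intro S T hS hT ε hε
    obtain ⟨C, hC, hw⟩ := hS (ε / 2) (by simp [hε])
    obtain ⟨C', hC', hw'⟩ := hT (ε / 2) (by simp [hε])
    refine ⟨C + C', by simp [hC, hC'], fun w hww => ?_⟩
    refine (lintegral_union_le _ _ _).trans ((add_le_add (hw w hww) (hw' w hww)).trans
      (le_of_eq ?_))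
    conv_rhs => rw [← ENNReal.add_halves ε]
    ring
  · intro x hx
    obtain ⟨L, γ, K, ρ, h⟩ := hΩ.exists_isChart hx
    refine ⟨_, mem_nhdsWithin_of_mem_nhds (Metric.ball_mem_nhds x h.pos), fun ε hε => ?_⟩
    set A : ℝ≥0∞ := ((1 + K : NNReal) : ℝ≥0∞) ^ (d - 1) with hA
    have hAtop : A ≠ ⊤ := ENNReal.pow_ne_top ENNReal.coe_ne_top
    -- A thin strip makes the gradient coefficient small; the price is the factor 1/t in `C`.
    have hsmall : ∃ t ∈ Set.Ioo 0 ρ, A * 2 * ENNReal.ofReal t ≤ ε := by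
      have h2 := ENNReal.Tendsto.const_mul (a := A * 2)
        (ENNReal.continuous_ofReal.tendsto 0) (Or.inr (ENNReal.mul_ne_top hAtop (by simp)))
      rw [ENNReal.ofReal_zero, mul_zero] at h2
      obtain ⟨t, h3, h4⟩ := ((Filter.eventually_of_mem (Ioo_mem_nhdsGT h.pos) fun _ h => h).and
        ((h2.mono_left nhdsWithin_le_nhds).eventually
          (eventually_le_nhds (pos_iff_ne_zero.2 hε)))).exists
      exact ⟨t, h3, h4⟩
    obtain ⟨t, ht, hte⟩ := hsmall
    refine ⟨A * (2 * (ENNReal.ofReal t)⁻¹), ENNReal.mul_ne_top hAtop (ENNReal.mul_ne_top (by simp)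
      (ENNReal.inv_ne_top.2 (by simpa using ht.1))), fun w hww => ?_⟩
    refine (h.lintegral_trace_le hΩ.isOpen ht.1 ht.2.le hww).trans ?_
    rw [mul_add, add_comm, ← mul_assoc, ← mul_assoc, ← mul_assoc A]
    gcongr

/-! ### Functions with vanishing gradient -/

/-- An `L²` limit of smooth functions whose gradients tend to zero is constant on balls. -/
theorem exists_ae_eq_const_ball {x₀ : EuclideanSpace ℝ (Fin d)} {r : ℝ} (hr : 0 < r)
    {u : EuclideanSpace ℝ (Fin d) → ℂ} (hu : MemLp u 2 (volume.restrict (Metric.ball x₀ r)))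
    {w : ℕ → EuclideanSpace ℝ (Fin d) → ℂ} (hw : ∀ n, ContDiff ℝ ∞ (w n))
    (hwu : Tendsto (fun n => ∫⁻ x in Metric.ball x₀ r, ‖w n x - u x‖ₑ ^ 2) atTop (𝓝 0))
    (hD : Tendsto (fun n => ∫⁻ x in Metric.ball x₀ r, ‖fderiv ℝ (w n) x‖ₑ ^ 2) atTop (𝓝 0)) :
    ∃ c : ℂ, u =ᵐ[volume.restrict (Metric.ball x₀ r)] fun _ => c := by
  set B := Metric.ball x₀ r with hB
  have hB0 : volume B ≠ 0 := (Metric.measure_ball_pos volume x₀ hr).ne'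
  have hB1 : volume B ≠ ⊤ := measure_ball_lt_top.ne
  have : IsFiniteMeasure (volume.restrict B) := ⟨by
    rw [Measure.restrict_apply_univ]; exact measure_ball_lt_top⟩
  set c : ℕ → ℂ := fun n => ⨍ y in B, w n y with hc
  have hP := fun n => lintegral_sub_average_le volume (measurableSet_ball : MeasurableSet B)
    (convex_ball x₀ r) (δ := 2 * r) (fun x hx y hy => by
      rw [← dist_eq_norm]
      have h1 := dist_triangle_right y x x₀
      rw [Metric.mem_ball] at hx hy
      linarith) hB0 hB1 (hw n)
    (((hw n).continuous.continuousOn.integrableOn_compact (isCompact_closedBall x₀ r)).mono_set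
      Metric.ball_subset_closedBall)
  set M := (volume B)⁻¹ * (ENNReal.ofReal (2 * r) ^ 2 *
    volume (Metric.closedBall (0 : EuclideanSpace ℝ (Fin d)) (2 * r))) with hM
  have hMtop : M ≠ ⊤ := ENNReal.mul_ne_top (ENNReal.inv_ne_top.2 hB0) (ENNReal.mul_ne_top
    (ENNReal.pow_ne_top ENNReal.ofReal_ne_top) measure_closedBall_lt_top.ne)
  have hlim : Tendsto (fun n => ∫⁻ x in B, ‖c n - u x‖ₑ ^ 2) atTop (𝓝 0) := by
    have h1 : Tendsto (fun n => 2 * (∫⁻ x in B, ‖w n x - u x‖ₑ ^ 2) +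
        2 * (M * ∫⁻ x in B, ‖fderiv ℝ (w n) x‖ₑ ^ 2)) atTop (𝓝 (2 * 0 + 2 * (M * 0))) :=
      (ENNReal.Tendsto.const_mul hwu (Or.inr (by simp))).add (ENNReal.Tendsto.const_mul
        (ENNReal.Tendsto.const_mul hD (Or.inr hMtop)) (Or.inr (by simp)))
    simp only [mul_zero, add_zero] at h1
    refine tendsto_of_tendsto_of_tendsto_of_le_of_le tendsto_const_nhds h1 (fun _ => zero_le)
      fun n => ?_
    calc ∫⁻ x in B, ‖c n - u x‖ₑ ^ 2
        ≤ ∫⁻ x in B, (2 * ‖w n x - u x‖ₑ ^ 2 + 2 * ‖w n x - c n‖ₑ ^ 2) := by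
          refine lintegral_mono fun x => ?_
          have h2 := enorm_add_sq_le (w n x - u x) (-(w n x - c n))
          rw [enorm_neg] at h2
          convert h2 using 3
          ring
      _ = 2 * (∫⁻ x in B, ‖w n x - u x‖ₑ ^ 2) + 2 * ∫⁻ x in B, ‖w n x - c n‖ₑ ^ 2 := by
          have hm : Measurable fun x => 2 * ‖w n x - c n‖ₑ ^ 2 :=
            (((hw n).continuous.sub continuous_const).enorm.measurable.pow_const 2).const_mul 2
          rw [lintegral_add_right _ hm, lintegral_const_mul' _ _ (by simp),
            lintegral_const_mul' _ _ (by simp)]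
      _ ≤ _ := by
          gcongr
          exact hP n
  -- The averages converge to `u` in L². The constants form a finite-dimensional, hence closed,
  -- subspace, so the limit is constant without a separate proof that the numbers `c n` converge.
  let T := Lp.constL 2 (volume.restrict B) ℂ (E := ℂ)
  have hT : ∀ n, T (c n) = (memLp_const (c n)).toLp (fun _ => c n) := fun n => rfl
  have htend : Tendsto (fun n => T (c n)) atTop (𝓝 (hu.toLp u)) := by
    simp only [hT]
    rw [Lp.tendsto_Lp_iff_tendsto_eLpNorm'', ← tendsto_sq_zero_iff]
    refine hlim.congr fun n => ?_
    rw [eLpNorm_two_sq]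
    rfl
  have hclosed : IsClosed ((LinearMap.range (T : ℂ →ₗ[ℂ] Lp ℂ 2 (volume.restrict B)) :
      Submodule ℂ _) : Set (Lp ℂ 2 (volume.restrict B))) := Submodule.closed_of_finiteDimensional _
  obtain ⟨a, ha⟩ := hclosed.mem_of_tendsto htend (Eventually.of_forall fun n => ⟨c n, rfl⟩)
  refine ⟨a, hu.coeFn_toLp.symm.trans ?_⟩
  have ha' : hu.toLp u = (memLp_const a).toLp (fun _ => a) := ha.symm
  rw [ha']
  exact MemLp.coeFn_toLp _

/-- The points near which `u` equals a given constant form an open set that is relatively closed in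
`Ω`: two overlapping balls share a set of positive measure, which forces their constants to agree.
-/
theorem exists_ae_eq_const_of_locally (hΩ : IsOpen Ω) (hc : IsConnected Ω)
    {u : EuclideanSpace ℝ (Fin d) → ℂ}
    (h : ∀ x ∈ Ω, ∃ r : ℝ, 0 < r ∧ ∃ c : ℂ, u =ᵐ[volume.restrict (Metric.ball x r)] fun _ => c) :
    ∃ c : ℂ, u =ᵐ[volume.restrict Ω] fun _ => c := by
  obtain ⟨x₀, hx₀⟩ := hc.nonempty
  obtain ⟨r₀, hr₀, c, hc₀⟩ := h x₀ hx₀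
  refine ⟨c, ?_⟩
  let A : Set (EuclideanSpace ℝ (Fin d)) :=
    {x | ∃ r : ℝ, 0 < r ∧ u =ᵐ[volume.restrict (Metric.ball x r)] fun _ => c}
  have hAo : IsOpen A := by
    rw [Metric.isOpen_iff]
    rintro x ⟨r, hr, hx⟩
    refine ⟨r / 2, half_pos hr, fun y hy => ⟨r / 2, half_pos hr, ?_⟩⟩
    refine ae_restrict_of_ae_restrict_of_subset (Metric.ball_subset_ball' ?_) hx
    rw [Metric.mem_ball] at hy
    linarith
  have hsub : Ω ⊆ A := by
    refine hc.isPreconnected.subset_of_closure_inter_subset hAo ⟨x₀, hx₀, r₀, hr₀, hc₀⟩ ?_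
    rintro x ⟨hxA, hxΩ⟩
    obtain ⟨r, hr, c', hc'⟩ := h x hxΩ
    obtain ⟨z, ⟨s, hs, hz⟩, hzx⟩ := Metric.mem_closure_iff.1 hxA r hr
    rw [dist_comm] at hzx
    have hpos : volume (Metric.ball x r ∩ Metric.ball z s) ≠ 0 :=
      ((Metric.isOpen_ball.inter Metric.isOpen_ball).measure_pos volume
        ⟨z, hzx, Metric.mem_ball_self hs⟩).ne'
    have h1 : u =ᵐ[volume.restrict (Metric.ball x r ∩ Metric.ball z s)] fun _ => c' :=
      ae_restrict_of_ae_restrict_of_subset Set.inter_subset_left hc'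
    have h2 : u =ᵐ[volume.restrict (Metric.ball x r ∩ Metric.ball z s)] fun _ => c :=
      ae_restrict_of_ae_restrict_of_subset Set.inter_subset_right hz
    have : (ae (volume.restrict (Metric.ball x r ∩ Metric.ball z s))).NeBot := by
      rw [ae_neBot]
      exact fun h0 => hpos (Measure.restrict_eq_zero.1 h0)
    obtain ⟨y, hy1, hy2⟩ := (h1.and h2).exists
    have hcc : c' = c := hy1.symm.trans hy2
    exact ⟨r, hr, hcc ▸ hc'⟩
  rw [EventuallyEq, ae_restrict_iff' hΩ.measurableSet, ae_iff]
  -- The exceptional set is null near each of its points, hence null by second countability.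
  refine measure_null_of_locally_null _ fun x hx => ?_
  simp only [Set.mem_ofPred_eq, Classical.not_imp] at hx
  obtain ⟨r, hr, hx'⟩ := hsub hx.1
  rw [EventuallyEq, ae_restrict_iff' measurableSet_ball, ae_iff] at hx'
  refine ⟨Metric.ball x r ∩ {y | ¬ (y ∈ Ω → u y = c)}, inter_mem
    (mem_nhdsWithin_of_mem_nhds (Metric.ball_mem_nhds x hr)) self_mem_nhdsWithin, ?_⟩
  refine measure_mono_null ?_ hx'
  rintro y ⟨hy1, hy2⟩ hy3
  exact hy2 fun _ => hy3 hy1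

theorem IsAdmissibleDomain.exists_ae_eq_const (hΩ : IsAdmissibleDomain Ω)
    {u : EuclideanSpace ℝ (Fin d) → ℂ} (hu : MemLp u 2 (volume.restrict Ω))
    {w : ℕ → EuclideanSpace ℝ (Fin d) → ℂ} (hw : ∀ n, ContDiff ℝ ∞ (w n))
    (hwu : Tendsto (fun n => ∫⁻ x in Ω, ‖w n x - u x‖ₑ ^ 2) atTop (𝓝 0))
    (hD : Tendsto (fun n => ∫⁻ x in Ω, ‖fderiv ℝ (w n) x‖ₑ ^ 2) atTop (𝓝 0)) :
    ∃ c : ℂ, u =ᵐ[volume.restrict Ω] fun _ => c := by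
  refine exists_ae_eq_const_of_locally hΩ.isOpen hΩ.isConnected fun x hx => ?_
  obtain ⟨r, hr, hrΩ⟩ := Metric.isOpen_iff.1 hΩ.isOpen x hx
  refine ⟨r, hr, exists_ae_eq_const_ball hr (hu.mono_measure (Measure.restrict_mono hrΩ le_rfl)) hw
    ?_ ?_⟩
  · exact tendsto_of_tendsto_of_tendsto_of_le_of_le tendsto_const_nhds hwu (fun _ => zero_le)
      fun n => lintegral_mono_set hrΩ
  · exact tendsto_of_tendsto_of_tendsto_of_le_of_le tendsto_const_nhds hD (fun _ => zero_le)
      fun n => lintegral_mono_set hrΩ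

end Domain

/-! ### Compactness from a priori estimates -/

/-- An Ehrling-type argument: a finite net for the image of the unit ball under the compact `F`,
lifted to the ball, is by the estimate a net for its image under `J`. -/
theorem isCompactOperator_of_estimate {X Z : Type*} [NormedAddCommGroup X] [NormedSpace ℂ X]
    [NormedAddCommGroup Z] [NormedSpace ℂ Z] [CompleteSpace Z] (J : X →L[ℂ] Z) (M : ℝ)
    (h : ∀ ε : ℝ, 0 < ε → ∃ (W : Type) (_ : NormedAddCommGroup W) (_ : NormedSpace ℂ W)
      (F : X →L[ℂ] W) (C : ℝ), IsCompactOperator F ∧ 0 ≤ C ∧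
        ∀ x, ‖J x‖ ^ 2 ≤ ε * (M * ‖x‖ ^ 2) + C * ‖F x‖ ^ 2) :
    IsCompactOperator J := by
  refine (isCompactOperator_iff_isCompact_closure_image_closedBall (J : X →ₗ[ℂ] Z)
    one_pos).2 ?_
  refine TotallyBounded.isCompact_of_isClosed (TotallyBounded.closure ?_) isClosed_closure
  rw [Metric.totallyBounded_iff]
  intro δ hδ
  -- Points of the unit ball are at distance at most 2, whence the 4; each of the two terms may use
  -- half of δ².
  obtain ⟨ε, hε, hεδ⟩ : ∃ ε : ℝ, 0 < ε ∧ ε * (|M| * 4) < δ ^ 2 / 2 := by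
    refine ⟨δ ^ 2 / (16 * (|M| + 1)), by positivity, ?_⟩
    have hM : 0 ≤ |M| := abs_nonneg M
    rw [div_mul_eq_mul_div, div_lt_div_iff₀ (by positivity) (by positivity)]
    nlinarith [sq_pos_of_pos hδ, mul_nonneg hM (sq_nonneg δ)]
  obtain ⟨W, _, _, F, C, hF, hC, hJ⟩ := h ε hε
  obtain ⟨η, hη, hηδ⟩ : ∃ η : ℝ, 0 < η ∧ C * η ^ 2 < δ ^ 2 / 2 := by
    refine ⟨δ / (2 * (C + 1)), by positivity, ?_⟩
    rw [div_pow, mul_div_assoc', div_lt_div_iff₀ (by positivity) (by positivity)]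
    nlinarith [sq_pos_of_pos hδ, mul_nonneg hC (sq_nonneg δ),
      mul_nonneg (mul_nonneg hC hC) (sq_nonneg δ)]
  have htb : TotallyBounded (F '' Metric.closedBall 0 1) :=
    ((isCompactOperator_iff_isCompact_closure_image_closedBall (F : X →ₗ[ℂ] W)
      one_pos).1 hF).totallyBounded.subset subset_closure
  obtain ⟨t, htF, htfin, htcov⟩ := htb.exists_subset (Metric.dist_mem_uniformity hη)
  obtain ⟨s, hs, hst⟩ := (Set.exists_subset_image_iff (f := F) (p := fun t => t.Finite ∧
    F '' Metric.closedBall 0 1 ⊆ ⋃ y ∈ t, {x | dist x y < η})).1 ⟨t, htF, htfin, htcov⟩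
  obtain ⟨g, hg⟩ : ∃ g : W → X, ∀ y ∈ t, g y ∈ Metric.closedBall (0 : X) 1 ∧ F (g y) = y := by
    classical
    choose! g hg using fun (y : W) (hy : y ∈ t) => htF hy
    exact ⟨g, hg⟩
  refine ⟨(fun y => J (g y)) '' t, htfin.image _, ?_⟩
  rintro _ ⟨x, hx, rfl⟩
  obtain ⟨y, hy, hxy⟩ := Set.mem_iUnion₂.1 (htcov ⟨x, hx, rfl⟩)
  refine Set.mem_biUnion ⟨y, hy, rfl⟩ ?_
  obtain ⟨hg1, hg2⟩ := hg y hy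
  rw [Metric.mem_ball, dist_eq_norm]
  have h1 := hJ (x - g y)
  have h2 : ‖F (x - g y)‖ < η := by
    rw [map_sub, hg2, ← dist_eq_norm]
    exact hxy
  have h3 : ‖x - g y‖ ≤ 2 := by
    rw [mem_closedBall_zero_iff] at hx hg1
    linarith [norm_sub_le x (g y)]
  have h4 : ‖x - g y‖ ^ 2 ≤ 4 := by nlinarith [norm_nonneg (x - g y)]
  have h5 : ε * (M * ‖x - g y‖ ^ 2) ≤ ε * (|M| * 4) :=
    mul_le_mul_of_nonneg_left ((mul_le_mul_of_nonneg_right (le_abs_self M) (sq_nonneg _)).trans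
      (mul_le_mul_of_nonneg_left h4 (abs_nonneg M))) hε.le
  have h6 : C * ‖F (x - g y)‖ ^ 2 ≤ C * η ^ 2 :=
    mul_le_mul_of_nonneg_left (pow_le_pow_left₀ (norm_nonneg _) h2.le 2) hC
  have h7 : ‖J (x - g y)‖ ^ 2 < δ ^ 2 := by linarith
  rw [map_sub] at h7
  exact lt_of_pow_lt_pow_left₀ 2 hδ.le h7

/-! ### The Hilbert space of functions with gradient and trace -/

/-- The complex space `L²(Ω)`. -/
abbrev DomainL2 {d : ℕ} (Ω : Set (EuclideanSpace ℝ (Fin d))) : Type :=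
  Lp ℂ 2 (volume.restrict Ω)

/-- The Hilbert space `L²(Ω) × L²(Ω)^d × L²(∂Ω)`. -/
abbrev Triples {d : ℕ} (Ω : Set (EuclideanSpace ℝ (Fin d))) : Type :=
  WithLp 2 (DomainL2 Ω × WithLp 2 (PiLp 2 (fun _ : Fin d => DomainL2 Ω) × BoundaryL2 Ω))

section Triples

variable {d : ℕ} (Ω : Set (EuclideanSpace ℝ (Fin d)))

/-- The function component of a triple. -/
def valL : Triples Ω →L[ℂ] DomainL2 Ω := WithLp.fstL 2 ℂ _ _

/-- The components of the gradient component of a triple. -/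
def gradL (i : Fin d) : Triples Ω →L[ℂ] DomainL2 Ω :=
  (PiLp.proj 2 (fun _ : Fin d => DomainL2 Ω) i).comp
    ((WithLp.fstL 2 ℂ _ _).comp (WithLp.sndL 2 ℂ _ _))

/-- The trace component of a triple. -/
def trL : Triples Ω →L[ℂ] BoundaryL2 Ω := (WithLp.sndL 2 ℂ _ _).comp (WithLp.sndL 2 ℂ _ _)

/-- The triple with given components. -/
def mkTriple (p : DomainL2 Ω × (Fin d → DomainL2 Ω) × BoundaryL2 Ω) : Triples Ω :=
  WithLp.toLp 2 (p.1, WithLp.toLp 2 (WithLp.toLp 2 p.2.1, p.2.2))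

variable {Ω}

theorem continuous_mkTriple : Continuous (mkTriple Ω) := by
  refine (WithLp.prod_continuous_toLp 2 _ _).comp (continuous_fst.prodMk
    ((WithLp.prod_continuous_toLp 2 _ _).comp (Continuous.prodMk ?_ ?_)))
  · exact (PiLp.continuous_toLp 2 _).comp (continuous_fst.comp continuous_snd)
  · exact continuous_snd.comp continuous_snd

theorem norm_sq_triple (y : Triples Ω) :
    ‖y‖ ^ 2 = ‖valL Ω y‖ ^ 2 + (∑ i, ‖gradL Ω i y‖ ^ 2) + ‖trL Ω y‖ ^ 2 := by
  rw [WithLp.prod_norm_sq_eq_of_L2, WithLp.prod_norm_sq_eq_of_L2, PiLp.norm_sq_eq_of_L2, add_assoc]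
  rfl

theorem triple_eq_zero {y : Triples Ω} (h1 : valL Ω y = 0) (h2 : ∀ i, gradL Ω i y = 0)
    (h3 : trL Ω y = 0) : y = 0 := by
  have h := norm_sq_triple y
  simp only [h1, h2, h3, norm_zero, ne_eq, OfNat.ofNat_ne_zero, not_false_eq_true, zero_pow,
    Finset.sum_const_zero, add_zero, pow_eq_zero_iff, norm_eq_zero] at h
  exact h

/-- The square of the `L²` norm of the gradient component. -/
def gradSq (y : Triples Ω) : ℝ := ∑ i, ‖gradL Ω i y‖ ^ 2

theorem gradSq_nonneg (y : Triples Ω) : 0 ≤ gradSq y := Finset.sum_nonneg fun _ _ => sq_nonneg _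

theorem continuous_gradSq : Continuous (gradSq : Triples Ω → ℝ) :=
  continuous_finsetSum _ fun i _ => ((gradL Ω i).continuous.norm).pow 2

theorem gradSq_le (y : Triples Ω) : gradSq y ≤ ‖y‖ ^ 2 := by
  rw [norm_sq_triple, gradSq]
  nlinarith [sq_nonneg ‖valL Ω y‖, sq_nonneg ‖trL Ω y‖]

/-- `y` consists of the smooth function `w`, its gradient and its restriction to the boundary. -/
structure IsSmoothTriple (y : Triples Ω) (w : EuclideanSpace ℝ (Fin d) → ℂ) : Prop where
  contDiff : ContDiff ℝ ∞ w
  val : valL Ω y =ᵐ[volume.restrict Ω] w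
  grad : ∀ i, gradL Ω i y =ᵐ[volume.restrict Ω] partialDeriv i w
  trace : trL Ω y =ᵐ[surface Ω] w

variable (Ω) in
/-- The triples that come from smooth functions. -/
def smoothTriples : Submodule ℂ (Triples Ω) where
  carrier := {y | ∃ w, IsSmoothTriple y w}
  zero_mem' := by
    refine ⟨0, contDiff_const, ?_, fun i => ?_, ?_⟩
    · rw [map_zero]; exact Lp.coeFn_zero _ _ _
    · rw [map_zero]
      refine (Lp.coeFn_zero _ _ _).trans (Eventually.of_forall fun x => ?_)
      simp [partialDeriv]
    · rw [map_zero]; exact Lp.coeFn_zero _ _ _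
  add_mem' := by
    rintro y z ⟨w, hw⟩ ⟨v, hv⟩
    refine ⟨w + v, hw.contDiff.add hv.contDiff, ?_, fun i => ?_, ?_⟩
    · rw [map_add]; exact (Lp.coeFn_add _ _).trans (hw.val.add hv.val)
    · rw [map_add]
      refine (Lp.coeFn_add _ _).trans (((hw.grad i).add (hv.grad i)).trans
        (Eventually.of_forall fun x => ?_))
      rw [partialDeriv, fderiv_add (hw.contDiff.differentiable (by simp) x)
        (hv.contDiff.differentiable (by simp) x)]
      rfl
    · rw [map_add]; exact (Lp.coeFn_add _ _).trans (hw.trace.add hv.trace)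
  smul_mem' := by
    rintro c y ⟨w, hw⟩
    refine ⟨c • w, hw.contDiff.const_smul c, ?_, fun i => ?_, ?_⟩
    · rw [map_smul]; exact (Lp.coeFn_smul _ _).trans (hw.val.const_smul c)
    · rw [map_smul]
      refine (Lp.coeFn_smul _ _).trans (((hw.grad i).const_smul c).trans
        (Eventually.of_forall fun x => ?_))
      rw [partialDeriv, fderiv_const_smul (hw.contDiff.differentiable (by simp) x)]
      rfl
    · rw [map_smul]; exact (Lp.coeFn_smul _ _).trans (hw.trace.const_smul c)

variable (Ω) in
/-- The space of the triples `(u, ∇u, u|_∂Ω)`, as the closure of the smooth ones. -/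
def traceSpace : Submodule ℂ (Triples Ω) := (smoothTriples Ω).topologicalClosure

theorem isClosed_traceSpace : IsClosed (traceSpace Ω : Set (Triples Ω)) :=
  (smoothTriples Ω).isClosed_topologicalClosure

theorem exists_smooth_seq {y : Triples Ω} (hy : y ∈ traceSpace Ω) :
    ∃ (z : ℕ → Triples Ω) (w : ℕ → EuclideanSpace ℝ (Fin d) → ℂ),
      (∀ n, IsSmoothTriple (z n) (w n)) ∧ Tendsto z atTop (𝓝 y) := by
  obtain ⟨z, hz, hlim⟩ := mem_closure_iff_seq_limit.1 hy
  choose w hw using hz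
  exact ⟨z, w, hw, hlim⟩

/-- A continuous inequality between quadratic quantities that holds for smooth triples holds on the
trace space. -/
theorem le_on_traceSpace {f g : Triples Ω → ℝ} (hf : Continuous f) (hg : Continuous g)
    (h : ∀ y w, IsSmoothTriple y w → f y ≤ g y) : ∀ y ∈ traceSpace Ω, f y ≤ g y := fun _ hy =>
  closure_minimal (t := {z | f z ≤ g z}) (by rintro z ⟨w, hw⟩; exact h z w hw)
    (isClosed_le hf hg) hy

/-! ### Estimates and compactness on the trace space. -/

theorem enorm_fderiv_sq_le (w : EuclideanSpace ℝ (Fin d) → ℂ) (x : EuclideanSpace ℝ (Fin d)) :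
    ‖fderiv ℝ w x‖ₑ ^ 2 ≤ ∑ i, ‖partialDeriv i w x‖ₑ ^ 2 := by
  have h1 : ‖fderiv ℝ w x‖ ≤ √(∑ i, ‖partialDeriv i w x‖ ^ 2) := by
    refine ContinuousLinearMap.opNorm_le_bound _ (Real.sqrt_nonneg _) fun v => ?_
    have hv : fderiv ℝ w x v = ∑ i, v i • partialDeriv i w x := by
      conv_lhs => rw [← (EuclideanSpace.basisFun (Fin d) ℝ).sum_repr v]
      simp [partialDeriv]
    rw [hv, EuclideanSpace.norm_eq, ← Real.sqrt_mul (Finset.sum_nonneg fun _ _ => sq_nonneg _)]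
    refine (norm_sum_le _ _).trans (Real.le_sqrt_of_sq_le ?_)
    simp only [norm_smul]
    rw [mul_comm]
    exact Finset.sum_mul_sq_le_sq_mul_sq _ _ _
  have h2 : ‖fderiv ℝ w x‖ ^ 2 ≤ ∑ i, ‖partialDeriv i w x‖ ^ 2 :=
    (Real.le_sqrt (norm_nonneg _) (Finset.sum_nonneg fun _ _ => sq_nonneg _)).1 h1
  have h3 := ENNReal.ofReal_le_ofReal h2
  rw [ENNReal.ofReal_sum_of_nonneg fun _ _ => sq_nonneg _] at h3
  simpa only [ENNReal.ofReal_pow (norm_nonneg _), ofReal_norm] using h3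

theorem IsSmoothTriple.lintegral_val {y : Triples Ω} {w : EuclideanSpace ℝ (Fin d) → ℂ}
    (h : IsSmoothTriple y w) :
    ∫⁻ x in Ω, ‖w x‖ₑ ^ 2 = ENNReal.ofReal (‖valL Ω y‖ ^ 2) := by
  rw [← eLpNorm_two_sq, ← eLpNorm_congr_ae h.val, ← Lp.enorm_def, ENNReal.ofReal_pow (norm_nonneg _),
    ofReal_norm]

theorem IsSmoothTriple.lintegral_trace {y : Triples Ω} {w : EuclideanSpace ℝ (Fin d) → ℂ}
    (h : IsSmoothTriple y w) :
    ∫⁻ x, ‖w x‖ₑ ^ 2 ∂(surface Ω) = ENNReal.ofReal (‖trL Ω y‖ ^ 2) := by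
  rw [← eLpNorm_two_sq, ← eLpNorm_congr_ae h.trace, ← Lp.enorm_def,
    ENNReal.ofReal_pow (norm_nonneg _), ofReal_norm]

theorem IsSmoothTriple.lintegral_fderiv_le {y : Triples Ω} {w : EuclideanSpace ℝ (Fin d) → ℂ}
    (h : IsSmoothTriple y w) :
    ∫⁻ x in Ω, ‖fderiv ℝ w x‖ₑ ^ 2 ≤ ENNReal.ofReal (gradSq y) := by
  have hm : ∀ i : Fin d, Measurable fun x => ‖partialDeriv i w x‖ₑ ^ 2 := fun i =>
    (((h.contDiff.continuous_fderiv (by simp)).clm_apply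
      continuous_const).enorm.measurable).pow_const 2
  refine (lintegral_mono fun x => enorm_fderiv_sq_le w x).trans (le_of_eq ?_)
  rw [lintegral_finsetSum _ fun i _ => hm i, gradSq,
    ENNReal.ofReal_sum_of_nonneg fun _ _ => sq_nonneg _]
  refine Finset.sum_congr rfl fun i _ => ?_
  rw [← eLpNorm_two_sq, ← eLpNorm_congr_ae (h.grad i), ← Lp.enorm_def,
    ENNReal.ofReal_pow (norm_nonneg _), ofReal_norm]

theorem le_of_ofReal_estimate {a b c ε : ℝ} {D C : ℝ≥0∞} (hb : 0 ≤ b) (hc : 0 ≤ c)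
    (hε : 0 ≤ ε) (hC : C ≠ ⊤) (hD : D ≤ ENNReal.ofReal b)
    (h : ENNReal.ofReal a ≤ ENNReal.ofReal ε * D + C * ENNReal.ofReal c) :
    a ≤ ε * b + C.toReal * c := by
  have h1 : ENNReal.ofReal a ≤ ENNReal.ofReal (ε * b + C.toReal * c) := by
    rw [ENNReal.ofReal_add (by positivity) (by positivity), ENNReal.ofReal_mul hε,
      ENNReal.ofReal_mul ENNReal.toReal_nonneg, ENNReal.ofReal_toReal hC]
    exact h.trans (by gcongr)
  exact (ENNReal.ofReal_le_ofReal_iff (by positivity)).1 h1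

theorem IsAdmissibleDomain.trL_estimate (hΩ : IsAdmissibleDomain Ω) {ε : ℝ} (hε : 0 < ε) :
    ∃ C : ℝ, 0 ≤ C ∧ ∀ y ∈ traceSpace Ω,
      ‖trL Ω y‖ ^ 2 ≤ ε * gradSq y + C * ‖valL Ω y‖ ^ 2 := by
  obtain ⟨C, hC, h⟩ := hΩ.trace_estimate (ENNReal.ofReal ε) (by simpa using hε)
  refine ⟨C.toReal, ENNReal.toReal_nonneg, le_on_traceSpace ((trL Ω).continuous.norm.pow 2)
    ((continuous_gradSq.const_mul ε).add (((valL Ω).continuous.norm.pow 2).const_mul _))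
    fun y w hw => ?_⟩
  have h1 := h w hw.contDiff
  rw [hw.lintegral_val, hw.lintegral_trace] at h1
  exact le_of_ofReal_estimate (gradSq_nonneg y) (sq_nonneg _) hε.le hC hw.lintegral_fderiv_le h1

/-- The finitely many integrals of the Rellich estimate are inner products with indicator functions,
so they assemble into a bounded map `F` of finite rank. -/
theorem IsAdmissibleDomain.valL_estimate (hΩ : IsAdmissibleDomain Ω) {ε : ℝ} (hε : 0 < ε) :
    ∃ (ι : Type) (_ : Fintype ι) (F : DomainL2 Ω →L[ℂ] EuclideanSpace ℂ ι) (C : ℝ), 0 ≤ C ∧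
      ∀ y ∈ traceSpace Ω, ‖valL Ω y‖ ^ 2 ≤ ε * gradSq y + C * ‖F (valL Ω y)‖ ^ 2 := by
  obtain ⟨ι, hι, Q, C, hC, hQ, h⟩ := hΩ.rellichEstimate (ENNReal.ofReal ε) (by simpa using hε)
  have hfin : ∀ i, (volume.restrict Ω) (Q i) ≠ ⊤ := fun i =>
    ((Measure.restrict_apply_le _ _).trans_lt
      ((measure_mono (hQ i).2).trans_lt hΩ.volume_lt_top)).ne
  let F : DomainL2 Ω →L[ℂ] EuclideanSpace ℂ ι :=
    ((PiLp.continuousLinearEquiv 2 ℂ fun _ : ι => ℂ).symm : (ι → ℂ) →L[ℂ] _).comp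
      (ContinuousLinearMap.pi fun i =>
        innerSL ℂ (indicatorConstLp 2 (hQ i).1 (hfin i) (1 : ℂ)))
  have hF : ∀ (u : DomainL2 Ω) i, F u i = ∫ x in Q i, u x := by
    intro u i
    have h1 := L2.inner_indicatorConstLp_eq_inner_setIntegral ℂ (hQ i).1 (hfin i) (1 : ℂ) u
    rw [Measure.restrict_restrict (hQ i).1, Set.inter_eq_left.2 (hQ i).2] at h1
    refine h1.trans ?_
    rw [RCLike.inner_apply, map_one, mul_one]
  refine ⟨ι, hι, F, C.toReal, ENNReal.toReal_nonneg, le_on_traceSpace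
    ((valL Ω).continuous.norm.pow 2) ((continuous_gradSq.const_mul ε).add
      (((F.continuous.comp (valL Ω).continuous).norm.pow 2).const_mul _)) fun y w hw => ?_⟩
  have h1 := h w hw.contDiff
  have h2 : ∑ i, ‖∫ x in Q i, w x‖ₑ ^ 2 = ENNReal.ofReal (‖F (valL Ω y)‖ ^ 2) := by
    rw [EuclideanSpace.norm_sq_eq, ENNReal.ofReal_sum_of_nonneg fun _ _ => sq_nonneg _]
    refine Finset.sum_congr rfl fun i _ => ?_
    rw [hF, ENNReal.ofReal_pow (norm_nonneg _), ofReal_norm]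
    congr 2
    exact integral_congr_ae (ae_restrict_of_ae_restrict_of_subset (hQ i).2
      (hw.val.mono fun x hx => hx.symm))
  rw [hw.lintegral_val, h2] at h1
  exact le_of_ofReal_estimate (gradSq_nonneg y) (sq_nonneg _) hε.le hC hw.lintegral_fderiv_le h1

/-- Rellich's theorem. -/
theorem IsAdmissibleDomain.isCompactOperator_valL (hΩ : IsAdmissibleDomain Ω) :
    IsCompactOperator ((valL Ω).comp (traceSpace Ω).subtypeL) := by
  refine isCompactOperator_of_estimate _ 1 fun ε hε => ?_
  obtain ⟨ι, hι, F, C, hC, h⟩ := hΩ.valL_estimate hε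
  refine ⟨EuclideanSpace ℂ ι, inferInstance, inferInstance,
    F.comp ((valL Ω).comp (traceSpace Ω).subtypeL), C,
    isCompactOperator_of_locallyCompactSpace_dom _, hC,
    fun x => (h x x.2).trans ?_⟩
  rw [one_mul]
  gcongr
  · exact gradSq_le _
  · exact le_rfl

/-- Compactness of the trace. -/
theorem IsAdmissibleDomain.isCompactOperator_trL (hΩ : IsAdmissibleDomain Ω) :
    IsCompactOperator ((trL Ω).comp (traceSpace Ω).subtypeL) := by
  refine isCompactOperator_of_estimate _ 1 fun ε hε => ?_
  obtain ⟨C, hC, h⟩ := hΩ.trL_estimate hε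
  -- The comparison map is now the embedding into L²(Ω), which is compact by Rellich's theorem.
  refine ⟨DomainL2 Ω, inferInstance, inferInstance,
    (valL Ω).comp (traceSpace Ω).subtypeL, C, hΩ.isCompactOperator_valL, hC,
    fun x => (h x x.2).trans ?_⟩
  rw [one_mul]
  gcongr
  · exact gradSq_le _
  · exact le_rfl

end Triples

/-! ### Sobolev functions with traces and the trace space -/

theorem memLp_of_continuous {E : Type*} [TopologicalSpace E] [MeasurableSpace E]
    [OpensMeasurableSpace E] [SecondCountableTopology E] {μ : Measure E} [IsFiniteMeasure μ]
    {K : Set E} (hK : IsCompact K) (hKm : MeasurableSet K) (hμ : μ.restrict K = μ) {f : E → ℂ}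
    (hf : Continuous f) (p : ℝ≥0∞) : MemLp f p μ := by
  obtain ⟨C, hC⟩ := hK.exists_bound_of_continuousOn hf.continuousOn
  refine MemLp.of_bound hf.measurable.aestronglyMeasurable C ?_
  rw [← hμ]
  exact (ae_restrict_mem hKm).mono hC

/-- Writing pairings with test functions as inner products makes the weak-gradient identity a closed
condition. -/
theorem integral_mul_eq_inner_star {α : Type*} [MeasurableSpace α] {μ : Measure α} {φ : α → ℂ}
    (hφ : MemLp φ 2 μ) (u : Lp ℂ 2 μ) : ∫ x, u x * φ x ∂μ = inner ℂ (hφ.star.toLp) u := by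
  rw [L2.inner_def]
  refine integral_congr_ae (hφ.star.coeFn_toLp.mono fun x hx => ?_)
  simp only [hx, RCLike.inner_apply, Pi.star_apply, RCLike.star_def, RCLike.conj_conj]

theorem tendsto_Lp_iff_of_ae {α : Type*} [MeasurableSpace α] {μ : Measure α} {f : ℕ → Lp ℂ 2 μ}
    {g : Lp ℂ 2 μ} {w : ℕ → α → ℂ} {u : α → ℂ} (hf : ∀ n, f n =ᵐ[μ] w n) (hg : g =ᵐ[μ] u) :
    Tendsto f atTop (𝓝 g) ↔ Tendsto (fun n => eLpNorm (fun x => w n x - u x) 2 μ) atTop (𝓝 0) := by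
  rw [Lp.tendsto_Lp_iff_tendsto_eLpNorm']
  refine tendsto_congr fun n => eLpNorm_congr_ae ?_
  exact (hf n).sub hg

section Correspondence

variable {d : ℕ} {Ω : Set (EuclideanSpace ℝ (Fin d))}

theorem tendsto_triple {y : ℕ → Triples Ω} {a : DomainL2 Ω} {b : Fin d → DomainL2 Ω}
    {c : BoundaryL2 Ω} (h1 : Tendsto (fun n => valL Ω (y n)) atTop (𝓝 a))
    (h2 : ∀ i, Tendsto (fun n => gradL Ω i (y n)) atTop (𝓝 (b i)))
    (h3 : Tendsto (fun n => trL Ω (y n)) atTop (𝓝 c)) :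
    Tendsto y atTop (𝓝 (mkTriple Ω (a, b, c))) :=
  (continuous_mkTriple.tendsto _).comp (h1.prodMk_nhds ((tendsto_pi_nhds.2 h2).prodMk_nhds h3))

theorem IsAdmissibleDomain.memLp_domain (hΩ : IsAdmissibleDomain Ω)
    {f : EuclideanSpace ℝ (Fin d) → ℂ} (hf : Continuous f) : MemLp f 2 (volume.restrict Ω) := by
  have : IsFiniteMeasure (volume.restrict Ω) := ⟨by
    rw [Measure.restrict_apply_univ]; exact hΩ.volume_lt_top⟩
  refine memLp_of_continuous hΩ.isBounded.isCompact_closure isClosed_closure.measurableSet ?_ hf 2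
  rw [Measure.restrict_restrict isClosed_closure.measurableSet,
    Set.inter_eq_right.2 subset_closure]

theorem IsAdmissibleDomain.memLp_boundary (hΩ : IsAdmissibleDomain Ω)
    {f : EuclideanSpace ℝ (Fin d) → ℂ} (hf : Continuous f) : MemLp f 2 (surface Ω) := by
  have := hΩ.isFiniteMeasure_surface
  exact memLp_of_continuous hΩ.isCompact_frontier isClosed_frontier.measurableSet
    surface_restrict_frontier hf 2

theorem continuous_partialDeriv {w : EuclideanSpace ℝ (Fin d) → ℂ} (hw : ContDiff ℝ ∞ w)
    (i : Fin d) : Continuous (partialDeriv i w) :=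
  (hw.continuous_fderiv (by simp)).clm_apply continuous_const

theorem IsAdmissibleDomain.exists_isSmoothTriple (hΩ : IsAdmissibleDomain Ω)
    {w : EuclideanSpace ℝ (Fin d) → ℂ} (hw : ContDiff ℝ ∞ w) :
    ∃ y : Triples Ω, IsSmoothTriple y w :=
  ⟨mkTriple Ω ((hΩ.memLp_domain hw.continuous).toLp w,
    fun i => (hΩ.memLp_domain (continuous_partialDeriv hw i)).toLp _,
    (hΩ.memLp_boundary hw.continuous).toLp w), hw,
    (hΩ.memLp_domain hw.continuous).coeFn_toLp,
    fun i => (hΩ.memLp_domain (continuous_partialDeriv hw i)).coeFn_toLp,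
    (hΩ.memLp_boundary hw.continuous).coeFn_toLp⟩

theorem IsSmoothTriple.mem {y : Triples Ω} {w : EuclideanSpace ℝ (Fin d) → ℂ}
    (h : IsSmoothTriple y w) : y ∈ traceSpace Ω :=
  (smoothTriples Ω).le_topologicalClosure ⟨w, h⟩

/-- The triple of a Sobolev function. -/
def MemH1.triple {u : EuclideanSpace ℝ (Fin d) → ℂ} {G : Fin d → EuclideanSpace ℝ (Fin d) → ℂ}
    (h : MemH1 Ω u G) (g : BoundaryL2 Ω) : Triples Ω :=
  mkTriple Ω (h.memLp.toLp u, fun i => (h.memLp_grad i).toLp (G i), g)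

theorem HasTrace.triple_mem (hΩ : IsAdmissibleDomain Ω) {u : EuclideanSpace ℝ (Fin d) → ℂ}
    {G : Fin d → EuclideanSpace ℝ (Fin d) → ℂ} {g : BoundaryL2 Ω} (ht : HasTrace Ω u G g)
    (h : MemH1 Ω u G) : h.triple g ∈ traceSpace Ω := by
  obtain ⟨w, hw, h1, h2, h3⟩ := ht
  choose y hy using fun n => hΩ.exists_isSmoothTriple (hw n)
  refine mem_closure_of_tendsto (tendsto_triple (y := y) ?_ (fun i => ?_) ?_)
    (Eventually.of_forall fun n => ⟨w n, hy n⟩)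
  · exact (tendsto_Lp_iff_of_ae (fun n => (hy n).val) (MemLp.coeFn_toLp _)).2 h1
  · exact (tendsto_Lp_iff_of_ae (fun n => (hy n).grad i) (MemLp.coeFn_toLp _)).2 (h2 i)
  · exact (tendsto_Lp_iff_of_ae (fun n => (hy n).trace) (EventuallyEq.refl _ _)).2 h3

theorem hasTrace_of_mem {y : Triples Ω} (hy : y ∈ traceSpace Ω) :
    HasTrace Ω (valL Ω y) (fun i => gradL Ω i y) (trL Ω y) := by
  obtain ⟨z, w, hw, hlim⟩ := exists_smooth_seq hy
  refine ⟨w, fun n => (hw n).contDiff, ?_, fun i => ?_, ?_⟩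
  · exact (tendsto_Lp_iff_of_ae (fun n => (hw n).val) (EventuallyEq.refl _ _)).1
      (((valL Ω).continuous.tendsto y).comp hlim)
  · exact (tendsto_Lp_iff_of_ae (fun n => (hw n).grad i) (EventuallyEq.refl _ _)).1
      (((gradL Ω i).continuous.tendsto y).comp hlim)
  · exact (tendsto_Lp_iff_of_ae (fun n => (hw n).trace) (EventuallyEq.refl _ _)).1
      (((trL Ω).continuous.tendsto y).comp hlim)

theorem integral_mul_partialDeriv {w ψ : EuclideanSpace ℝ (Fin d) → ℂ} (hw : ContDiff ℝ ∞ w)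
    (hψ : ContDiff ℝ ∞ ψ) (hc : HasCompactSupport ψ) (hs : tsupport ψ ⊆ Ω) (i : Fin d) :
    ∫ x in Ω, w x * partialDeriv i ψ x = - ∫ x in Ω, partialDeriv i w x * ψ x := by
  have hz : ∀ x, x ∉ Ω → ψ x = 0 := fun x hx => image_eq_zero_of_notMem_tsupport fun h => hx (hs h)
  have hz' : ∀ x, x ∉ Ω → partialDeriv i ψ x = 0 := fun x hx => by
    have : fderiv ℝ ψ x = 0 := by
      by_contra h
      exact hx (hs (support_fderiv_subset ℝ h))
    simp [partialDeriv, this]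
  rw [setIntegral_eq_integral_of_forall_compl_eq_zero fun x hx => by rw [hz' x hx, mul_zero],
    setIntegral_eq_integral_of_forall_compl_eq_zero fun x hx => by rw [hz x hx, mul_zero]]
  have hcd : HasCompactSupport (partialDeriv i ψ) :=
    (hc.fderiv ℝ).comp_left (g := fun T : EuclideanSpace ℝ (Fin d) →L[ℝ] ℂ =>
      T (EuclideanSpace.single i (1 : ℝ))) (by simp)
  refine integral_mul_fderiv_eq_neg_fderiv_mul_of_integrable ?_ ?_ ?_
    (fun x _ => hw.differentiable (by simp) x) (fun x _ => hψ.differentiable (by simp) x)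
  · exact ((continuous_partialDeriv hw i).mul hψ.continuous).integrable_of_hasCompactSupport
      hc.mul_left
  · exact (hw.continuous.mul (continuous_partialDeriv hψ i)).integrable_of_hasCompactSupport
      hcd.mul_left
  · exact (hw.continuous.mul hψ.continuous).integrable_of_hasCompactSupport hc.mul_left

/-- For smooth triples the weak-gradient identity is integration by parts; for a fixed test function
both sides are continuous in the triple, so it survives the closure. -/
theorem memH1_of_mem (hΩ : IsAdmissibleDomain Ω) {y : Triples Ω} (hy : y ∈ traceSpace Ω) :
    MemH1 Ω (valL Ω y) (fun i => gradL Ω i y) := by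
  refine ⟨Lp.memLp _, fun i => Lp.memLp _, fun i ψ hψ hc hs => ?_⟩
  have hψm := hΩ.memLp_domain hψ.continuous
  have hdm := hΩ.memLp_domain (continuous_partialDeriv hψ i)
  have hcl : IsClosed {y : Triples Ω | inner ℂ (hdm.star.toLp) (valL Ω y) =
      - inner ℂ (hψm.star.toLp) (gradL Ω i y)} :=
    isClosed_eq (continuous_const.inner (valL Ω).continuous)
      (continuous_const.inner (gradL Ω i).continuous).neg
  have h := closure_minimal (s := (smoothTriples Ω : Set (Triples Ω))) (by
    rintro z ⟨w, hw⟩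
    change inner ℂ (hdm.star.toLp) (valL Ω z) = - inner ℂ (hψm.star.toLp) (gradL Ω i z)
    have h1 : ∫ x in Ω, valL Ω z x * partialDeriv i ψ x = ∫ x in Ω, w x * partialDeriv i ψ x :=
      integral_congr_ae (hw.val.mono fun x hx => by simp only [hx])
    have h2 : ∫ x in Ω, gradL Ω i z x * ψ x = ∫ x in Ω, partialDeriv i w x * ψ x :=
      integral_congr_ae ((hw.grad i).mono fun x hx => by simp only [hx])
    rw [← integral_mul_eq_inner_star hdm, ← integral_mul_eq_inner_star hψm, h1, h2]
    exact integral_mul_partialDeriv hw.contDiff hψ hc hs i) hcl hy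
  rw [integral_mul_eq_inner_star hdm, integral_mul_eq_inner_star hψm]
  exact h

/-! ### Constants and the mean-free subspace -/

theorem IsSmoothTriple.gradL_eq_zero {y : Triples Ω} {c : ℂ} (h : IsSmoothTriple y fun _ => c)
    (i : Fin d) : gradL Ω i y = 0 := by
  refine Lp.ext ((h.grad i).trans (EventuallyEq.trans ?_ (Lp.coeFn_zero _ _ _).symm))
  exact Eventually.of_forall fun x => by simp [partialDeriv]

theorem IsSmoothTriple.meanFree_eq {e : Triples Ω} (he : IsSmoothTriple e fun _ => 1) :
    meanFree Ω = (Submodule.span ℂ {trL Ω e})ᗮ := by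
  have : {b : BoundaryL2 Ω | ⇑b =ᵐ[surface Ω] fun _ => (1 : ℂ)} = {trL Ω e} := by
    ext b
    exact ⟨fun hb => Lp.ext (EventuallyEq.trans hb he.trace.symm), fun hb => by
      rw [Set.mem_singleton_iff.1 hb]; exact he.trace⟩
  rw [meanFree, this]

theorem IsSmoothTriple.mem_meanFree_iff {e : Triples Ω} (he : IsSmoothTriple e fun _ => 1)
    {g : BoundaryL2 Ω} : g ∈ meanFree Ω ↔ inner ℂ (trL Ω e) g = 0 := by
  rw [he.meanFree_eq, Submodule.mem_orthogonal_singleton_iff_inner_right]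

theorem IsAdmissibleDomain.trL_one_ne_zero (hd : 2 ≤ d) (hΩ : IsAdmissibleDomain Ω) {e : Triples Ω}
    (he : IsSmoothTriple e fun _ => 1) : trL Ω e ≠ 0 := by
  intro h0
  obtain ⟨x, hx⟩ := hΩ.frontier_nonempty hd
  have hpos := hΩ.surface_ball_pos hx one_pos
  have h1 : (fun _ => (1 : ℂ)) =ᵐ[surface Ω] fun _ => 0 := by
    refine he.trace.symm.trans ?_
    rw [h0]
    exact Lp.coeFn_zero _ _ _
  have h2 : surface Ω = 0 := by
    rw [← ae_eq_bot, ← eventually_false_iff_eq_bot]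
    exact h1.mono fun x hx => one_ne_zero hx
  rw [h2] at hpos
  simp at hpos

/-- A vanishing gradient makes the function constant on the connected `Ω`. After subtracting that
constant, the trace estimate forces the trace to vanish as well. -/
theorem IsAdmissibleDomain.exists_eq_smul_one (hΩ : IsAdmissibleDomain Ω) {e : Triples Ω}
    (he : IsSmoothTriple e fun _ => 1) {y : Triples Ω} (hy : y ∈ traceSpace Ω)
    (hgrad : ∀ i, gradL Ω i y = 0) : ∃ c : ℂ, y = c • e := by
  obtain ⟨z, w, hw, hlim⟩ := exists_smooth_seq hy
  have hg0 : gradSq y = 0 := by simp [gradSq, hgrad]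
  obtain ⟨c, hc⟩ := hΩ.exists_ae_eq_const (Lp.memLp (valL Ω y)) (fun n => (hw n).contDiff) (by
      have h1 := (tendsto_Lp_iff_of_ae (fun n => (hw n).val) (EventuallyEq.refl _ _)).1
        (((valL Ω).continuous.tendsto y).comp hlim)
      rw [← tendsto_sq_zero_iff] at h1
      simpa only [eLpNorm_two_sq] using h1) (by
      have h1 := (ENNReal.continuous_ofReal.tendsto _).comp ((continuous_gradSq.tendsto y).comp hlim)
      rw [hg0, ENNReal.ofReal_zero] at h1
      exact tendsto_of_tendsto_of_tendsto_of_le_of_le tendsto_const_nhds h1 (fun _ => zero_le)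
        fun n => (hw n).lintegral_fderiv_le)
  refine ⟨c, sub_eq_zero.1 ?_⟩
  have hmem : y - c • e ∈ traceSpace Ω := sub_mem hy (Submodule.smul_mem _ _ he.mem)
  have hval : valL Ω (y - c • e) = 0 := by
    rw [map_sub, map_smul, sub_eq_zero]
    refine Lp.ext (hc.trans (EventuallyEq.trans ?_ (Lp.coeFn_smul _ _).symm))
    exact he.val.mono fun x hx => by simp [hx]
  have hgr : ∀ i, gradL Ω i (y - c • e) = 0 := fun i => by
    rw [map_sub, map_smul, hgrad, he.gradL_eq_zero, smul_zero, sub_zero]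
  refine triple_eq_zero hval hgr ?_
  obtain ⟨C, -, hC⟩ := hΩ.trL_estimate one_pos
  have h1 := hC _ hmem
  simp only [gradSq, hval, hgr, norm_zero, ne_eq, OfNat.ofNat_ne_zero, not_false_eq_true, zero_pow,
    Finset.sum_const_zero, mul_zero, add_zero] at h1
  exact norm_eq_zero.1 (pow_eq_zero_iff two_ne_zero |>.1 (le_antisymm h1 (sq_nonneg _)))

/-! ### Mean-free traces and the Poincaré inequality. -/

variable (Ω) in
/-- The subspace of the trace space with mean-free traces. -/
def freeSpace : Submodule ℂ (Triples Ω) :=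
  traceSpace Ω ⊓ (meanFree Ω).comap (trL Ω : Triples Ω →ₗ[ℂ] BoundaryL2 Ω)

theorem isClosed_freeSpace : IsClosed (freeSpace Ω : Set (Triples Ω)) :=
  isClosed_traceSpace.inter ((Submodule.isClosed_orthogonal _).preimage (trL Ω).continuous)

instance : CompleteSpace (freeSpace Ω) := isClosed_freeSpace.completeSpace_coe

/-- Every element of the trace space differs from a mean-free one by a constant. -/
theorem IsAdmissibleDomain.exists_sub_smul_mem_freeSpace (hd : 2 ≤ d) (hΩ : IsAdmissibleDomain Ω)
    {e : Triples Ω} (he : IsSmoothTriple e fun _ => 1) {y : Triples Ω} (hy : y ∈ traceSpace Ω) :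
    ∃ c : ℂ, y - c • e ∈ freeSpace Ω := by
  have h0 : inner ℂ (trL Ω e) (trL Ω e) ≠ (0 : ℂ) :=
    inner_self_ne_zero.2 (hΩ.trL_one_ne_zero hd he)
  refine ⟨inner ℂ (trL Ω e) (trL Ω y) / inner ℂ (trL Ω e) (trL Ω e),
    sub_mem hy (Submodule.smul_mem _ _ he.mem), ?_⟩
  rw [SetLike.mem_coe, Submodule.mem_comap, ContinuousLinearMap.coe_coe, he.mem_meanFree_iff, map_sub, map_smul,
    inner_sub_right, inner_smul_right, div_mul_cancel₀ _ h0, sub_self]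

theorem gradSq_smul (c : ℂ) (y : Triples Ω) : gradSq (c • y) = ‖c‖ ^ 2 * gradSq y := by
  simp only [gradSq, map_smul, norm_smul, mul_pow, Finset.mul_sum]

/-- The Poincaré inequality for mean-free traces. -/
theorem IsAdmissibleDomain.poincare (hd : 2 ≤ d) (hΩ : IsAdmissibleDomain Ω) :
    ∃ C : ℝ, 0 < C ∧ ∀ y ∈ freeSpace Ω, ‖y‖ ^ 2 ≤ C * gradSq y := by
  by_contra! hcon
  -- Normalized counterexamples have gradients tending to zero. Compactness of function and trace
  -- then makes a subsequence converge in the full norm, so the limit keeps norm one.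
  have hseq : ∀ n : ℕ, ∃ y ∈ freeSpace Ω, ‖y‖ = 1 ∧ gradSq y ≤ 1 / ((n : ℝ) + 1) := by
    intro n
    obtain ⟨y, hy, hlt⟩ := hcon ((n : ℝ) + 1) (by positivity)
    have hy0 : 0 < ‖y‖ := by
      have h1 : 0 < ‖y‖ ^ 2 := lt_of_le_of_lt
        (mul_nonneg (by positivity) (gradSq_nonneg y)) hlt
      exact (norm_nonneg y).lt_of_ne fun h => by rw [← h] at h1; simp at h1
    refine ⟨((‖y‖ : ℂ)⁻¹) • y, Submodule.smul_mem _ _ hy, ?_, ?_⟩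
    · rw [norm_smul, norm_inv, Complex.norm_real, norm_norm, inv_mul_cancel₀ hy0.ne']
    · rw [gradSq_smul, norm_inv, Complex.norm_real, norm_norm, le_div_iff₀ (by positivity), inv_pow,
        mul_assoc, inv_mul_le_iff₀ (by positivity), mul_one, mul_comm]
      exact hlt.le
  choose y hyX hy1 hyg using hseq
  let x : ℕ → traceSpace Ω := fun n => ⟨y n, (hyX n).1⟩
  have hx1 : ∀ n, x n ∈ Metric.closedBall (0 : traceSpace Ω) 1 := fun n => by
    rw [mem_closedBall_zero_iff]
    exact (hy1 n).le
  obtain ⟨K, hK, hsub⟩ := hΩ.isCompactOperator_valL.image_closedBall_subset_compact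
    (f := ((valL Ω).comp (traceSpace Ω).subtypeL : traceSpace Ω →ₗ[ℂ] DomainL2 Ω)) 1
  obtain ⟨a, -, φ, hφ, ha⟩ := hK.tendsto_subseq (x := fun n => valL Ω (y n))
    (fun n => hsub ⟨x n, hx1 n, rfl⟩)
  obtain ⟨K', hK', hsub'⟩ := hΩ.isCompactOperator_trL.image_closedBall_subset_compact
    (f := ((trL Ω).comp (traceSpace Ω).subtypeL : traceSpace Ω →ₗ[ℂ] BoundaryL2 Ω)) 1
  obtain ⟨b, -, ψ, hψ, hb⟩ := hK'.tendsto_subseq (x := fun n => trL Ω (y (φ n)))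
    (fun n => hsub' ⟨x (φ n), hx1 _, rfl⟩)
  have hlim0 : Tendsto (fun n => gradSq (y (φ (ψ n)))) atTop (𝓝 0) := by
    have h1 : Tendsto (fun n => gradSq (y n)) atTop (𝓝 0) :=
      squeeze_zero (fun n => gradSq_nonneg _) hyg tendsto_one_div_add_atTop_nhds_zero_nat
    exact h1.comp (hφ.comp hψ).tendsto_atTop
  have hgrad : ∀ i, Tendsto (fun n => gradL Ω i (y (φ (ψ n)))) atTop (𝓝 0) := by
    intro i
    rw [tendsto_zero_iff_norm_tendsto_zero]
    have h1 : Tendsto (fun n => ‖gradL Ω i (y (φ (ψ n)))‖ ^ 2) atTop (𝓝 0) :=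
      squeeze_zero (fun n => sq_nonneg _) (fun n => Finset.single_le_sum
        (f := fun i => ‖gradL Ω i (y (φ (ψ n)))‖ ^ 2) (fun _ _ => sq_nonneg _)
        (Finset.mem_univ i)) hlim0
    have h2 := h1.sqrt
    simpa using h2
  have hlim := tendsto_triple (y := fun n => y (φ (ψ n))) (ha.comp hψ.tendsto_atTop) hgrad hb
  set z := mkTriple Ω (a, fun _ => 0, b) with hz
  have hzX : z ∈ freeSpace Ω :=
    isClosed_freeSpace.mem_of_tendsto hlim (Eventually.of_forall fun n => hyX _)
  have hz1 : ‖z‖ = 1 := tendsto_nhds_unique hlim.norm (by simp only [hy1]; exact tendsto_const_nhds)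
  obtain ⟨e, he⟩ := hΩ.exists_isSmoothTriple (w := fun _ => 1) contDiff_const
  obtain ⟨c, hc⟩ := hΩ.exists_eq_smul_one he hzX.1 fun i => rfl
  -- The limit is a multiple of the constant function with mean-free trace, hence zero.
  have hm : inner ℂ (trL Ω e) (trL Ω z) = (0 : ℂ) := he.mem_meanFree_iff.1 hzX.2
  rw [hc, map_smul, inner_smul_right, mul_eq_zero, inner_self_eq_zero] at hm
  rcases hm with hm | hm
  · rw [hc, hm, zero_smul, norm_zero] at hz1
    exact zero_ne_one hz1
  · exact hΩ.trL_one_ne_zero hd he hm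

/-- The mean-free subspace is infinite-dimensional. -/
theorem IsAdmissibleDomain.meanFree_infinite (hd : 2 ≤ d) (hΩ : IsAdmissibleDomain Ω) :
    ¬ FiniteDimensional ℂ (meanFree Ω) := by
  intro hfin
  have hfm := hΩ.isFiniteMeasure_surface
  obtain ⟨e, he⟩ := hΩ.exists_isSmoothTriple (w := fun _ => 1) contDiff_const
  -- The mean-free subspace and the line of constants span everything, so it is enough to refute
  -- finite dimension of L²(∂Ω).
  have htop : FiniteDimensional ℂ (BoundaryL2 Ω) := by
    rw [he.meanFree_eq] at hfin
    have h1 : FiniteDimensional ℂ (Submodule.span ℂ {trL Ω e} ⊔ (Submodule.span ℂ {trL Ω e})ᗮ :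
      Submodule ℂ (BoundaryL2 Ω)) := inferInstance
    rw [Submodule.sup_orthogonal_of_hasOrthogonalProjection] at h1
    exact Module.Finite.equiv (Submodule.topEquiv (R := ℂ) (M := BoundaryL2 Ω))
  have : Infinite (frontier Ω) := (hΩ.frontier_infinite hd).to_subtype
  -- Disjoint relatively open boundary sets have positive surface measure, so their indicators are
  -- nonzero and orthogonal.
  obtain ⟨U, hUinf, hUo, hUd⟩ := exists_seq_infinite_isOpen_pairwise_disjoint (frontier Ω)
  let S : ℕ → Set (EuclideanSpace ℝ (Fin d)) := fun n => Subtype.val '' U n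
  have hSm : ∀ n, MeasurableSet (S n) := fun n =>
    (MeasurableEmbedding.subtype_coe isClosed_frontier.measurableSet).measurableSet_image.2
      (hUo n).measurableSet
  have hSd : ∀ m n, m ≠ n → S m ∩ S n = ∅ := fun m n hmn => by
    rw [← Set.disjoint_iff_inter_eq_empty]
    exact (Set.disjoint_image_iff Subtype.val_injective).2 (hUd hmn)
  have hS0 : ∀ n, surface Ω (S n) ≠ 0 := by
    intro n
    obtain ⟨x, hx⟩ := (hUinf n).nonempty
    obtain ⟨V, hV, hVU⟩ := isOpen_induced_iff.1 (hUo n)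
    have hxV : x.1 ∈ V := by
      rw [← hVU] at hx
      exact hx
    obtain ⟨r, hr, hrV⟩ := Metric.isOpen_iff.1 hV x.1 hxV
    have h1 := hΩ.surface_ball_pos x.2 hr
    rw [← surface_restrict_frontier, Measure.restrict_apply measurableSet_ball] at h1
    refine (h1.trans_le (measure_mono ?_)).ne'
    rintro z ⟨hz1, hz2⟩
    refine ⟨⟨z, hz2⟩, ?_, rfl⟩
    rw [← hVU]
    exact hrV hz1
  have hfinS : ∀ n, surface Ω (S n) ≠ ⊤ := fun n => measure_ne_top _ _
  have hli : LinearIndependent ℂ fun n => indicatorConstLp 2 (hSm n) (hfinS n) (1 : ℂ) := by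
    refine linearIndependent_of_ne_zero_of_inner_eq_zero (fun n h0 => ?_) fun m n hmn => ?_
    · have h1 := norm_indicatorConstLp (p := 2) (hs := hSm n) (hμs := hfinS n) (c := (1 : ℂ))
        (by simp) (by simp)
      rw [h0, norm_zero, norm_one, one_mul] at h1
      have h2 : 0 < (surface Ω).real (S n) := measureReal_nonneg.lt_of_ne'
        ((measureReal_ne_zero_iff (hfinS n)).2 (hS0 n))
      exact (Real.rpow_pos_of_pos h2 _).ne h1
    · change inner ℂ (indicatorConstLp 2 (hSm m) (hfinS m) (1 : ℂ))
        (indicatorConstLp 2 (hSm n) (hfinS n) (1 : ℂ)) = 0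
      rw [L2.inner_indicatorConstLp_eq_inner_setIntegral, setIntegral_indicatorConstLp (hSm m),
        Set.inter_comm, hSd m n hmn]
      simp
  exact not_finite_iff_infinite.2 inferInstance hli.finite

end Correspondence

/-! ### The solution operator -/

/-- For a coercive symmetric `A` and a compact `B` whose adjoint is injective, the operator
`B A⁻¹ B†` is compact, symmetric and positive. -/
theorem exists_solutionOperator {X H : Type*} [NormedAddCommGroup X] [InnerProductSpace ℂ X]
    [CompleteSpace X] [NormedAddCommGroup H] [InnerProductSpace ℂ H] [CompleteSpace H]
    {A : X →L[ℂ] X} {c : ℝ} (hc : 0 < c) (hA : ∀ x, c * ‖x‖ ^ 2 ≤ (inner ℂ (A x) x).re)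
    (hs : A.IsSymmetric) {B : X →L[ℂ] H} (hB : IsCompactOperator B)
    (hinj : ∀ f, B.adjoint f = 0 → f = 0) :
    ∃ T : H →L[ℂ] H, IsCompactOperator T ∧ T.IsSymmetric ∧
      (∀ f, f ≠ 0 → 0 < (inner ℂ f (T f)).re) ∧
      ∀ f U, U = T f ↔ ∃ x, A x = B.adjoint f ∧ B x = U := by
  -- The Lax–Milgram step: coercivity makes `A` invertible.
  have hunit : IsUnit A := by
    refine A.isUnit_of_forall_le_norm_inner_map (c := ⟨c, hc.le⟩) hc fun x => ?_
    rw [mul_comm]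
    exact (hA x).trans (Complex.re_le_norm _)
  obtain ⟨⟨A', S, hAS, hSA⟩, rfl⟩ := hunit
  change ∀ x, c * ‖x‖ ^ 2 ≤ (inner ℂ (A' x) x).re at hA
  change (A' : X →ₗ[ℂ] X).IsSymmetric at hs
  have hAS' : ∀ x, A' (S x) = x := fun x => congrArg (fun F : X →L[ℂ] X => F x) hAS
  have hSA' : ∀ x, S (A' x) = x := fun x => congrArg (fun F : X →L[ℂ] X => F x) hSA
  have hs' : ∀ x y, inner ℂ (A' x) y = inner ℂ x (A' y) := hs
  have hSs : ∀ x y, inner ℂ (S x) y = inner ℂ x (S y) := fun x y => by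
    rw [← hAS' y, ← hs', hAS', hSA']
  refine ⟨B.comp (S.comp B.adjoint), hB.comp_clm (S.comp B.adjoint), fun f g => ?_, fun f hf => ?_,
    fun f U => ?_⟩
  · change inner ℂ (B (S (B.adjoint f))) g = inner ℂ f (B (S (B.adjoint g)))
    rw [← ContinuousLinearMap.adjoint_inner_right, hSs, ContinuousLinearMap.adjoint_inner_left]
  · change 0 < (inner ℂ f (B (S (B.adjoint f)))).re
    have h0 : S (B.adjoint f) ≠ 0 := fun h => hf (hinj f (by rw [← hAS' (B.adjoint f), h, map_zero]))
    rw [← ContinuousLinearMap.adjoint_inner_left]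
    have h1 := hA (S (B.adjoint f))
    rw [hAS'] at h1
    have h2 : 0 < ‖S (B.adjoint f)‖ ^ 2 := by positivity
    exact (mul_pos hc h2).trans_le h1
  · change U = B (S (B.adjoint f)) ↔ ∃ x, A' x = B.adjoint f ∧ B x = U
    constructor
    · rintro rfl
      exact ⟨S (B.adjoint f), hAS' _, rfl⟩
    · rintro ⟨x, hx, rfl⟩
      rw [← hx, hSA']

/-- A coercive variational problem on a closed subspace `K`, with data and solutions observed through
`t : K → N`, has a compact, symmetric and positive solution operator. -/
theorem exists_variational_solutionOperator {E D H ι : Type*} [Fintype ι]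
    [NormedAddCommGroup E] [InnerProductSpace ℂ E]
    [NormedAddCommGroup D] [InnerProductSpace ℂ D] [CompleteSpace D]
    [NormedAddCommGroup H] [InnerProductSpace ℂ H]
    (K : Submodule ℂ E) [CompleteSpace K] (N : Submodule ℂ H) [CompleteSpace N]
    (hN : IsClosed (N : Set H))
    {g : ι → E →L[ℂ] D} {t : E →L[ℂ] H} {M : D →L[ℂ] D} {a C : ℝ} (ha : 0 < a) (hC : 0 < C)
    (hM : ∀ u v, inner ℂ (M u) v = inner ℂ u (M v)) (hMa : ∀ u, a * ‖u‖ ^ 2 ≤ (inner ℂ u (M u)).re)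
    (hP : ∀ x ∈ K, ‖x‖ ^ 2 ≤ C * ∑ i, ‖g i x‖ ^ 2) (ht : ∀ x ∈ K, t x ∈ N)
    (hcpt : IsCompactOperator fun x : K => t x)
    (hinj : ∀ f ∈ N, (∀ x ∈ K, inner ℂ f (t x) = 0) → f = 0) :
    ∃ T : N →L[ℂ] N, IsCompactOperator T ∧ T.IsSymmetric ∧
      (∀ f, f ≠ 0 → 0 < (inner ℂ f (T f)).re) ∧
      ∀ f U : N, U = T f ↔ ∃ x ∈ K,
        (∀ y ∈ K, ∑ i, inner ℂ (g i y) (M (g i x)) = inner ℂ (t y) (f : H)) ∧ t x = U := by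
  let B : K →L[ℂ] N := (t.comp K.subtypeL).codRestrict N fun x => ht x x.2
  -- This operator represents the sesquilinear form; `hP` and `hMa` make it coercive with constant
  -- a/C.
  let A : K →L[ℂ] K := ∑ i, ((g i).comp K.subtypeL).adjoint.comp (M.comp ((g i).comp K.subtypeL))
  have hinner : ∀ x y : K, inner ℂ y (A x) = ∑ i, inner ℂ (g i y) (M (g i x)) := by
    intro x y
    rw [_root_.sum_apply, inner_sum]
    refine Finset.sum_congr rfl fun i _ => ?_
    rw [ContinuousLinearMap.comp_apply, ContinuousLinearMap.adjoint_inner_right]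
    rfl
  have hsymm : A.IsSymmetric := by
    intro x y
    change inner ℂ (A x) y = inner ℂ x (A y)
    rw [← inner_conj_symm, hinner, hinner, map_sum]
    refine Finset.sum_congr rfl fun i _ => ?_
    rw [inner_conj_symm, hM]
  have hcoer : ∀ x : K, a / C * ‖x‖ ^ 2 ≤ (inner ℂ (A x) x).re := by
    intro x
    have h1 : inner ℂ (A x) x = inner ℂ x (A x) := hsymm x x
    have h2 : ‖x‖ ^ 2 ≤ C * ∑ i, ‖g i x‖ ^ 2 := hP x x.2
    rw [h1, hinner, Complex.re_sum]
    calc a / C * ‖x‖ ^ 2 ≤ a / C * (C * ∑ i, ‖g i x‖ ^ 2) := by gcongr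
      _ = ∑ i, a * ‖g i x‖ ^ 2 := by
          rw [← Finset.mul_sum]
          field_simp
      _ ≤ _ := Finset.sum_le_sum fun i _ => hMa _
  have hBinj : ∀ f, B.adjoint f = 0 → f = 0 := by
    refine fun f hf => Subtype.ext (hinj f f.2 fun x hx => ?_)
    have h1 := ContinuousLinearMap.adjoint_inner_left B ⟨x, hx⟩ f
    rw [hf, inner_zero_left] at h1
    exact h1.symm
  have hBc : IsCompactOperator B := IsCompactOperator.codRestrict hcpt (fun x => ht x x.2) hN
  obtain ⟨T, h1, h2, h3, h4⟩ := exists_solutionOperator (div_pos ha hC) hcoer hsymm hBc hBinj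
  refine ⟨T, h1, h2, h3, fun f U => (h4 f U).trans ⟨?_, ?_⟩⟩
  · rintro ⟨x, hx, rfl⟩
    refine ⟨x, x.2, fun y hy => ?_, rfl⟩
    rw [← hinner x ⟨y, hy⟩, hx, ContinuousLinearMap.adjoint_inner_right]
    rfl
  · rintro ⟨x, hxK, hx, hU⟩
    refine ⟨⟨x, hxK⟩, ext_inner_left ℂ fun y => ?_, Subtype.ext hU⟩
    rw [hinner, ContinuousLinearMap.adjoint_inner_right]
    exact hx y y.2

/-! ### The conductivity form and the Neumann-to-Dirichlet operator. -/

section Conductivity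

variable {d : ℕ} {Ω : Set (EuclideanSpace ℝ (Fin d))} {σ : EuclideanSpace ℝ (Fin d) → ℝ}

/-- Multiplication by a conductivity. -/
theorem IsConductivity.exists_mulOperator (hσ : IsConductivity Ω σ) :
    ∃ M : DomainL2 Ω →L[ℂ] DomainL2 Ω, ∀ u, M u =ᵐ[volume.restrict Ω] fun x => (σ x : ℂ) * u x := by
  have hm : MemLp (fun x => (σ x : ℂ)) ∞ (volume.restrict Ω) := hσ.1.ofReal
  refine ⟨(ContinuousLinearMap.mul ℂ ℂ).holderL (volume.restrict Ω) ∞ 2 2 (hm.toLp _), fun u => ?_⟩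
  refine ((ContinuousLinearMap.mul ℂ ℂ).coeFn_holder (hm.toLp _) u).trans ?_
  exact hm.coeFn_toLp.mono fun x hx => by simp [hx]

theorem inner_mulOperator {M : DomainL2 Ω →L[ℂ] DomainL2 Ω}
    (hM : ∀ u, M u =ᵐ[volume.restrict Ω] fun x => (σ x : ℂ) * u x) (u v : DomainL2 Ω) :
    inner ℂ v (M u) = ∫ x in Ω, (σ x : ℂ) * (u x * conj (v x)) := by
  rw [L2.inner_def]
  refine integral_congr_ae ((hM u).mono fun x hx => ?_)
  simp only [hx, RCLike.inner_apply, mul_assoc]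

theorem integrable_mulOperator {M : DomainL2 Ω →L[ℂ] DomainL2 Ω}
    (hM : ∀ u, M u =ᵐ[volume.restrict Ω] fun x => (σ x : ℂ) * u x) (u v : DomainL2 Ω) :
    Integrable (fun x => (σ x : ℂ) * (u x * conj (v x))) (volume.restrict Ω) := by
  refine (L2.integrable_inner (𝕜 := ℂ) v (M u)).congr ((hM u).mono fun x hx => ?_)
  simp only [hx, RCLike.inner_apply, mul_assoc]

theorem mulOperator_symm {M : DomainL2 Ω →L[ℂ] DomainL2 Ω}
    (hM : ∀ u, M u =ᵐ[volume.restrict Ω] fun x => (σ x : ℂ) * u x) (u v : DomainL2 Ω) :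
    inner ℂ (M u) v = inner ℂ u (M v) := by
  rw [← inner_conj_symm, inner_mulOperator hM, inner_mulOperator hM, ← integral_conj]
  refine integral_congr_ae (Eventually.of_forall fun x => ?_)
  simp only [map_mul, Complex.conj_ofReal, Complex.conj_conj]
  ring

theorem mulOperator_coercive {M : DomainL2 Ω →L[ℂ] DomainL2 Ω}
    (hM : ∀ u, M u =ᵐ[volume.restrict Ω] fun x => (σ x : ℂ) * u x) {a : ℝ}
    (ha : ∀ᵐ x ∂(volume.restrict Ω), a ≤ σ x) (u : DomainL2 Ω) :
    a * ‖u‖ ^ 2 ≤ (inner ℂ u (M u)).re := by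
  have h1 := L2.integrable_inner (𝕜 := ℂ) u u
  have h2 := integrable_mulOperator hM u u
  have h3 : ‖u‖ ^ 2 = ∫ x in Ω, (inner ℂ (u x) (u x)).re := by
    have h4 : ∫ x in Ω, (inner ℂ (u x) (u x)).re = (∫ x in Ω, inner ℂ (u x) (u x)).re :=
      integral_re h1
    rw [h4, ← L2.inner_def, inner_self_eq_norm_sq_to_K]
    norm_cast
  have h5 : (inner ℂ u (M u)).re = ∫ x in Ω, ((σ x : ℂ) * (u x * conj (u x))).re := by
    rw [inner_mulOperator hM]
    exact (integral_re h2).symm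
  rw [h3, h5, ← integral_const_mul]
  refine integral_mono_ae (h1.re.const_mul a) h2.re (ha.mono fun x hx => ?_)
  simp only [RCLike.inner_apply, Complex.mul_conj, Complex.ofReal_re,
    Complex.re_ofReal_mul]
  exact mul_le_mul_of_nonneg_right hx (Complex.normSq_nonneg _)

/-- Subtracting a constant puts any smooth triple into `freeSpace` without changing the pairing with
the mean-free `f`. Thus `f` is orthogonal to the test functions, which are dense in L²(∂Ω). This is
the injectivity of B† behind positivity. -/
theorem IsAdmissibleDomain.eq_zero_of_inner_trL (hd : 2 ≤ d) (hΩ : IsAdmissibleDomain Ω)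
    (f : BoundaryL2 Ω) (hf : f ∈ meanFree Ω)
    (hort : ∀ x ∈ freeSpace Ω, inner ℂ f (trL Ω x) = 0) : f = 0 := by
  have := hΩ.isFiniteMeasure_surface
  obtain ⟨e, he⟩ := hΩ.exists_isSmoothTriple (w := fun _ => 1) contDiff_const
  have hfe : inner ℂ f (trL Ω e) = 0 := inner_eq_zero_symm.1 (he.mem_meanFree_iff.1 hf)
  have hdense := Lp.dense_hasCompactSupport_contDiff (F := ℂ) (μ := surface Ω) (p := 2) (by simp)
  refine hdense.eq_zero_of_inner_left ℂ fun g hg => ?_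
  obtain ⟨w, hgw, -, hw⟩ := hg
  obtain ⟨y, hy⟩ := hΩ.exists_isSmoothTriple hw
  have hgy : g = trL Ω y := Lp.ext (hgw.trans hy.trace.symm)
  obtain ⟨c, hc⟩ := hΩ.exists_sub_smul_mem_freeSpace hd he hy.mem
  have h1 := hort _ hc
  rw [map_sub, map_smul, inner_sub_right, inner_smul_right, hfe, mul_zero, sub_zero] at h1
  rw [hgy, h1]

theorem integral_energy {M : DomainL2 Ω →L[ℂ] DomainL2 Ω}
    (hM : ∀ u, M u =ᵐ[volume.restrict Ω] fun x => (σ x : ℂ) * u x)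
    {G H : Fin d → EuclideanSpace ℝ (Fin d) → ℂ} {g h : Fin d → DomainL2 Ω}
    (hg : ∀ i, g i =ᵐ[volume.restrict Ω] G i) (hh : ∀ i, h i =ᵐ[volume.restrict Ω] H i) :
    ∫ x in Ω, (σ x : ℂ) * ∑ i, G i x * conj (H i x) = ∑ i, inner ℂ (h i) (M (g i)) := by
  simp only [inner_mulOperator hM]
  rw [← integral_finsetSum _ fun i _ => integrable_mulOperator hM _ _]
  refine integral_congr_ae ?_
  filter_upwards [ae_all_iff.2 hg, ae_all_iff.2 hh] with x h1 h2
  simp only [h1, h2, Finset.mul_sum]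

theorem integral_boundary (f V : BoundaryL2 Ω) :
    ∫ x, f x * conj (V x) ∂(surface Ω) = inner ℂ V f := by
  rw [L2.inner_def]
  rfl

/-- Boundary potentials are the traces of the solutions of the variational problem in the mean-free
trace space. -/
theorem isBoundaryPotential_iff (hd : 2 ≤ d) (hΩ : IsAdmissibleDomain Ω)
    {M : DomainL2 Ω →L[ℂ] DomainL2 Ω}
    (hM : ∀ u, M u =ᵐ[volume.restrict Ω] fun x => (σ x : ℂ) * u x) (f U : meanFree Ω) :
    IsBoundaryPotential Ω σ f U ↔ ∃ x ∈ freeSpace Ω,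
      (∀ y ∈ freeSpace Ω, ∑ i, inner ℂ (gradL Ω i y) (M (gradL Ω i x)) =
        inner ℂ (trL Ω y) (f : BoundaryL2 Ω)) ∧ trL Ω x = U := by
  constructor
  · rintro ⟨u, G, ⟨hu, hweak⟩, ht⟩
    refine ⟨hu.triple U, ⟨ht.triple_mem hΩ hu, U.2⟩, fun y hy => ?_, rfl⟩
    have h1 := hweak _ _ _ (memH1_of_mem hΩ hy.1) (hasTrace_of_mem hy.1)
    rw [integral_boundary, integral_energy hM (g := fun i => (hu.memLp_grad i).toLp (G i))
      (h := fun i => gradL Ω i y) (fun i => MemLp.coeFn_toLp _) fun i => EventuallyEq.refl _ _] at h1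
    exact h1
  · rintro ⟨x, hx, heq, hU⟩
    obtain rfl : U = ⟨trL Ω x, hx.2⟩ := Subtype.ext hU.symm
    refine ⟨valL Ω x, fun i => gradL Ω i x, ⟨memH1_of_mem hΩ hx.1, fun v H V hv ht => ?_⟩,
      hasTrace_of_mem hx.1⟩
    obtain ⟨e, he⟩ := hΩ.exists_isSmoothTriple (w := fun _ => 1) contDiff_const
    -- A general test function is made mean-free by a constant, which has zero gradient and pairs to
    -- zero with `f`, so both sides of the weak equation are unchanged.
    obtain ⟨c, hc⟩ := hΩ.exists_sub_smul_mem_freeSpace hd he (ht.triple_mem hΩ hv)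
    have h1 := heq _ hc
    simp only [map_sub, map_smul, he.gradL_eq_zero, smul_zero, sub_zero] at h1
    rw [inner_sub_left, inner_smul_left, he.mem_meanFree_iff.1 f.2, mul_zero, sub_zero] at h1
    rw [integral_boundary, integral_energy hM (g := fun i => gradL Ω i x)
      (h := fun i => (hv.memLp_grad i).toLp (H i)) (fun i => EventuallyEq.refl _ _)
      fun i => MemLp.coeFn_toLp _]
    exact h1

theorem exists_neumannToDirichlet (hd : 2 ≤ d) (hΩ : IsAdmissibleDomain Ω)
    (hσ : IsConductivity Ω σ) :
    ∃ T : meanFree Ω →L[ℂ] meanFree Ω, IsCompactOperator T ∧ T.IsSymmetric ∧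
      (∀ f, f ≠ 0 → 0 < (inner ℂ f (T f)).re) ∧
      ∀ f U, IsBoundaryPotential Ω σ f U ↔ U = T f := by
  obtain ⟨M, hM⟩ := hσ.exists_mulOperator
  obtain ⟨a, ha, haσ⟩ := hσ.2
  obtain ⟨C, hC, hP⟩ := hΩ.poincare hd
  obtain ⟨T, h1, h2, h3, h4⟩ := exists_variational_solutionOperator (E := Triples Ω)
    (D := DomainL2 Ω) (freeSpace Ω) (meanFree Ω) (Submodule.isClosed_orthogonal _)
    (g := gradL Ω) (t := trL Ω) ha hC (mulOperator_symm hM) (mulOperator_coercive hM haσ)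
    hP (fun x hx => hx.2)
    (hΩ.isCompactOperator_trL.comp_clm ((freeSpace Ω).subtypeL.codRestrict (traceSpace Ω)
      fun x => x.2.1)) (hΩ.eq_zero_of_inner_trL hd)
  exact ⟨T, h1, h2, h3, fun f U => (isBoundaryPotential_iff hd hΩ hM f U).trans (h4 f U).symm⟩

theorem neumannToDirichlet_spec (hd : 2 ≤ d) (hΩ : IsAdmissibleDomain Ω)
    (hσ : IsConductivity Ω σ) (f U : meanFree Ω) :
    IsBoundaryPotential Ω σ f U ↔ U = neumannToDirichlet Ω σ f := by
  obtain ⟨T, -, -, -, hT⟩ := exists_neumannToDirichlet hd hΩ hσ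
  have h : ∃ T : meanFree Ω →L[ℂ] meanFree Ω, ∀ f U, IsBoundaryPotential Ω σ f U ↔ U = T f := ⟨T, hT⟩
  rw [neumannToDirichlet, dif_pos h]
  exact h.choose_spec f U

end Conductivity

end EIT

end

theorem mainTheorem2 (d : ℕ) (hd : 2 ≤ d) (Ω : Set (EuclideanSpace ℝ (Fin d)))
    (hΩ : EIT.IsAdmissibleDomain Ω) (σ : EuclideanSpace ℝ (Fin d) → ℝ)
    (hσ : EIT.IsConductivity Ω σ) :
    -- `Λ(σ)` is well defined: `Λ(σ) f` is the unique mean-free boundary potential for `f`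
    (∀ f U : EIT.meanFree Ω,
      EIT.IsBoundaryPotential Ω σ f U ↔ U = EIT.neumannToDirichlet Ω σ f) ∧
    -- `Λ(σ)` is compact, self-adjoint and positive
    IsCompactOperator (EIT.neumannToDirichlet Ω σ) ∧
    IsSelfAdjoint (EIT.neumannToDirichlet Ω σ) ∧
    (∀ f : EIT.meanFree Ω, f ≠ 0 → 0 < (inner ℂ f (EIT.neumannToDirichlet Ω σ f)).re) ∧
    -- `Λ(σ)` has an eigensystem
    (∃ (φ : HilbertBasis ℕ ℂ (EIT.meanFree Ω)) (lam : ℕ → ℝ),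
      EIT.IsEigensystem (EIT.neumannToDirichlet Ω σ) φ lam) ∧
    -- the logarithm defined through any eigensystem is densely defined, self-adjoint, unbounded
    (∀ (φ : HilbertBasis ℕ ℂ (EIT.meanFree Ω)) (lam : ℕ → ℝ),
      EIT.IsEigensystem (EIT.neumannToDirichlet Ω σ) φ lam →
        Dense ((EIT.spectralLog φ lam).domain : Set (EIT.meanFree Ω)) ∧
        IsSelfAdjoint (EIT.spectralLog φ lam) ∧
        ¬ ∃ C : ℝ, ∀ g : (EIT.spectralLog φ lam).domain, ‖EIT.spectralLog φ lam g‖ ≤ C * ‖g‖) := by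
  have hspec := EIT.neumannToDirichlet_spec hd hΩ hσ
  obtain ⟨T, hTc, hTs, hTp, hT⟩ := EIT.exists_neumannToDirichlet hd hΩ hσ
  -- An operator is determined by its graph, so the constructed `T` is the chosen one and its
  -- properties transfer.
  obtain rfl : T = EIT.neumannToDirichlet Ω σ :=
    ContinuousLinearMap.ext fun f => (hspec f (T f)).1 ((hT f (T f)).2 rfl)
  exact ⟨hspec, hTc, hTs.isSelfAdjoint, hTp,
    EIT.exists_isEigensystem (hΩ.meanFree_infinite hd) hTc hTs hTp,
    fun φ lam h => ⟨EIT.dense_spectralLog_domain φ lam, EIT.isSelfAdjoint_spectralLog φ lam,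
      EIT.spectralLog_unbounded h⟩⟩
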